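/- Let $k$ be an algebraically closed field of characteristic zero (for instance $k=\mathbb{C}$), let $X$ be a smooth projective variety over $k$, let $L$ be a line bundle on $X$, let $E$ be a vector bundle of finite rank on $X$, and let $p\ge 0$ be an integer. For $q\ge 1$ let $\mathcal{K}_{p,q}(X,E,L)$ be the Koszul cohomology group of $B=\bigoplus_{q}B_q$, $B_q=H^0(X,E\otimes L^{\otimes q})$, with respect to $V=H^0(X,L)$, that is, the quotient $\operatorname{Ker}(d_{p,q})/\operatorname{Im}(d_{p+1,q-1})$ for the Koszul complex $$\wedge^{p+1}V\otimes B_{q-1}\xrightarrow{d_{p+1,q-1}}\wedge^pV\otimes B_q\xrightarrow{d_{p,q}}\wedge^{p-1}V\otimes B_{q+1},\qquad d(v_1\wedge\cdots\wedge v_p\otimes b)=\sum_i(-1)^{i-1}\,v_1\wedge\cdots\widehat{v_i}\cdots\wedge v_p\otimes v_ib,$$ where $\wedge^{-1}V=0$. For $r\ge 2$ let $X(r)=X\times\cdots\times X$ be the product of $r$ copies of $X$ over $k$, with projections $\operatorname{pr}_i$ to $X$ and $\operatorname{pr}_{i,j}=(\operatorname{pr}_i,\operatorname{pr}_j)$ to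 $X\times X$. Let $\Delta^{1,i}=\operatorname{pr}_{1,i}^{-1}(\Delta_X)\subset X(r)$ be the locus where the first and $i$-th coordinates agree, with ideal sheaf $\mathcal{I}_{\Delta^{1,i}}$, and put $$\mathcal{I}^1_{\Delta}(r)=\mathcal{I}_{\Delta^{1,2}}\otimes\mathcal{I}_{\Delta^{1,3}}\otimes\cdots\otimes\mathcal{I}_{\Delta^{1,r}}.$$ For sheaves $F_1,\dots,F_r$ on $X$ write $F_1\boxtimes\cdots\boxtimes F_r=\operatorname{pr}_1^*F_1\otimes\cdots\otimes\operatorname{pr}_r^*F_r$. Suppose that $$H^1\bigl(X(r),\ \mathcal{I}^1_{\Delta}(r)\otimes\bigl((E\otimes L^{\otimes m})\boxtimes L\boxtimes\cdots\boxtimes L\bigr)\bigr)=0\qquad\text{for all } 2\le r\le p+2 \text{ and all } m\ge 1.$$ Then $\mathcal{K}_{p,q}(X,E,L)=0$ for all $q\ge 2$. -/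

import Mathlib

open CategoryTheory CategoryTheory.Limits AlgebraicGeometry TopologicalSpace Opposite
open scoped TensorProduct

universe u

noncomputable section

namespace GreenKoszul

/-! ### Koszul cohomology of a graded module -/

section Koszul

variable {k : Type u} [CommRing k] {V : Type u} [AddCommGroup V] [Module k V]

/-- For a bilinear multiplication `V × B → B'`, the linear map
`v ↦ (w ↦ (b ↦ (v * b) ⊗ w))` with `w ∈ ⋀ᵖ V`, as an alternating map in the factors of `w`. -/
def koszulAux {B B' : Type u} [AddCommGroup B] [Module k B] [AddCommGroup B'] [Module k B']
    (mul : V →ₗ[k] B →ₗ[k] B') (p : ℕ) :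
    V →ₗ[k] V [⋀^Fin p]→ₗ[k] (B →ₗ[k] B' ⊗[k] (⋀[k]^p V)) where
  toFun v := (((TensorProduct.mk k B' (⋀[k]^p V)).comp (mul v)).flip).compAlternatingMap
    (exteriorPower.ιMulti k p)
  map_add' v w := by
    ext x b
    simp
  map_smul' c v := by
    ext x b
    simp [TensorProduct.smul_tmul']

/-- The Koszul differential `⋀ᵖ⁺¹ V ⊗ B → ⋀ᵖ V ⊗ B'` (with the tensor factors written in the
other order). -/
def koszulDiff {B B' : Type u} [AddCommGroup B] [Module k B] [AddCommGroup B'] [Module k B']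
    (mul : V →ₗ[k] B →ₗ[k] B') (p : ℕ) :
    B ⊗[k] (⋀[k]^(p + 1) V) →ₗ[k] B' ⊗[k] (⋀[k]^p V) :=
  TensorProduct.lift (exteriorPower.alternatingMapLinearEquiv
    (AlternatingMap.alternatizeUncurryFin (koszulAux mul p))).flip

/-- `d (b ⊗ v₀ ∧ ⋯ ∧ vₚ) = ∑ᵢ (-1)ⁱ (vᵢ * b) ⊗ v₀ ∧ ⋯ ∧ v̂ᵢ ∧ ⋯ ∧ vₚ`. -/
theorem koszulDiff_tmul {B B' : Type u} [AddCommGroup B] [Module k B] [AddCommGroup B']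
    [Module k B'] (mul : V →ₗ[k] B →ₗ[k] B') (p : ℕ) (v : Fin (p + 1) → V) (b : B) :
    koszulDiff mul p (b ⊗ₜ[k] exteriorPower.ιMulti k (p + 1) v) =
      ∑ i : Fin (p + 1), (-1 : ℤ) ^ (i : ℕ) •
        (mul (v i) b ⊗ₜ[k] exteriorPower.ιMulti k p (i.removeNth v)) := by
  simp [koszulDiff, koszulAux, AlternatingMap.alternatizeUncurryFin_apply,
    LinearMap.sum_apply]

variable {B : ℕ → Type u} [∀ n, AddCommGroup (B n)] [∀ n, Module k (B n)]
  (mul : ∀ n, V →ₗ[k] B n →ₗ[k] B (n + 1))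

/-- The kernel of `d_{p,q} : ⋀ᵖ V ⊗ B_q → ⋀ᵖ⁻¹ V ⊗ B_{q+1}`, where `⋀⁻¹ V = 0`. -/
def koszulCycles : ∀ p q : ℕ, Submodule k (B q ⊗[k] (⋀[k]^p V))
  | 0, _ => ⊤
  | p + 1, q => LinearMap.ker (koszulDiff (mul q) p)

/-- The image of `d_{p+1,q-1} : ⋀ᵖ⁺¹ V ⊗ B_{q-1} → ⋀ᵖ V ⊗ B_q` for a module graded in
degrees `≥ 0`, that is with `B_{-1} = 0`. -/
def koszulBoundaries (p : ℕ) : ∀ q : ℕ, Submodule k (B q ⊗[k] (⋀[k]^p V))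
  | 0 => ⊥
  | q + 1 => LinearMap.range (koszulDiff (mul q) p)

/-- The Koszul cohomology `K_{p,q}(B, V) = Ker d_{p,q} / Im d_{p+1,q-1}`. -/
abbrev KoszulCohomology (p q : ℕ) : Type u :=
  koszulCycles mul p q ⧸ (koszulBoundaries mul p q).submoduleOf (koszulCycles mul p q)

end Koszul

/-! ### Sheaves of modules -/

section Modules

variable {X Y : Scheme.{u}}

/-- The structure sheaf as a module over itself. -/
abbrev structureSheaf (X : Scheme.{u}) : X.Modules := SheafOfModules.unit X.ringCatSheaf

/-- The presheaf `U ↦ M(U) ⊗ N(U)`, the tensor products being over `𝒪_X(U)`. -/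
def presheafTensor (M N : X.Modules) : X.PresheafOfModules :=
  PresheafOfModules.Monoidal.tensorObj (R := X.presheaf) M.val N.val

/-- The tensor product over `𝒪_X`: the sheaf associated with the presheaf tensor product. -/
def tensor (M N : X.Modules) : X.Modules :=
  (PresheafOfModules.sheafification (𝟙 X.ringCatSheaf.obj)).obj (presheafTensor M N)

/-- The canonical map `M(U) ⊗ N(U) → (M ⊗ N)(U)`. -/
def tensorSections (M N : X.Modules) (U : X.Opens) :
    Γ(M, U) ⊗[Γ(X, U)] Γ(N, U) →ₗ[Γ(X, U)] Γ(tensor M N, U) :=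
  (((PresheafOfModules.sheafificationAdjunction (𝟙 X.ringCatSheaf.obj)).unit.app
    (presheafTensor M N)).app (op U)).hom

/-- The tensor product of a list of sheaves of modules. -/
def tensorList (l : List X.Modules) : X.Modules := l.foldr tensor (structureSheaf X)

/-- `F ⊗ L^{⊗ n}`. -/
def twist (F L : X.Modules) : ℕ → X.Modules
  | 0 => F
  | n + 1 => tensor (twist F L n) L

/-- `M` is locally free of finite rank. -/
def IsVectorBundle (M : X.Modules) : Prop :=
  ∀ x : X, ∃ (U : X.Opens) (_ : x ∈ U) (n : ℕ),
    Nonempty (M.restrict U.ι ≅ SheafOfModules.free (R := U.toScheme.ringCatSheaf)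
      (ULift.{u} (Fin n)))

/-- `M` is locally free of rank one. -/
def IsLineBundle (M : X.Modules) : Prop :=
  ∀ x : X, ∃ (U : X.Opens) (_ : x ∈ U), Nonempty (M.restrict U.ι ≅ structureSheaf U.toScheme)

/-- The ideal sheaf of (the scheme-theoretic image of) `g : Y ⟶ X`: the kernel of
`𝒪_X ⟶ g_* 𝒪_Y`. -/
def idealSheaf (g : Y ⟶ X) : X.Modules :=
  kernel (C := X.Modules) (X := structureSheaf X)
    (Y := (Scheme.Modules.pushforward g).obj (structureSheaf Y))
    (SheafOfModules.unitToPushforwardObjUnit g.toRingCatSheafHom)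

/-- The sheaf cohomology group `Hⁿ(X, M)`. -/
abbrev cohomology (M : X.Modules) (n : ℕ) : Type u :=
  Sheaf.H.{u} ((SheafOfModules.toSheaf X.ringCatSheaf).obj M) n

end Modules

/-! ### Varieties over a field -/

section Varieties

variable {k : Type u} [Field k] {X : Scheme.{u}} (f : X ⟶ Spec (CommRingCat.of k))

section

attribute [local instance] MvPolynomial.gradedAlgebra

/-- Projective space `ℙⁿ` over `k`. -/
def projectiveSpace (k : Type u) [Field k] (n : ℕ) : Scheme.{u} :=
  Proj (MvPolynomial.homogeneousSubmodule (Fin (n + 1)) k)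

/-- The structure morphism `ℙⁿ ⟶ Spec k`. -/
def projectiveSpaceHom (k : Type u) [Field k] (n : ℕ) :
    projectiveSpace k n ⟶ Spec (CommRingCat.of k) :=
  Proj.toSpecZero (MvPolynomial.homogeneousSubmodule (Fin (n + 1)) k) ≫
    Spec.map (CommRingCat.ofHom
      (algebraMap k (MvPolynomial.homogeneousSubmodule (Fin (n + 1)) k 0)))

end

/-- `X` is a closed subscheme of some `ℙⁿ` over `k`. -/
def IsProjective : Prop :=
  ∃ (n : ℕ) (i : X ⟶ projectiveSpace k n), IsClosedImmersion i ∧ i ≫ projectiveSpaceHom k n = f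

/-- The structure map `k → Γ(X, 𝒪_X)`. -/
def scalarHom : k →+* Γ(X, ⊤) :=
  ((Scheme.ΓSpecIso (CommRingCat.of k)).inv ≫ f.appTop).hom

/-- `H⁰(X, M)` as a `k`-vector space. -/
def globalSections (M : X.Modules) : ModuleCat.{u} k :=
  (ModuleCat.restrictScalars (scalarHom f)).obj (M.val.obj (op ⊤))

/-- The product of global sections, `H⁰(X, L) × H⁰(X, M) → H⁰(X, M ⊗ L)`, `(s, t) ↦ t ⊗ s`. -/
def sectionsMul (L M : X.Modules) :
    globalSections f L →ₗ[k] globalSections f M →ₗ[k] globalSections f (tensor M L) :=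
  LinearMap.mk₂ k (fun s t ↦ tensorSections M L ⊤ (TensorProduct.tmul Γ(X, ⊤)
      (show Γ(M, ⊤) from t) (show Γ(L, ⊤) from s)))
    (fun s s' t ↦ (congrArg (tensorSections M L ⊤) (TensorProduct.tmul_add
      (R := Γ(X, ⊤)) (M := Γ(M, ⊤)) (N := Γ(L, ⊤)) t s s')).trans (map_add _ _ _))
    (fun c s t ↦ (congrArg (tensorSections M L ⊤) (TensorProduct.tmul_smul
      (R := Γ(X, ⊤)) (M := Γ(M, ⊤)) (N := Γ(L, ⊤)) (scalarHom f c) t s)).trans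
        ((tensorSections M L ⊤).map_smul (scalarHom f c) _))
    (fun s t t' ↦ (congrArg (tensorSections M L ⊤) (TensorProduct.add_tmul
      (R := Γ(X, ⊤)) (M := Γ(M, ⊤)) (N := Γ(L, ⊤)) t t' s)).trans (map_add _ _ _))
    (fun c s t ↦ (congrArg (tensorSections M L ⊤) (TensorProduct.smul_tmul'
      (R := Γ(X, ⊤)) (M := Γ(M, ⊤)) (N := Γ(L, ⊤)) (scalarHom f c) t s).symm).trans
        ((tensorSections M L ⊤).map_smul (scalarHom f c) _))

/-- The Koszul cohomology group `K_{p,q}(X, F, L)` for `q ≥ 1`: the Koszul cohomology of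
`⨁_q H⁰(X, F ⊗ L^{⊗ q})` with respect to `V = H⁰(X, L)`. (It only involves the degrees
`q - 1`, `q`, `q + 1`.) -/
abbrev KoszulGroup (F L : X.Modules) (p q : ℕ) : Type u :=
  KoszulCohomology (V := globalSections f L) (B := fun n ↦ globalSections f (twist F L n))
    (fun n ↦ sectionsMul f L (twist F L n)) p q

/-- The product `X(r)` of `r` copies of `X` over `k`. -/
def power (r : ℕ) : Scheme.{u} :=
  widePullback (Spec (CommRingCat.of k)) (fun _ : Fin r ↦ X) (fun _ ↦ f)

/-- The projection of `X(r)` to the `i`-th factor. -/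
def proj (r : ℕ) (i : Fin r) : power f r ⟶ X :=
  WidePullback.π (fun _ : Fin r ↦ f) i

theorem proj_comp (r : ℕ) (i j : Fin r) : proj f r i ≫ f = proj f r j ≫ f :=
  (WidePullback.π_arrow (fun _ : Fin r ↦ f) i).trans
    (WidePullback.π_arrow (fun _ : Fin r ↦ f) j).symm

/-- `pr_{i,j} : X(r) ⟶ X × X`. -/
def projPair (r : ℕ) (i j : Fin r) : power f r ⟶ pullback f f :=
  pullback.lift (proj f r i) (proj f r j) (proj_comp f r i j)

/-- The ideal sheaf of the diagonal `Δ^{i,j} = pr_{i,j}⁻¹ Δ_X` in `X(r)`. -/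
def diagonalIdeal (r : ℕ) (i j : Fin r) : (power f r).Modules :=
  idealSheaf (pullback.fst (projPair f r i j) (pullback.diagonal f))

/-- `I¹_Δ(r) = I_{Δ^{1,2}} ⊗ I_{Δ^{1,3}} ⊗ ⋯ ⊗ I_{Δ^{1,r}}` on `X(r)`; the first factor has
index `0` in `Fin r`. -/
def firstDiagonalsIdeal (r : ℕ) [NeZero r] : (power f r).Modules :=
  tensorList ((List.finRange r).tail.map fun i ↦ diagonalIdeal f r 0 i)

/-- The external tensor product `F₁ ⊠ ⋯ ⊠ F_r` on `X(r)`. -/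
def boxTensor (r : ℕ) (F : Fin r → X.Modules) : (power f r).Modules :=
  tensorList ((List.finRange r).map fun i ↦ (Scheme.Modules.pullback (proj f r i)).obj (F i))

end Varieties

end GreenKoszul

end

/-! Put `A = E ⊗ L^{⊗(q-1)}`, `V = H⁰(X, L)` and view tensors as sections on powers of `X`. An
element of `H⁰(A) ⊗ V^{⊗(p+1)}` is a section of `A ⊠ L ⊠ ⋯ ⊠ L` on `X(p+2)`, and multiplying one
factor of `V` into `H⁰(A)` (the map `contr`) is restriction to the diagonal where the first
coordinate equals the coordinate of that factor, a copy of `X(p+1)`.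

A Koszul cycle in `⋀ᵖV ⊗ B_q` becomes, after antisymmetrization, a tensor `z ∈ H⁰(A ⊗ L) ⊗ V^{⊗p}`
killed by all contractions (`contr_antisymm`). It suffices to find `y ∈ H⁰(A) ⊗ V^{⊗(p+1)}` whose
last contraction is `z` and whose other contractions vanish: the image of `y` in the exterior power
then bounds the cycle up to the sign `(-1)^p` and the factor `p!`, invertible in characteristic zero
(`subsingleton_koszulCohomology`).

Geometrically, a section on `X(p+2)` is wanted that equals `z` on the last diagonal `Δ^{1,p+2}` and
`0` on the others. Locally this is easy. Near the last diagonal, write `b = b' ⊗ l` with `l` a local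
generator of `L`, and replace `∑ b ⊠ v₁ ⊠ ⋯ ⊠ v_p` by `∑ b' ⊠ v₁ ⊠ ⋯ ⊠ v_p ⊠ l`. This vanishes on
the other diagonals because `z` is killed by contractions (`pull_localSection_eq_zero`), and its
restriction to the last one does not depend on `l` (`pull_diag_last_localSection`). Away from the
last diagonal take `0`. Two local solutions differ by a section of `A ⊠ L ⊠ ⋯ ⊠ L` that vanishes on
every diagonal, so the obstruction to a global solution lies in `H¹` of the sheaf of such sections.

This sheaf is the one in the hypothesis with `r = p + 2`, because the tensor product of the ideals
of the diagonals is their intersection (`exists_firstDiagonalsIdeal_hom`). The reason is flatness: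
forgetting coordinate `j` is a flat map to `X(p+1)`, it maps `Δ^{1,j}` isomorphically onto its
target, and the other diagonals are preimages along it, so the relevant `Tor₁` vanishes
(`tensor_ideals_of_flat`).

Finally the global section comes from a tensor `y` by the surjective half of a Künneth formula
(`exists_evalBox_eq_coord`): on a product of copies of an affine open set, integrating out all
coordinates but one yields functions that extend to global sections of the remaining factor. The
contractions of `y` are compared with `0` and `z` on such a product, where tensors of global
sections are determined by their values since `X` is integral (`evalBox_injective`). -/

noncomputable section

namespace GreenKoszul

open Scheme.Modules

/-! ### Restriction, separation and gluing for sections of sheaves of modules -/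

section SheafAPI

variable {X : Scheme.{u}}

/-- Restriction of sections of a sheaf of modules. -/
def res (M : X.Modules) {V U : X.Opens} (h : V ≤ U) : Γ(M, U) →+ Γ(M, V) :=
  (M.presheaf.map (homOfLE h).op).hom

/-- Restriction of functions. -/
def ores (X : Scheme.{u}) {V U : X.Opens} (h : V ≤ U) : Γ(X, U) →+* Γ(X, V) :=
  (X.presheaf.map (homOfLE h).op).hom

variable (M : X.Modules)

theorem res_smul {V U : X.Opens} (h : V ≤ U) (a : Γ(X, U)) (s : Γ(M, U)) :
    res M h (a • s) = ores X h a • res M h s :=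
  Scheme.Modules.map_smul M (homOfLE h) a s

@[simp] theorem res_self {U : X.Opens} (h : U ≤ U) (s : Γ(M, U)) : res M h s = s :=
  congr($(M.presheaf.map_id (op U)) s)

@[simp] theorem res_res {W V U : X.Opens} (h : V ≤ U) (h' : W ≤ V) (s : Γ(M, U)) :
    res M h' (res M h s) = res M (h'.trans h) s :=
  (congr($(M.presheaf.map_comp (homOfLE h).op (homOfLE h').op) s)).symm

@[simp] theorem ores_self {U : X.Opens} (h : U ≤ U) (s : Γ(X, U)) : ores X h s = s :=
  congr($(X.presheaf.map_id (op U)) s)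

@[simp] theorem ores_ores {W V U : X.Opens} (h : V ≤ U) (h' : W ≤ V) (s : Γ(X, U)) :
    ores X h' (ores X h s) = ores X (h'.trans h) s :=
  (congr($(X.presheaf.map_comp (homOfLE h).op (homOfLE h').op) s)).symm

variable {M}

theorem app_res {N : X.Modules} (φ : M ⟶ N) {V U : X.Opens} (h : V ≤ U) (s : Γ(M, U)) :
    φ.app V (res M h s) = res N h (φ.app U s) :=
  congr($(φ.mapPresheaf.naturality (homOfLE h).op) s)

theorem app_smul {N : X.Modules} (φ : M ⟶ N) {U : X.Opens} (a : Γ(X, U)) (s : Γ(M, U)) :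
    φ.app U (a • s) = a • φ.app U s :=
  Hom.app_smul φ a s

theorem section_ext {U : X.Opens} {s t : Γ(M, U)}
    (h : ∀ x ∈ U, ∃ (V : X.Opens) (hV : V ≤ U), x ∈ V ∧ res M hV s = res M hV t) : s = t := by
  choose V hV hx he using h
  refine TopCat.Sheaf.eq_of_locally_eq' (F := ⟨M.presheaf, M.isSheaf⟩) (fun x : U ↦ V x.1 x.2) U
    (fun x ↦ homOfLE (hV x.1 x.2)) (fun x hxU ↦ ?_) s t (fun x ↦ he x.1 x.2)
  exact Opens.mem_iSup.2 ⟨⟨x, hxU⟩, hx x hxU⟩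

theorem section_glue {U : X.Opens} {ι : Type u} (V : ι → X.Opens) (hV : ∀ i, V i ≤ U)
    (hc : ∀ x ∈ U, ∃ i, x ∈ V i) (s : ∀ i, Γ(M, V i))
    (hs : ∀ i j, res M inf_le_left (s i) = res M (inf_le_right : V i ⊓ V j ≤ V j) (s j)) :
    ∃ t : Γ(M, U), ∀ i, res M (hV i) t = s i := by
  obtain ⟨t, ht, -⟩ := TopCat.Sheaf.existsUnique_gluing' (F := ⟨M.presheaf, M.isSheaf⟩) V U
    (fun i ↦ homOfLE (hV i)) (fun x hx ↦ Opens.mem_iSup.2 (hc x hx)) s hs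
  exact ⟨t, ht⟩

theorem function_ext {U : X.Opens} {s t : Γ(X, U)}
    (h : ∀ x ∈ U, ∃ (V : X.Opens) (hV : V ≤ U), x ∈ V ∧ ores X hV s = ores X hV t) : s = t := by
  choose V hV hx he using h
  refine TopCat.Sheaf.eq_of_locally_eq' (F := X.sheaf) (fun x : U ↦ V x.1 x.2) U
    (fun x ↦ homOfLE (hV x.1 x.2)) (fun x hxU ↦ ?_) s t (fun x ↦ he x.1 x.2)
  exact Opens.mem_iSup.2 ⟨⟨x, hxU⟩, hx x hxU⟩

end SheafAPI

/-! ### Lifting sections of a quotient when `H¹` of the kernel vanishes -/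

section Lifting

/-- If `H¹(K) = 0`, a global section of `M / K` given by local sections of `M` lifts to `M`. -/
theorem exists_lift_of_subsingleton_H {T : TopCat.{u}}
    {K M : Sheaf (Opens.grothendieckTopology T) AddCommGrpCat.{u}} (F : K ⟶ M)
    (hF : ∀ U, Function.Injective (F.hom.app U)) (hK : Subsingleton (Sheaf.H.{u} K 1))
    {ι : Type u} (V : ι → Opens T) (hV : ∀ x, ∃ i, x ∈ V i) (m : ∀ i, M.obj.obj (op (V i)))
    (hm : ∀ i j, ∃ k : K.obj.obj (op (V i ⊓ V j)), F.hom.app _ k =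
      M.obj.map (homOfLE inf_le_left).op (m i) -
        M.obj.map (homOfLE (inf_le_right : V i ⊓ V j ≤ V j)).op (m j)) :
    ∃ s : M.obj.obj (op ⊤), ∀ i, ∃ k : K.obj.obj (op (V i)),
      F.hom.app _ k = M.obj.map (homOfLE le_top).op s - m i := by
  have : Mono F := by
    have : Mono F.hom := by
      rw [NatTrans.mono_iff_mono_app]
      intro U
      rw [AddCommGrpCat.mono_iff_injective]
      exact hF U
    exact (sheafToPresheaf _ _).mono_of_mono_map this
  let S := ShortComplex.mk F (cokernel.π F) (cokernel.condition F)
  have hS : S.ShortExact := { exact := ShortComplex.exact_cokernel F }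
  let p (U : Opens T) : M.obj.obj (op U) →+ S.X₃.obj.obj (op U) := (S.g.hom.app (op U)).hom
  have hp {U V : Opens T} (h : V ≤ U) (s : M.obj.obj (op U)) :
      p V (M.obj.map (homOfLE h).op s) = S.X₃.obj.map (homOfLE h).op (p U s) :=
    congr($(S.g.hom.naturality (homOfLE h).op) s)
  have hpF (U : Opens T) (k : K.obj.obj (op U)) : p U (F.hom.app _ k) = 0 :=
    congr(($(S.zero).hom.app (op U)) k)
  -- Taking sections over `U` is left exact, so a section that dies in the quotient sheaf comes from
  -- `K`.
  have hex (U : Opens T) (s : M.obj.obj (op U)) (hs : p U s = 0) :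
      ∃ k : K.obj.obj (op U), F.hom.app _ k = s := by
    let G := sheafToPresheaf (Opens.grothendieckTopology T) AddCommGrpCat.{u} ⋙
      (evaluation _ _).obj (op U)
    have := hS.exact.map_of_mono_of_preservesKernel G inferInstance inferInstance
    rw [ShortComplex.ab_exact_iff] at this
    exact this s hs
  -- The differences of the `m i` come from `K`, so their images in the quotient sheaf agree on
  -- overlaps and glue.
  obtain ⟨q, hq, -⟩ := TopCat.Sheaf.existsUnique_gluing' (F := S.X₃) V ⊤
    (fun i ↦ homOfLE le_top) (fun x _ ↦ Opens.mem_iSup.2 (hV x)) (fun i ↦ p (V i) (m i)) (by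
      intro i j
      obtain ⟨k, hk⟩ := hm i j
      have h0 := hpF _ k
      rw [hk, map_sub, sub_eq_zero] at h0
      exact (hp inf_le_left _).symm.trans (h0.trans (hp inf_le_right _)))
  have hT : IsTerminal (⊤ : Opens T) := Preorder.isTerminalTop _
  -- The image of `q` under the connecting map lies in `H¹(K) = 0`, so `q` lifts to `H⁰(M)`.
  obtain ⟨y, hy⟩ := Abelian.Ext.covariant_sequence_exact₃ _ hS
    ((Sheaf.H.equiv₀ S.X₃ hT).symm q) rfl (Subsingleton.elim (α := Sheaf.H.{u} K 1) _ _)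
  refine ⟨Sheaf.H.equiv₀ M hT y, fun i ↦ hex _ _ ?_⟩
  have h2 : p ⊤ (Sheaf.H.equiv₀ M hT y) = q := by
    refine (Sheaf.H.equiv₀_naturality hT S.g y).trans ?_
    rw [Sheaf.H.map_apply, hy, AddEquiv.apply_symm_apply]
  rw [map_sub, sub_eq_zero, ← hq i, hp, h2]

variable {X : Scheme.{u}} {K M : X.Modules} (φ : K ⟶ M)

theorem exists_section_of_subsingleton_cohomology
    (hφ : ∀ U, Function.Injective (φ.app U)) (hK : Subsingleton (cohomology K 1))
    {ι : Type u} (V : ι → X.Opens) (hV : ∀ x, ∃ i, x ∈ V i) (m : ∀ i, Γ(M, V i))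
    (hm : ∀ i j, ∃ k : Γ(K, V i ⊓ V j), φ.app _ k =
      res M inf_le_left (m i) - res M (inf_le_right : V i ⊓ V j ≤ V j) (m j)) :
    ∃ s : Γ(M, ⊤), ∀ i, ∃ k : Γ(K, V i), φ.app _ k = res M le_top s - m i :=
  exists_lift_of_subsingleton_H ((SheafOfModules.toSheaf X.ringCatSheaf).map φ)
    (fun U ↦ hφ U.unop) hK V hV m hm

end Lifting

/-! ### Local bases, coordinates, and morphisms given on sections -/

section Basis

variable {X : Scheme.{u}} {κ : Type} [Fintype κ]

/-- The sections `e a` form a basis of `M` over `U`. -/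
def IsBasis (M : X.Modules) {U : X.Opens} (e : κ → Γ(M, U)) : Prop :=
  ∀ (V : X.Opens) (h : V ≤ U),
    Function.Bijective fun c : κ → Γ(X, V) ↦ ∑ a, c a • res M h (e a)

namespace IsBasis

variable {M : X.Modules} {U : X.Opens} {e : κ → Γ(M, U)} (he : IsBasis M e)
include he

theorem mono {V : X.Opens} (h : V ≤ U) : IsBasis M fun a ↦ res M h (e a) := fun W hW ↦ by
  simpa using he W (hW.trans h)

/-- The coordinates of sections with respect to a basis. -/
def coord {V : X.Opens} (h : V ≤ U) : Γ(M, V) ≃ₗ[Γ(X, V)] (κ → Γ(X, V)) :=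
  (LinearEquiv.ofBijective
    { toFun := fun c ↦ ∑ a, c a • res M h (e a)
      map_add' := fun c d ↦ by simp [add_smul, Finset.sum_add_distrib]
      map_smul' := fun r c ↦ by simp [mul_smul, Finset.smul_sum] } (he V h)).symm

theorem sum_coord {V : X.Opens} (h : V ≤ U) (s : Γ(M, V)) :
    ∑ a, he.coord h s a • res M h (e a) = s :=
  (he.coord h).symm_apply_apply s

theorem coord_sum {V : X.Opens} (h : V ≤ U) (c : κ → Γ(X, V)) :
    he.coord h (∑ a, c a • res M h (e a)) = c :=
  (he.coord h).apply_symm_apply c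

theorem coord_eq {V : X.Opens} (h : V ≤ U) {s : Γ(M, V)} {c : κ → Γ(X, V)}
    (hs : s = ∑ a, c a • res M h (e a)) : he.coord h s = c :=
  hs ▸ he.coord_sum h c

theorem coord_res {W V : X.Opens} (h : V ≤ U) (h' : W ≤ V) (s : Γ(M, V)) :
    he.coord (h'.trans h) (res M h' s) = fun a ↦ ores X h' (he.coord h s a) := by
  apply he.coord_eq
  conv_lhs => rw [← he.sum_coord h s]
  simp [res_smul]

theorem coord_mono {W V : X.Opens} (h : V ≤ U) (h' : W ≤ V) (s : Γ(M, W)) :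
    (he.mono h).coord h' s = he.coord (h'.trans h) s := by
  apply IsBasis.coord_eq
  conv_lhs => rw [← he.sum_coord (h'.trans h) s]
  simp

end IsBasis

/-- A morphism of sheaves of modules from its linear maps on sections. -/
def homMk {M N : X.Modules} (φ : ∀ U : X.Opens, Γ(M, U) →ₗ[Γ(X, U)] Γ(N, U))
    (hφ : ∀ {V U : X.Opens} (h : V ≤ U) (s : Γ(M, U)), φ V (res M h s) = res N h (φ U s)) :
    M ⟶ N where
  val := PresheafOfModules.homMk
    { app := fun U ↦ AddCommGrpCat.ofHom (φ U.unop).toAddMonoidHom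
      naturality := fun U V i ↦ by
        ext s
        exact hφ (leOfHom i.unop) s }
    (fun U r m ↦ (φ U.unop).map_smul r m)

/-- Sections of the structure sheaf are functions. -/
def unitSec (U : X.Opens) : Γ(structureSheaf X, U) ≃ₗ[Γ(X, U)] Γ(X, U) where
  toFun s := s
  invFun s := s
  map_add' _ _ := rfl
  map_smul' _ _ := rfl
  left_inv _ := rfl
  right_inv _ := rfl

theorem unitSec_res {V U : X.Opens} (h : V ≤ U) (s : Γ(structureSheaf X, U)) :
    unitSec V (res _ h s) = ores X h (unitSec U s) := rfl

/-- The morphism from the structure sheaf defined by a global section. -/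
def homOfSection (N : X.Modules) (s : Γ(N, ⊤)) : structureSheaf X ⟶ N :=
  homMk (fun U ↦ (LinearMap.toSpanSingleton Γ(X, U) Γ(N, U) (res N le_top s)).comp
      (unitSec U).toLinearMap) (fun h t ↦ by
    simp [unitSec_res, res_smul])

theorem homOfSection_app (N : X.Modules) (s : Γ(N, ⊤)) (U : X.Opens)
    (c : Γ(structureSheaf X, U)) :
    (homOfSection N s).app U c = unitSec U c • res N le_top s := rfl

theorem hom_unit_ext {N : X.Modules} {φ ψ : structureSheaf X ⟶ N}
    (h : φ.app ⊤ ((unitSec ⊤).symm 1) = ψ.app ⊤ ((unitSec ⊤).symm 1)) : φ = ψ := by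
  apply Scheme.Modules.hom_ext
  intro U
  ext c
  have key (χ : structureSheaf X ⟶ N) : χ.app U c =
      unitSec U c • res N le_top (χ.app ⊤ ((unitSec ⊤).symm 1)) := by
    rw [← app_res, ← app_smul]
    congr 1
    apply (unitSec U).injective
    rw [LinearEquiv.map_smul, unitSec_res]
    simp
  rw [key, key, h]

end Basis

section Pushforward

variable {X Y : Scheme.{u}} (f : X ⟶ Y) (N : X.Modules)

theorem smul_pushforward {U : Y.Opens} (a : Γ(Y, U)) (s : Γ((pushforward f).obj N, U)) :
    a • s = (show Γ(N, f ⁻¹ᵁ U) from f.app U a • (show Γ(N, f ⁻¹ᵁ U) from s)) := rfl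

end Pushforward

/-! ### Recognizing a basis by its universal property -/

section Criterion

theorem sum_ite_smul {R A κ : Type*} [Ring R] [AddCommGroup A] [Module R A] [Fintype κ]
    [DecidableEq κ] (a : κ) {c : κ → R} (hc : ∀ b, c b = if a = b then 1 else 0) (x : κ → A) :
    ∑ b, c b • x b = x a := by
  simp [hc]

theorem sum_app {X : Scheme.{u}} {M N : X.Modules} {κ : Type*} (t : Finset κ) (φ : κ → (M ⟶ N))
    (U : X.Opens) (s : Γ(M, U)) : (∑ b ∈ t, φ b).app U s = ∑ b ∈ t, (φ b).app U s := by
  classical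
  induction t using Finset.induction_on with
  | empty => simp
  | insert b t hb ih =>
    rw [Finset.sum_insert hb, Finset.sum_insert hb, ← ih]
    rfl

variable {X : Scheme.{u}} {κ : Type} [Fintype κ]

/-- Functions on `V ≤ U` are functions on the corresponding open subset of the scheme `U`. -/
theorem bijective_ι_app {U V : X.Opens} (h : V ≤ U) : Function.Bijective (U.ι.app V) := by
  have : IsIso (U.ι.app V) := U.ι.isIso_app V (by simpa using h)
  exact ConcreteCategory.bijective_of_isIso _

theorem res_restrict (M : X.Modules) {U : X.Opens} {V W : U.toScheme.Opens} (h : V ≤ W)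
    (s : Γ(M, U.ι ''ᵁ W)) :
    res (M.restrict U.ι) h (show Γ(M.restrict U.ι, W) from s) = res M (U.ι.image_mono h) s :=
  rfl

/-- The hypothesis is the universal property of a free module on `e` over `U`. Existence gives dual
coordinate maps `φ b`, hence independence; uniqueness identifies `∑ φ b · e b` with restriction to
`U`, hence spanning. Stated through morphisms, the criterion passes along adjunctions, which is how
sections of a pullback are reached. -/
theorem isBasis_of_bijective_hom {M : X.Modules} {U : X.Opens} {e : κ → Γ(M, U)}
    (h : ∀ N : U.toScheme.Modules, Function.Bijective
      fun (φ : M ⟶ (pushforward U.ι).obj N) (a : κ) ↦ φ.app U (e a)) : IsBasis M e := by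
  classical
  let one : Γ((pushforward U.ι).obj (structureSheaf U.toScheme), U) :=
    (unitSec (U.ι ⁻¹ᵁ U)).symm 1
  have hδ (b : κ) : ∃ φ : M ⟶ (pushforward U.ι).obj (structureSheaf U.toScheme),
      ∀ a, φ.app U (e a) = if a = b then one else 0 := by
    obtain ⟨φ, hφ⟩ := (h (structureSheaf U.toScheme)).surjective
      (fun a ↦ if a = b then one else 0)
    exact ⟨φ, fun a ↦ congrFun hφ a⟩
  choose φ hφ using hδ
  have hφc {V : X.Opens} (hV : V ≤ U) (c : κ → Γ(X, V)) (b : κ) :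
      unitSec (U.ι ⁻¹ᵁ V) ((φ b).app V (∑ a, c a • res M hV (e a))) = U.ι.app V (c b) := by
    rw [map_sum, Finset.sum_eq_single b]
    · rw [app_smul, app_res, hφ, if_pos rfl, smul_pushforward]
      change U.ι.app V (c b) * _ = _
      have : res ((pushforward U.ι).obj (structureSheaf U.toScheme)) hV one =
        (show Γ(structureSheaf U.toScheme, U.ι ⁻¹ᵁ V) from (unitSec (U.ι ⁻¹ᵁ V)).symm 1) :=
        map_one (U.toScheme.presheaf.map _).hom
      rw [this]
      exact mul_one _
    · intro a _ hab
      rw [app_smul, app_res, hφ, if_neg hab, map_zero, smul_zero]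
    · simp
  have htop : U.ι ''ᵁ ⊤ ≤ U := by simp
  let e' (a : κ) : Γ(M.restrict U.ι, ⊤) := res M htop (e a)
  -- `R` expands a section through the `φ b`, and `η` restricts it to `U`. They agree on each `e a`,
  -- hence are equal.
  let R : M ⟶ (pushforward U.ι).obj (M.restrict U.ι) :=
    ∑ b, φ b ≫ (pushforward U.ι).map (homOfSection _ (e' b))
  let η : M ⟶ (pushforward U.ι).obj (M.restrict U.ι) :=
    (restrictAdjunction U.ι).unit.app M
  have hR (V : X.Opens) (s : Γ(M, V)) :
      R.app V s = ∑ b, (show Γ(M.restrict U.ι, U.ι ⁻¹ᵁ V) from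
        unitSec (U.ι ⁻¹ᵁ V) ((φ b).app V s) • res (M.restrict U.ι) le_top (e' b)) :=
    sum_app _ _ _ _
  have hη (V : X.Opens) (s : Γ(M, V)) : η.app V s = res M (U.ι.image_preimage_le V) s := rfl
  have hRη : R = η := by
    apply (h _).injective
    funext a
    change R.app U (e a) = η.app U (e a)
    have h1 (b : κ) : unitSec (U.ι ⁻¹ᵁ U) ((φ b).app U (e a)) = if a = b then 1 else 0 := by
      rw [hφ]
      split_ifs <;> rfl
    have h2 : res (M.restrict U.ι) le_top (e' a) = res M (U.ι.image_preimage_le U) (e a) :=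
      (res_restrict M le_top (res M htop (e a))).trans
        (res_res M htop (U.ι.image_mono le_top) (e a))
    exact (hR U (e a)).trans ((sum_ite_smul (A := Γ(M.restrict U.ι, U.ι ⁻¹ᵁ U)) a h1 _).trans h2)
  intro V hV
  refine ⟨fun c d hcd ↦ funext fun b ↦ (bijective_ι_app hV).injective ?_, fun s ↦ ?_⟩
  · rw [← hφc hV, ← hφc hV]
    exact congrArg (fun t ↦ unitSec (U.ι ⁻¹ᵁ V) ((φ b).app V t)) hcd
  · choose c hc using fun b ↦ (bijective_ι_app hV).surjective
      (unitSec (U.ι ⁻¹ᵁ V) ((φ b).app V s))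
    refine ⟨c, ?_⟩
    have hVV : U.ι ''ᵁ U.ι ⁻¹ᵁ V = V := by
      rw [Scheme.Hom.image_preimage_eq_opensRange_inf]; simpa using hV
    have hinj : Function.Injective (res M (U.ι.image_preimage_le V)) := by
      intro s t hst
      have := congrArg (res M hVV.ge) hst
      simpa using this
    apply hinj
    rw [← hη, ← hη, ← hRη, hR, hR]
    refine Finset.sum_congr rfl fun b _ ↦ ?_
    have := hφc hV c b
    rw [hc] at this
    exact congrArg (fun r ↦ r • res (M.restrict U.ι) le_top (e' b)) this

end Criterion

/-! ### Pullback of bases, and bases of locally free sheaves -/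

section Pullback

variable {X : Scheme.{u}} {κ : Type} [Fintype κ]

/-- The universal property for targets `G` that only see `U`, such as pushforwards from `U`: a
morphism into `G` is determined over `U`, and there by coordinates. -/
theorem IsBasis.bijective_hom {M : X.Modules} {U : X.Opens} {e : κ → Γ(M, U)} (he : IsBasis M e)
    (G : X.Modules) (hG : ∀ V, Function.Bijective (res G (inf_le_left : V ⊓ U ≤ V))) :
    Function.Bijective fun (φ : M ⟶ G) (a : κ) ↦ φ.app U (e a) := by
  constructor
  · intro φ ψ h
    apply Scheme.Modules.hom_ext
    intro V
    ext s
    apply (hG V).injective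
    rw [← app_res, ← app_res]
    conv_lhs => rw [← he.sum_coord inf_le_right (res M inf_le_left s)]
    conv_rhs => rw [← he.sum_coord inf_le_right (res M inf_le_left s)]
    simp only [map_sum, app_smul, app_res, fun a ↦ congrFun h a]
  · intro g
    let ρ (V : X.Opens) : Γ(G, V) ≃+ Γ(G, V ⊓ U) := AddEquiv.ofBijective _ (hG V)
    have hρ (V : X.Opens) (s : Γ(G, V)) : ρ V s = res G inf_le_left s := rfl
    let F (V : X.Opens) (s : Γ(M, V)) : Γ(G, V ⊓ U) :=
      ∑ a, he.coord inf_le_right (res M inf_le_left s) a • res G inf_le_right (g a)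
    let φ (V : X.Opens) : Γ(M, V) →ₗ[Γ(X, V)] Γ(G, V) :=
      { toFun := fun s ↦ (ρ V).symm (F V s)
        map_add' := fun s t ↦ by
          rw [← map_add]
          simp [F, add_smul, Finset.sum_add_distrib]
        map_smul' := fun r s ↦ by
          apply (ρ V).injective
          rw [AddEquiv.apply_symm_apply, hρ, RingHom.id_apply, res_smul, ← hρ,
            AddEquiv.apply_symm_apply]
          simp [F, res_smul, mul_smul, Finset.smul_sum] }
    have hφ (V : X.Opens) (s : Γ(M, V)) : res G inf_le_left (φ V s) = F V s :=
      (ρ V).apply_symm_apply _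
    refine ⟨homMk φ ?_, ?_⟩
    · intro V W h s
      apply (hG V).injective
      have h' : V ⊓ U ≤ W ⊓ U := inf_le_inf_right _ h
      have h1 : res G inf_le_left (res G h (φ W s)) = res G h' (res G inf_le_left (φ W s)) := by
        rw [res_res, res_res]
      rw [hφ, h1, hφ]
      simp only [F, map_sum, res_smul, res_res]
      refine Finset.sum_congr rfl fun a _ ↦ ?_
      congr 1
      have := congrFun (he.coord_res inf_le_right h' (res M inf_le_left s)) a
      rw [res_res] at this
      exact this
    · funext a
      have hUU : U ≤ U ⊓ U := le_inf le_rfl le_rfl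
      apply (hG U).injective
      refine (hφ U (e a)).trans ?_
      classical
      have : he.coord inf_le_right (res M (inf_le_left : U ⊓ U ≤ U) (e a)) =
          fun b ↦ if a = b then 1 else 0 := by
        apply he.coord_eq
        simp
      simp only [F, this]
      simp

theorem bijective_res (N : X.Modules) {V U : X.Opens} (h : V ≤ U) (h' : U ≤ V) :
    Function.Bijective (res N h) := by
  refine ⟨fun s t hst ↦ ?_, fun s ↦ ⟨res N h' s, by simp⟩⟩
  simpa using congrArg (res N h') hst

/-- The pullback of sections. -/
def pull {X Y : Scheme.{u}} (f : X ⟶ Y) (M : Y.Modules) (U : Y.Opens) :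
    Γ(M, U) →+ Γ((Scheme.Modules.pullback f).obj M, f ⁻¹ᵁ U) :=
  (((pullbackPushforwardAdjunction f).unit.app M).app U).hom

section

variable {Y : Scheme.{u}} (f : X ⟶ Y) (M : Y.Modules)

theorem pull_smul {U : Y.Opens} (a : Γ(Y, U)) (s : Γ(M, U)) :
    pull f M U (a • s) = f.app U a • pull f M U s :=
  app_smul ((pullbackPushforwardAdjunction f).unit.app M) a s

theorem pull_res {V U : Y.Opens} (h : V ≤ U) (s : Γ(M, U)) :
    pull f M V (res M h s) = res ((Scheme.Modules.pullback f).obj M) (f.preimage_mono h) (pull f M U s) :=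
  app_res ((pullbackPushforwardAdjunction f).unit.app M) h s

/-- By adjunction, morphisms from the pullback to a pushforward from `f ⁻¹ᵁ U` are morphisms from
`M` to a sheaf that only sees `U`; for these the universal property is known. -/
theorem IsBasis.pull {M : Y.Modules} {U : Y.Opens} {e : κ → Γ(M, U)} (he : IsBasis M e) :
    IsBasis ((Scheme.Modules.pullback f).obj M) fun a ↦ pull f M U (e a) := by
  apply isBasis_of_bijective_hom
  intro N
  have h1 := he.bijective_hom ((pushforward f).obj ((pushforward (f ⁻¹ᵁ U).ι).obj N)) (by
    intro V
    exact bijective_res N ((f ⁻¹ᵁ U).ι.preimage_mono (f.preimage_mono inf_le_left))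
      fun x hx ↦ ⟨hx, x.2⟩)
  have h2 := ((pullbackPushforwardAdjunction f).homEquiv M
    ((pushforward (f ⁻¹ᵁ U).ι).obj N)).bijective
  refine (congrArg Function.Bijective (funext₂ fun φ a ↦ ?_)).mp (h1.comp h2)
  simp only [Function.comp]
  rw [Adjunction.homEquiv_unit]
  rfl

end

/-- The hypothesis on `σ` says that `P` is free on it; the adjunction between restriction to `U` and
pushforward turns this into the criterion for `M`. -/
theorem exists_isBasis_of_restrict_iso {M : X.Modules} {U : X.Opens} {P : U.toScheme.Modules}
    (i : M.restrict U.ι ≅ P) (σ : κ → Γ(P, ⊤))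
    (hσ : ∀ N : U.toScheme.Modules, Function.Bijective
      fun (ψ : P ⟶ N) (a : κ) ↦ ψ.app ⊤ (σ a)) : ∃ e : κ → Γ(M, U), IsBasis M e := by
  have hU : U ≤ U.ι ''ᵁ ⊤ := by simp
  refine ⟨fun a ↦ res M hU (show Γ(M, U.ι ''ᵁ ⊤) from i.inv.app ⊤ (σ a)), ?_⟩
  apply isBasis_of_bijective_hom
  intro N
  have hN := bijective_res N (le_top : U.ι ⁻¹ᵁ U ≤ ⊤) fun x _ ↦ x.2
  have h1 := ((hN.comp_left (α := κ)).comp (hσ N)).comp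
    (i.homCongr (Iso.refl N)).bijective
  have h2 := h1.comp ((restrictAdjunction U.ι).homEquiv M N).symm.bijective
  refine (congrArg Function.Bijective (funext₂ fun φ a ↦ ?_)).mp h2
  obtain ⟨ψ, rfl⟩ := ((restrictAdjunction U.ι).homEquiv M N).surjective φ
  simp only [Function.comp, Equiv.symm_apply_apply]
  rw [Adjunction.homEquiv_unit]
  have h3 : res M (U.ι.image_preimage_le U) (res M hU
      (show Γ(M, U.ι ''ᵁ ⊤) from i.inv.app ⊤ (σ a))) =
      res (M.restrict U.ι) (le_top : U.ι ⁻¹ᵁ U ≤ ⊤) (i.inv.app ⊤ (σ a)) := res_res M _ _ _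
  have h4 : ((restrictAdjunction U.ι).unit.app M ≫ (pushforward U.ι).map ψ).app U (res M hU
      (show Γ(M, U.ι ''ᵁ ⊤) from i.inv.app ⊤ (σ a))) =
      ψ.app (U.ι ⁻¹ᵁ U) (res M (U.ι.image_preimage_le U) (res M hU
      (show Γ(M, U.ι ''ᵁ ⊤) from i.inv.app ⊤ (σ a)))) := rfl
  rw [h4, h3, app_res, Iso.homCongr_apply, Iso.refl_hom, Category.comp_id]
  rfl

theorem bijective_hom_structureSheaf (N : X.Modules) : Function.Bijective
    fun (ψ : structureSheaf X ⟶ N) ↦ ψ.app ⊤ ((unitSec ⊤).symm 1) := by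
  refine ⟨fun φ ψ h ↦ hom_unit_ext h, fun s ↦ ⟨homOfSection N s, ?_⟩⟩
  refine (homOfSection_app N s ⊤ _).trans ?_
  simp

theorem IsLineBundle.exists_isBasis {L : X.Modules} (hL : IsLineBundle L) (x : X) :
    ∃ (U : X.Opens) (e : Unit → Γ(L, U)), x ∈ U ∧ IsBasis L e := by
  obtain ⟨U, hx, ⟨i⟩⟩ := hL x
  obtain ⟨e, he⟩ := exists_isBasis_of_restrict_iso i (fun _ : Unit ↦ (unitSec ⊤).symm 1)
    (fun N ↦ (Equiv.funUnique Unit _).symm.bijective.comp (bijective_hom_structureSheaf N))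
  exact ⟨U, e, hx, he⟩

variable (X) in
/-- The free sheaf of modules of rank `n`. -/
def freeModule (n : ℕ) : X.Modules :=
  SheafOfModules.free (R := X.ringCatSheaf) (ULift.{u} (Fin n))

/-- The inclusion of a summand. -/
def toFreeModule {n : ℕ} (a : Fin n) : structureSheaf X ⟶ freeModule X n :=
  SheafOfModules.ιFree (R := X.ringCatSheaf) (ULift.up a)

theorem freeModule_hom_ext {n : ℕ} {N : X.Modules} {φ ψ : freeModule X n ⟶ N}
    (h : ∀ a, toFreeModule a ≫ φ = toFreeModule a ≫ ψ) : φ = ψ :=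
  Cofan.IsColimit.hom_ext
    (SheafOfModules.isColimitFreeCofan (R := X.ringCatSheaf) (ULift.{u} (Fin n))) φ ψ
    fun a ↦ h a.down

theorem freeModule_exists_desc {n : ℕ} {N : X.Modules} (ψ : Fin n → (structureSheaf X ⟶ N)) :
    ∃ φ : freeModule X n ⟶ N, ∀ a, toFreeModule a ≫ φ = ψ a :=
  ⟨Cofan.IsColimit.desc
    (SheafOfModules.isColimitFreeCofan (R := X.ringCatSheaf) (ULift.{u} (Fin n)))
    (fun a ↦ ψ a.down), fun a ↦ Cofan.IsColimit.fac
      (SheafOfModules.isColimitFreeCofan (R := X.ringCatSheaf) (ULift.{u} (Fin n)))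
      (fun a ↦ ψ a.down) (ULift.up a)⟩

theorem bijective_hom_freeModule (n : ℕ) (N : X.Modules) : Function.Bijective
    fun (ψ : freeModule X n ⟶ N) (a : Fin n) ↦
      ψ.app ⊤ ((toFreeModule a).app ⊤ ((unitSec ⊤).symm 1)) := by
  constructor
  · intro φ ψ h
    exact freeModule_hom_ext fun a ↦ hom_unit_ext (congrFun h a)
  · intro g
    choose ψ hψ using fun a ↦ (bijective_hom_structureSheaf N).surjective (g a)
    obtain ⟨φ, hφ⟩ := freeModule_exists_desc ψ
    refine ⟨φ, funext fun a ↦ ?_⟩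
    rw [← hψ a, ← hφ a]
    rfl

theorem IsVectorBundle.exists_isBasis {E : X.Modules} (hE : IsVectorBundle E) (x : X) :
    ∃ (U : X.Opens) (n : ℕ) (e : Fin n → Γ(E, U)), x ∈ U ∧ IsBasis E e := by
  obtain ⟨U, hx, n, ⟨i⟩⟩ := hE x
  obtain ⟨e, he⟩ := exists_isBasis_of_restrict_iso (P := freeModule U.toScheme n) i _
    (bijective_hom_freeModule n)
  exact ⟨U, n, e, hx, he⟩

end Pullback

/-! ### Sections of the sheaf tensor product -/

section Tensor

variable {X : Scheme.{u}} (M N : X.Modules)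

/-- Restriction of elements of the presheaf tensor product. -/
def tres {V U : X.Opens} (h : V ≤ U) :
    Γ(M, U) ⊗[Γ(X, U)] Γ(N, U) →+ Γ(M, V) ⊗[Γ(X, V)] Γ(N, V) :=
  ((presheafTensor M N).presheaf.map (homOfLE h).op).hom

theorem tres_tmul {V U : X.Opens} (h : V ≤ U) (s : Γ(M, U)) (t : Γ(N, U)) :
    tres M N h (s ⊗ₜ t) = res M h s ⊗ₜ res N h t := rfl

theorem tensorSections_tres {V U : X.Opens} (h : V ≤ U) (z : Γ(M, U) ⊗[Γ(X, U)] Γ(N, U)) :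
    tensorSections M N V (tres M N h z) = res _ h (tensorSections M N U z) :=
  congr($(((PresheafOfModules.toPresheaf _).map
    ((PresheafOfModules.sheafificationAdjunction (𝟙 X.ringCatSheaf.obj)).unit.app
      (presheafTensor M N))).naturality (homOfLE h).op) z)

theorem exists_tensorSections_eq {U : X.Opens} (t : Γ(tensor M N, U)) {x : X} (hx : x ∈ U) :
    ∃ (V : X.Opens) (h : V ≤ U), x ∈ V ∧ ∃ z, tensorSections M N V z = res _ h t := by
  have := Presheaf.imageSieve_mem (Opens.grothendieckTopology X)
    (CategoryTheory.toSheafify (Opens.grothendieckTopology X) (presheafTensor M N).presheaf) t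
  obtain ⟨V, i, ⟨z, hz⟩, hxV⟩ := this x hx
  exact ⟨V, leOfHom i, hxV, z, hz⟩

theorem exists_tres_eq_zero {U : X.Opens} {z : Γ(M, U) ⊗[Γ(X, U)] Γ(N, U)}
    (hz : tensorSections M N U z = 0) {x : X} (hx : x ∈ U) :
    ∃ (V : X.Opens) (h : V ≤ U), x ∈ V ∧ tres M N h z = 0 := by
  have := Presheaf.equalizerSieve_mem (Opens.grothendieckTopology X)
    (CategoryTheory.toSheafify (Opens.grothendieckTopology X) (presheafTensor M N).presheaf) z 0
    (hz.trans (map_zero _).symm)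
  obtain ⟨V, i, hi, hxV⟩ := this x hx
  exact ⟨V, leOfHom i, hxV, hi.trans (map_zero _)⟩

variable {M N}

/-- The product of two sections. -/
def tmul {U : X.Opens} (s : Γ(M, U)) (t : Γ(N, U)) : Γ(tensor M N, U) :=
  tensorSections M N U (s ⊗ₜ t)

theorem res_tmul {V U : X.Opens} (h : V ≤ U) (s : Γ(M, U)) (t : Γ(N, U)) :
    res _ h (tmul s t) = tmul (res M h s) (res N h t) :=
  (tensorSections_tres M N h _).symm

theorem tmul_smul {U : X.Opens} (a : Γ(X, U)) (s : Γ(M, U)) (t : Γ(N, U)) :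
    tmul s (a • t) = a • tmul s t := by
  rw [tmul, TensorProduct.tmul_smul, LinearMap.map_smul, tmul]

theorem smul_tmul {U : X.Opens} (a : Γ(X, U)) (s : Γ(M, U)) (t : Γ(N, U)) :
    tmul (a • s) t = a • tmul s t := by
  rw [tmul, ← TensorProduct.smul_tmul', LinearMap.map_smul, tmul]

theorem tmul_add {U : X.Opens} (s : Γ(M, U)) (t t' : Γ(N, U)) :
    tmul s (t + t') = tmul s t + tmul s t' := by
  simp [tmul, TensorProduct.tmul_add]

theorem add_tmul {U : X.Opens} (s s' : Γ(M, U)) (t : Γ(N, U)) :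
    tmul (s + s') t = tmul s t + tmul s' t := by
  simp [tmul, TensorProduct.add_tmul]

theorem sum_tmul {κ : Type*} (r : Finset κ) {U : X.Opens} (s : κ → Γ(M, U)) (t : Γ(N, U)) :
    tmul (∑ a ∈ r, s a) t = ∑ a ∈ r, tmul (s a) t := by
  simp [tmul, TensorProduct.sum_tmul]

variable (M N) in
theorem exists_tensor_desc {G : X.Modules}
    (β : ∀ U : X.Opens, Γ(M, U) →ₗ[Γ(X, U)] Γ(N, U) →ₗ[Γ(X, U)] Γ(G, U))
    (hβ : ∀ {V U : X.Opens} (h : V ≤ U) (s : Γ(M, U)) (t : Γ(N, U)),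
      β V (res M h s) (res N h t) = res G h (β U s t)) :
    ∃ φ : tensor M N ⟶ G, ∀ (U : X.Opens) (z : Γ(M, U) ⊗[Γ(X, U)] Γ(N, U)),
      φ.app U (tensorSections M N U z) = TensorProduct.lift (β U) z := by
  have key {V U : X.Opens} (h : V ≤ U) (z : Γ(M, U) ⊗[Γ(X, U)] Γ(N, U)) :
      TensorProduct.lift (β V) (tres M N h z) = res G h (TensorProduct.lift (β U) z) := by
    induction z using TensorProduct.induction_on with
    | zero => simp only [map_zero]
    | tmul s t => exact hβ _ _ _
    | add z w hz hw => simp only [map_add, hz, hw]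
  let ψ : presheafTensor M N ⟶ G.val := PresheafOfModules.homMk
    { app := fun U ↦ AddCommGrpCat.ofHom (TensorProduct.lift (β U.unop)).toAddMonoidHom
      naturality := fun U V i ↦ by
        ext z
        exact key (leOfHom i.unop) z }
    (fun U r m ↦ (TensorProduct.lift (β U.unop)).map_smul r m)
  let φ := ((PresheafOfModules.sheafificationAdjunction (𝟙 X.ringCatSheaf.obj)).homEquiv
    (presheafTensor M N) G).symm ψ
  refine ⟨φ, fun U z ↦ ?_⟩
  have := ((PresheafOfModules.sheafificationAdjunction (𝟙 X.ringCatSheaf.obj)).homEquiv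
    (presheafTensor M N) G).apply_symm_apply ψ
  replace this := (Adjunction.homEquiv_unit _ _ _ _).symm.trans this
  exact congr(($this).app (op U) z)

variable {κ : Type} [Fintype κ]

/-- Tensoring with a free sheaf needs no sheafification. Contracting with the coordinates of `N`
recovers the `m a` from an honest tensor, which gives injectivity after passing to small open sets.
A section of the sheaf is only locally a tensor; by injectivity the local coefficients are unique,
so they glue. -/
theorem bijective_sum_tmul {U : X.Opens} {e : κ → Γ(N, U)} (he : IsBasis N e) {V : X.Opens}
    (h : V ≤ U) : Function.Bijective
      fun m : κ → Γ(M, V) ↦ ∑ a, tmul (m a) (res N h (e a)) := by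
  classical
  have hinj (V : X.Opens) (h : V ≤ U) : Function.Injective
      fun m : κ → Γ(M, V) ↦ ∑ a, tmul (m a) (res N h (e a)) := by
    let c (V : X.Opens) (h : V ≤ U) (b : κ) : Γ(M, V) ⊗[Γ(X, V)] Γ(N, V) →ₗ[Γ(X, V)] Γ(M, V) :=
      TensorProduct.lift (LinearMap.flip (LinearMap.comp (LinearMap.lsmul Γ(X, V) Γ(M, V))
        (LinearMap.comp (LinearMap.proj b) (he.coord h).toLinearMap)))
    have hc (V : X.Opens) (h : V ≤ U) (b : κ) (m : κ → Γ(M, V)) :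
        c V h b (∑ a, m a ⊗ₜ res N h (e a)) = m b := by
      have (a : κ) : he.coord h (res N h (e a)) b = if b = a then 1 else 0 := by
        rw [he.coord_eq h (c := fun b ↦ if b = a then 1 else 0) (by simp)]
      simp [c, this]
    let D (V : X.Opens) (h : V ≤ U) (m : κ → Γ(M, V)) : Γ(M, V) ⊗[Γ(X, V)] Γ(N, V) :=
      ∑ a, m a ⊗ₜ res N h (e a)
    intro m m' hm
    have h0 : tensorSections M N V (D V h m - D V h m') = 0 := by
      rw [map_sub, sub_eq_zero, map_sum, map_sum]
      exact hm
    funext b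
    refine section_ext fun x hx ↦ ?_
    obtain ⟨W, hW, hxW, hz⟩ := exists_tres_eq_zero M N h0 hx
    refine ⟨W, hW, hxW, ?_⟩
    rw [map_sub, sub_eq_zero] at hz
    have hD (m : κ → Γ(M, V)) : c W (hW.trans h) b (tres M N hW (D V h m)) = res M hW (m b) := by
      rw [← hc W (hW.trans h) b (fun a ↦ res M hW (m a)), map_sum]
      simp [tres_tmul]
    rw [← hD, ← hD, hz]
  refine ⟨hinj V h, fun t ↦ ?_⟩
  have hloc (x : V) : ∃ (W : X.Opens) (hW : W ≤ V) (m : κ → Γ(M, W)), x.1 ∈ W ∧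
      ∑ a, tmul (m a) (res N (hW.trans h) (e a)) = res _ hW t := by
    obtain ⟨W, hW, hxW, z, hz⟩ := exists_tensorSections_eq M N t x.2
    have hex (z : Γ(M, W) ⊗[Γ(X, W)] Γ(N, W)) : ∃ m : κ → Γ(M, W),
        ∑ a, tmul (m a) (res N (hW.trans h) (e a)) = tensorSections M N W z := by
      induction z using TensorProduct.induction_on with
      | zero => exact ⟨0, by simp [tmul]⟩
      | tmul s t =>
        refine ⟨fun a ↦ he.coord (hW.trans h) t a • s, ?_⟩
        change _ = tmul s t
        conv_rhs => rw [← he.sum_coord (hW.trans h) t]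
        simp [tmul, TensorProduct.tmul_sum, TensorProduct.smul_tmul']
      | add z w hz hw =>
        obtain ⟨m, hm⟩ := hz
        obtain ⟨m', hm'⟩ := hw
        exact ⟨m + m', by simp [add_tmul, Finset.sum_add_distrib, hm, hm']⟩
    obtain ⟨m, hm⟩ := hex z
    exact ⟨W, hW, m, hxW, hm.trans hz⟩
  choose W hW m hxW hm using hloc
  have hres {W W' : X.Opens} (hW : W ≤ V) (h' : W' ≤ W) (m : κ → Γ(M, W)) :
      res _ h' (∑ a, tmul (m a) (res N (hW.trans h) (e a))) =
        ∑ a, tmul (res M h' (m a)) (res N ((h'.trans hW).trans h) (e a)) := by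
    simp [res_tmul]
  have hglue (a : κ) : ∃ s : Γ(M, V), ∀ x, res M (hW x) s = m x a := by
    refine section_glue W hW (fun x hx ↦ ⟨⟨x, hx⟩, hxW _⟩) (fun x ↦ m x a) fun x y ↦ ?_
    refine congrFun (hinj _ ((inf_le_left.trans (hW x)).trans h)
      (a₁ := fun a ↦ res M inf_le_left (m x a))
      (a₂ := fun a ↦ res M (inf_le_right : W x ⊓ W y ≤ W y) (m y a)) ?_) a
    simp only []
    rw [← hres (hW x), ← hres (hW y), hm, hm, res_res, res_res]
  choose s hs using hglue
  refine ⟨s, section_ext fun x hx ↦ ⟨W ⟨x, hx⟩, hW _, hxW _, ?_⟩⟩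
  rw [← hm ⟨x, hx⟩]
  simp [res_tmul, hs]

end Tensor

/-! ### Bases of tensor products and of twists -/

section TensorBasis

variable {X : Scheme.{u}} {κ : Type} [Fintype κ]

theorem IsBasis.tmul {M N : X.Modules} {U : X.Opens} {e : κ → Γ(M, U)} (he : IsBasis M e)
    {g : Unit → Γ(N, U)} (hg : IsBasis N g) :
    IsBasis (tensor M N) fun a ↦ tmul (e a) (g ()) := fun V h ↦ by
  have h1 := (bijective_sum_tmul (M := M) hg h).comp
    ((Equiv.funUnique Unit Γ(M, V)).symm.bijective.comp (he V h))
  refine (congrArg Function.Bijective (funext fun c ↦ ?_)).mp h1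
  simp [Function.comp, sum_tmul, smul_tmul, res_tmul]

theorem isBasis_one (U : X.Opens) :
    IsBasis (structureSheaf X) fun _ : Unit ↦ (unitSec U).symm 1 := fun V h ↦ by
  have h1 := (Equiv.funUnique Unit Γ(X, V)).bijective
  have h2 := (unitSec V).symm.bijective.comp h1
  refine (congrArg Function.Bijective (funext fun c ↦ ?_)).mp h2
  apply (unitSec V).injective
  simp only [Function.comp, LinearEquiv.apply_symm_apply, Finset.univ_unique, Finset.sum_singleton]
  rw [LinearEquiv.map_smul, unitSec_res]
  simp

/-- The product of a list of sections. -/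
def prodList {ι : Type} {N : ι → X.Modules} {U : X.Opens} (s : ∀ i, Γ(N i, U)) :
    ∀ l : List ι, Γ(tensorList (l.map N), U)
  | [] => (unitSec U).symm 1
  | i :: l => tmul (s i) (prodList s l)

theorem res_prodList {ι : Type} {N : ι → X.Modules} {V U : X.Opens} (h : V ≤ U)
    (s : ∀ i, Γ(N i, U)) (l : List ι) :
    res _ h (prodList s l) = prodList (fun i ↦ res (N i) h (s i)) l := by
  induction l with
  | nil =>
    apply (unitSec V).injective
    refine (unitSec_res h _).trans ?_
    exact map_one (ores X h)
  | cons i l ih => exact (res_tmul h _ _).trans (congrArg _ ih)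

theorem isBasis_prodList {ι : Type} {N : ι → X.Modules} {U : X.Opens} (s : ∀ i, Γ(N i, U))
    (l : List ι) (hs : ∀ i ∈ l, IsBasis (N i) fun _ : Unit ↦ s i) :
    IsBasis (tensorList (l.map N)) fun _ : Unit ↦ prodList s l := by
  induction l with
  | nil => exact isBasis_one U
  | cons i l ih =>
    have h := IsBasis.tmul (N := tensorList (l.map N)) (hs i (by simp))
      (ih fun j hj ↦ hs j (by simp [hj]))
    exact h

theorem prodList_smul {ι : Type} {N : ι → X.Modules} {U : X.Opens} (c : ι → Γ(X, U))
    (s : ∀ i, Γ(N i, U)) (l : List ι) :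
    prodList (fun i ↦ c i • s i) l = (l.map c).prod • prodList s l := by
  induction l with
  | nil => exact (one_smul Γ(X, U) _).symm
  | cons i l ih =>
    have h : tmul (c i • s i) (prodList (fun i ↦ c i • s i) l) =
        (c i * (l.map c).prod) • tmul (s i) (prodList s l) := by
      rw [ih, smul_tmul, tmul_smul, mul_smul]
    exact h

theorem IsBasis.twist {E L : X.Modules} {U : X.Opens} {e : κ → Γ(E, U)} (he : IsBasis E e)
    {l : Unit → Γ(L, U)} (hl : IsBasis L l) (m : ℕ) :
    ∃ e' : κ → Γ(twist E L m, U), IsBasis (GreenKoszul.twist E L m) e' := by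
  induction m with
  | zero => exact ⟨e, he⟩
  | succ m ih =>
    obtain ⟨e', he'⟩ := ih
    exact ⟨_, he'.tmul hl⟩

end TensorBasis

/-! ### Ideal sheaves, their tensor products, and their products with locally free sheaves -/

section Ideals

variable {X Y : Scheme.{u}}

/-- The function attached to a section of a sheaf of modules mapping to the structure sheaf. -/
def fn {A : X.Modules} (α : A ⟶ structureSheaf X) (U : X.Opens) : Γ(A, U) →ₗ[Γ(X, U)] Γ(X, U) where
  toFun s := unitSec U (α.app U s)
  map_add' s t := by simp
  map_smul' r s := by rw [app_smul, LinearEquiv.map_smul, RingHom.id_apply]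

theorem fn_res {A : X.Modules} (α : A ⟶ structureSheaf X) {V U : X.Opens} (h : V ≤ U)
    (s : Γ(A, U)) : fn α V (res A h s) = ores X h (fn α U s) := by
  change unitSec V (α.app V (res A h s)) = ores X h (unitSec U (α.app U s))
  rw [app_res, unitSec_res]

/-- Sections over `U` are left exact, so the kernel is computed on sections. Afterwards the ideal
sheaf is handled only through the embedding `α` and its image. -/
theorem exists_idealSheaf_hom (g : Y ⟶ X) : ∃ α : idealSheaf g ⟶ structureSheaf X,
    (∀ U, Function.Injective (fn α U)) ∧
      ∀ (U : X.Opens) (r : Γ(X, U)), r ∈ LinearMap.range (fn α U) ↔ g.app U r = 0 := by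
  let b : structureSheaf X ⟶ (pushforward g).obj (structureSheaf Y) :=
    SheafOfModules.unitToPushforwardObjUnit g.toRingCatSheafHom
  let α : idealSheaf g ⟶ structureSheaf X := kernel.ι (C := X.Modules) b
  have hb (U : X.Opens) (r : Γ(X, U)) : b.app U ((unitSec U).symm r) = g.app U r := rfl
  let S : ShortComplex X.Modules := ShortComplex.mk α b (kernel.condition b)
  have hS : S.Exact := ShortComplex.exact_kernel b
  have hmono : Mono S.f := inferInstanceAs (Mono (kernel.ι b))
  have hz (U : X.Opens) :
      (toPresheaf X ⋙ (evaluation _ _).obj (op U)).PreservesZeroMorphisms := ⟨fun _ _ ↦ rfl⟩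
  have hl (U : X.Opens) :
      PreservesFiniteLimits (toPresheaf X ⋙ (evaluation _ _).obj (op U)) :=
    haveI : PreservesLimits ((evaluation (Opens X)ᵒᵖ AddCommGrpCat.{u}).obj (op U)) :=
      inferInstance
    comp_preservesFiniteLimits (toPresheaf X)
      ((evaluation (Opens X)ᵒᵖ AddCommGrpCat.{u}).obj (op U))
  have key (U : X.Opens) : (S.map (toPresheaf X ⋙ (evaluation _ _).obj (op U))).Exact ∧
      Mono (S.map (toPresheaf X ⋙ (evaluation _ _).obj (op U))).f :=
    ⟨hS.map_of_mono_of_preservesKernel _ inferInstance inferInstance,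
      inferInstanceAs (Mono ((toPresheaf X ⋙ (evaluation _ _).obj (op U)).map S.f))⟩
  refine ⟨α, fun U s t h ↦ ?_, fun U r ↦ ⟨?_, fun h ↦ ?_⟩⟩
  · exact (AddCommGrpCat.mono_iff_injective _).1 (key U).2 h
  · rintro ⟨s, rfl⟩
    exact congr(($(S.zero).app U) s)
  · obtain ⟨s, hs⟩ := (ShortComplex.ab_exact_iff _).1 (key U).1 r h
    exact ⟨s, hs⟩

/-- Multiplication of functions in two ideals. -/
def mulIdeals {A B : X.Modules} (α : A ⟶ structureSheaf X) (β : B ⟶ structureSheaf X)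
    (U : X.Opens) : Γ(A, U) ⊗[Γ(X, U)] Γ(B, U) →ₗ[Γ(X, U)] Γ(X, U) :=
  TensorProduct.lift ((LinearMap.mul Γ(X, U) Γ(X, U)).compl₁₂ (fn α U) (fn β U))

theorem mem_range_fn_of_locally {A : X.Modules} {α : A ⟶ structureSheaf X}
    (hα : ∀ U, Function.Injective (fn α U)) {U : X.Opens} {r : Γ(X, U)}
    (h : ∀ x ∈ U, ∃ (V : X.Opens) (hV : V ≤ U), x ∈ V ∧
      ores X hV r ∈ LinearMap.range (fn α V)) : r ∈ LinearMap.range (fn α U) := by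
  choose V hV hxV s hs using h
  obtain ⟨t, ht⟩ := section_glue (fun x : U ↦ V x.1 x.2) (fun x ↦ hV x.1 x.2)
    (fun x hx ↦ ⟨⟨x, hx⟩, hxV x hx⟩) (fun x ↦ s x.1 x.2) (fun x y ↦ by
      apply hα
      rw [fn_res, fn_res, hs, hs, ores_ores, ores_ores])
  refine ⟨t, function_ext fun x hx ↦ ⟨V x hx, hV x hx, hxV x hx, ?_⟩⟩
  rw [← fn_res, ← hs x hx]
  exact congrArg _ (ht ⟨x, hx⟩)

theorem mulIdeals_tres {A B : X.Modules} (α : A ⟶ structureSheaf X) (β : B ⟶ structureSheaf X)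
    {V U : X.Opens} (h : V ≤ U) (z : Γ(A, U) ⊗[Γ(X, U)] Γ(B, U)) :
    mulIdeals α β V (tres A B h z) = ores X h (mulIdeals α β U z) := by
  induction z using TensorProduct.induction_on with
  | zero => simp only [map_zero]
  | tmul s t =>
    change fn α V (res A h s) * fn β V (res B h t) = ores X h (fn α U s * fn β U t)
    rw [fn_res, fn_res, map_mul]
  | add z w hz hw => simp only [map_add, hz, hw]

theorem mulIdeals_mem {A B : X.Modules} (α : A ⟶ structureSheaf X) (β : B ⟶ structureSheaf X)
    {U : X.Opens} (z : Γ(A, U) ⊗[Γ(X, U)] Γ(B, U)) :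
    mulIdeals α β U z ∈ LinearMap.range (fn α U) ⊓ LinearMap.range (fn β U) := by
  induction z using TensorProduct.induction_on with
  | zero => rw [map_zero]; exact zero_mem _
  | tmul s t =>
    refine ⟨⟨fn β U t • s, ?_⟩, ⟨fn α U s • t, ?_⟩⟩
    · rw [LinearMap.map_smul, smul_eq_mul, mul_comm]; rfl
    · rw [LinearMap.map_smul, smul_eq_mul]; rfl
  | add z w hz hw => rw [map_add]; exact add_mem hz hw

/-- Injectivity and the description of the image are local, and products of functions from both
ideals always lie in the intersection. So it is enough to know, on arbitrarily small open sets, that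
the multiplication map is injective and reaches the whole intersection. -/
theorem exists_tensor_ideals_hom {A B : X.Modules} {α : A ⟶ structureSheaf X}
    {β : B ⟶ structureSheaf X} (hα : ∀ U, Function.Injective (fn α U))
    (hβ : ∀ U, Function.Injective (fn β U))
    (h : ∀ (U : X.Opens), ∀ x ∈ U, ∃ V ≤ U, x ∈ V ∧ Function.Injective (mulIdeals α β V) ∧
      LinearMap.range (fn α V) ⊓ LinearMap.range (fn β V) ≤ LinearMap.range (mulIdeals α β V)) :
    ∃ γ : tensor A B ⟶ structureSheaf X, (∀ U, Function.Injective (fn γ U)) ∧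
      ∀ (U : X.Opens), LinearMap.range (fn γ U) =
        LinearMap.range (fn α U) ⊓ LinearMap.range (fn β U) := by
  obtain ⟨γ, hγ⟩ := exists_tensor_desc A B (G := structureSheaf X)
    (fun U ↦ ((LinearMap.mul Γ(X, U) Γ(X, U)).compl₁₂ (fn α U) (fn β U)).compr₂
      (unitSec U).symm.toLinearMap) (fun {V U} h s t ↦ by
        have := mulIdeals_tres α β h (s ⊗ₜ t)
        exact this)
  have hγ' (U : X.Opens) (z) : fn γ U (tensorSections A B U z) = mulIdeals α β U z := by
    change unitSec U (γ.app U (tensorSections A B U z)) = _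
    rw [hγ]
    induction z using TensorProduct.induction_on with
    | zero => simp only [map_zero]
    | tmul s t => rfl
    | add z w hz hw => simp only [map_add, hz, hw]
  have hinj (U : X.Opens) : Function.Injective (fn γ U) := by
    rw [injective_iff_map_eq_zero]
    intro t ht
    refine section_ext fun x hx ↦ ?_
    obtain ⟨V, hV, hxV, z, hz⟩ := exists_tensorSections_eq A B t hx
    obtain ⟨W, hW, hxW, hi, -⟩ := h V x hxV
    refine ⟨W, hW.trans hV, hxW, ?_⟩
    have h1 : res _ (hW.trans hV) t = tensorSections A B W (tres A B hW z) := by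
      rw [tensorSections_tres, hz, res_res]
    have h2 : tres A B hW z = 0 := by
      apply hi
      rw [← hγ', ← h1, fn_res, ht, map_zero, map_zero]
    rw [h1, h2, map_zero, map_zero]
  refine ⟨γ, hinj, fun U ↦ le_antisymm ?_ ?_⟩
  · rintro _ ⟨t, rfl⟩
    have hl : ∀ x ∈ U, ∃ (V : X.Opens) (hV : V ≤ U), x ∈ V ∧ ores X hV (fn γ U t) ∈
        LinearMap.range (fn α V) ⊓ LinearMap.range (fn β V) := by
      intro x hx
      obtain ⟨V, hV, hxV, z, hz⟩ := exists_tensorSections_eq A B t hx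
      refine ⟨V, hV, hxV, ?_⟩
      rw [← fn_res, ← hz, hγ']
      exact mulIdeals_mem α β z
    constructor
    · exact mem_range_fn_of_locally hα fun x hx ↦
        let ⟨V, hV, hxV, hr⟩ := hl x hx; ⟨V, hV, hxV, hr.1⟩
    · exact mem_range_fn_of_locally hβ fun x hx ↦
        let ⟨V, hV, hxV, hr⟩ := hl x hx; ⟨V, hV, hxV, hr.2⟩
  · rintro r ⟨⟨s, hs⟩, ⟨t, ht⟩⟩
    refine mem_range_fn_of_locally hinj fun x hx ↦ ?_
    obtain ⟨V, hV, hxV, -, hr⟩ := h U x hx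
    obtain ⟨z, hz⟩ := hr (x := ores X hV r) ⟨⟨res A hV s, by rw [fn_res, hs]⟩,
      ⟨res B hV t, by rw [fn_res, ht]⟩⟩
    exact ⟨V, hV, hxV, tensorSections A B V z, by rw [hγ', hz]⟩

/-- `M` is locally free, so `T ⊗ M` is locally a power of `T` inside the same power of the structure
sheaf. Hence the image consists of the sections whose coordinates, in some basis near each point,
lie in the ideal. -/
theorem exists_ideal_tensor_hom {T M : X.Modules} (τ : T ⟶ structureSheaf X)
    (hτ : ∀ U, Function.Injective (fn τ U))
    (hM : ∀ x : X, ∃ (U : X.Opens) (n : ℕ) (e : Fin n → Γ(M, U)), x ∈ U ∧ IsBasis M e) :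
    ∃ φ : tensor T M ⟶ M, (∀ U, Function.Injective (φ.app U)) ∧
      ∀ (U : X.Opens) (m : Γ(M, U)), (∀ x ∈ U, ∃ (V : X.Opens) (hV : V ≤ U) (n : ℕ)
        (e : Fin n → Γ(M, V)) (he : IsBasis M e), x ∈ V ∧
          ∀ a, he.coord le_rfl (res M hV m) a ∈ LinearMap.range (fn τ V)) ↔
        ∃ k, φ.app U k = m := by
  obtain ⟨φ, hφ⟩ := exists_tensor_desc T M (G := M)
    (fun U ↦ (LinearMap.lsmul Γ(X, U) Γ(M, U)).comp (fn τ U)) (fun {V U} h s t ↦ by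
        change fn τ V (res T h s) • res M h t = res M h (fn τ U s • t)
        rw [fn_res, res_smul])
  have hφ' {U : X.Opens} (s : Γ(T, U)) (t : Γ(M, U)) : φ.app U (tmul s t) = fn τ U s • t :=
    hφ U (s ⊗ₜ t)
  have hφe {n : ℕ} {U V : X.Opens} (e : Fin n → Γ(M, U)) (h : V ≤ U) (s : Fin n → Γ(T, V)) :
      φ.app V (∑ a, tmul (s a) (res M h (e a))) = ∑ a, fn τ V (s a) • res M h (e a) := by
    simp only [map_sum, hφ']
  have hinj (U : X.Opens) : Function.Injective (φ.app U) := by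
    intro t t' ht
    refine section_ext fun x hx ↦ ?_
    obtain ⟨V, n, e, hxV, he⟩ := hM x
    refine ⟨U ⊓ V, inf_le_left, ⟨hx, hxV⟩, ?_⟩
    obtain ⟨s, hs⟩ := (bijective_sum_tmul (M := T) he (inf_le_right : U ⊓ V ≤ V)).surjective
      (res _ inf_le_left t)
    obtain ⟨s', hs'⟩ := (bijective_sum_tmul (M := T) he (inf_le_right : U ⊓ V ≤ V)).surjective
      (res _ inf_le_left t')
    have h1 := congrArg (res M (inf_le_left : U ⊓ V ≤ U)) ht
    rw [← app_res, ← app_res, ← hs, ← hs', hφe, hφe] at h1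
    have h2 := (he _ inf_le_right).injective h1
    have h3 : s = s' := funext fun a ↦ hτ _ (congrFun h2 a)
    rw [← hs, ← hs', h3]
  refine ⟨φ, hinj, fun U m ↦ ⟨fun h ↦ ?_, ?_⟩⟩
  · choose V hV n e he hxV s hs using h
    let k (x : X) (hx : x ∈ U) : Γ(tensor T M, V x hx) :=
      ∑ a, tmul (s x hx a) (res M le_rfl (e x hx a))
    have hk (x : X) (hx : x ∈ U) : φ.app _ (k x hx) = res M (hV x hx) m := by
      rw [hφe, ← (he x hx).sum_coord le_rfl (res M (hV x hx) m)]
      simp only [hs]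
    obtain ⟨t, ht⟩ := section_glue (fun x : U ↦ V x.1 x.2) (fun x ↦ hV x.1 x.2)
      (fun x hx ↦ ⟨⟨x, hx⟩, hxV x hx⟩) (fun x ↦ k x.1 x.2) (fun x y ↦ by
        apply hinj
        rw [app_res, app_res, hk, hk, res_res, res_res])
    refine ⟨t, section_ext fun x hx ↦ ⟨V x hx, hV x hx, hxV x hx, ?_⟩⟩
    rw [← app_res, ← hk x hx]
    exact congrArg _ (ht ⟨x, hx⟩)
  · rintro ⟨k, rfl⟩ x hx
    obtain ⟨V, n, e, hxV, he⟩ := hM x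
    refine ⟨U ⊓ V, inf_le_left, n, _, he.mono inf_le_right, ⟨hx, hxV⟩, fun a ↦ ?_⟩
    obtain ⟨s, hs⟩ := (bijective_sum_tmul (M := T) he (inf_le_right : U ⊓ V ≤ V)).surjective
      (res _ inf_le_left k)
    refine ⟨s a, ?_⟩
    rw [← app_res, ← hs, hφe, he.coord_mono, he.coord_sum]

end Ideals

/-! ### Flatness and tensor products of ideals in rings -/

section FlatIdeals

open TensorProduct

variable {R₀ R : Type*} [CommRing R₀] [CommRing R] [Algebra R₀ R] [Module.Flat R₀ R]

/-- Let `T₀ ⊆ R₀` be the common kernel of maps `R₀ → S i`. If `R` is flat over `R₀`, the common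
kernel of the maps `R → R ⊗ S i` is `T₀ R`. -/
theorem exists_sum_of_tmul_eq_zero {ι : Type*} [Finite ι] {S : ι → Type*} [∀ i, CommRing (S i)]
    [∀ i, Algebra R₀ (S i)] {r : R} (hr : ∀ i, r ⊗ₜ[R₀] (1 : S i) = 0) :
    ∃ z : R ⊗[R₀] (⨅ i, LinearMap.ker (Algebra.linearMap R₀ (S i)) : Submodule R₀ R₀),
      TensorProduct.rid R₀ R (LinearMap.lTensor R (Submodule.subtype _) z) = r := by
  classical
  have := Fintype.ofFinite ι
  -- The common kernel is the kernel of one map to the product. Flatness keeps this exact after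
  -- tensoring with `R`, and `⊗` commutes with the product because `ι` is finite.
  let p : R₀ →ₗ[R₀] ∀ i, S i := LinearMap.pi fun i ↦ Algebra.linearMap R₀ (S i)
  have hp : (⨅ i, LinearMap.ker (Algebra.linearMap R₀ (S i))) = LinearMap.ker p :=
    (LinearMap.ker_pi _).symm
  have hex : Function.Exact (Submodule.subtype (⨅ i, LinearMap.ker (Algebra.linearMap R₀ (S i)))) p := by
    rw [LinearMap.exact_iff, Submodule.range_subtype, hp]
  have h := Module.Flat.lTensor_exact R hex
  obtain ⟨z, hz⟩ := (h (r ⊗ₜ 1)).1 (by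
    apply (TensorProduct.piRight R₀ R₀ R S).injective
    rw [map_zero]
    funext i
    simpa [p] using hr i)
  exact ⟨z, by rw [hz]; simp⟩

variable {Q A B : Type*} [AddCommGroup Q] [Module R₀ Q] [Module.Flat R₀ Q] [AddCommGroup A]
  [Module R A] [Module R₀ A] [IsScalarTower R₀ R A] [AddCommGroup B] [Module R B]
  (q : R →ₗ[R₀] Q) (hq : Function.Surjective q) (α : A →ₗ[R] R) (hα : Function.Injective α)
  (hαq : ∀ r, q r = 0 ↔ ∃ a, α a = r) (T₀ : Submodule R₀ R₀) (β : B →ₗ[R] R)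
  (hβ : Function.Injective β)
  (hT : ∀ r, (∃ b, β b = r) ↔
    ∃ z : R ⊗[R₀] T₀, TensorProduct.rid R₀ R (LinearMap.lTensor R T₀.subtype z) = r)
include hq hα hαq hβ hT

/-- Here `A` is an ideal of `R` with quotient `Q` flat over `R₀`, and `B` is the extension `T₀R` of
an ideal of `R₀`. Elements of `A ⊗_R B` come from `A ⊗_{R₀} T₀`, which embeds into `R ⊗ T₀` because
`Q` is flat, and then into `R` because `R` is flat. An element of the intersection comes from some
`z ∈ R ⊗ T₀`; its image in `Q ⊗ T₀ ⊆ Q` vanishes, so `z` comes from `A ⊗ T₀`. -/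
theorem tensor_ideals_of_flat :
    Function.Injective (TensorProduct.lift ((LinearMap.mul R R).compl₁₂ α β)) ∧
      ∀ r, (∃ a, α a = r) → (∃ b, β b = r) →
        ∃ z, TensorProduct.lift ((LinearMap.mul R R).compl₁₂ α β) z = r := by
  let α₀ : A →ₗ[R₀] R := α.restrictScalars R₀
  have hex : Function.Exact α₀ q := fun r ↦ hαq r
  let m : A ⊗[R₀] T₀ →ₗ[R₀] R :=
    (TensorProduct.rid R₀ R).toLinearMap ∘ₗ LinearMap.lTensor R T₀.subtype ∘ₗ LinearMap.rTensor T₀ α₀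
  have hm : Function.Injective m := by
    refine (TensorProduct.rid R₀ R).injective.comp
      ((Module.Flat.lTensor_preserves_injective_linearMap _ T₀.subtype_injective).comp ?_)
    have := LinearMap.lTensor_injective_of_exact_of_flat q hq α₀ hα hex T₀
    exact (LinearMap.lTensor_inj_iff_rTensor_inj _ _).1 this
  have hb (t : T₀) : ∃ b, β b = algebraMap R₀ R t :=
    (hT _).2 ⟨1 ⊗ₜ t, by simp [Algebra.algebraMap_eq_smul_one]⟩
  choose b hb using hb
  have hb_smul (r : R₀) (t : T₀) : b (r • t) = algebraMap R₀ R r • b t :=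
    hβ (by rw [hb, _root_.map_smul, hb]; simp)
  let b' : T₀ →+ B :=
    { toFun := b
      map_zero' := hβ (by rw [hb]; simp)
      map_add' := fun t t' ↦ hβ (by rw [map_add, hb, hb, hb]; simp) }
  -- Only surjectivity of `ψ` has to be shown: its composite with the multiplication map is `m`,
  -- which is injective, so the multiplication map is injective as well.
  let ψ : A ⊗[R₀] T₀ →+ A ⊗[R] B := TensorProduct.liftAddHom
    { toFun := fun a ↦ (TensorProduct.mk R A B a).toAddMonoidHom.comp b'
      map_zero' := by ext; simp
      map_add' := fun a a' ↦ by ext; simp } (fun r a t ↦ by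
        change (r • a) ⊗ₜ[R] b t = a ⊗ₜ[R] b (r • t)
        rw [hb_smul, ← TensorProduct.smul_tmul, algebraMap_smul])
  have hψ (a : A) (t : T₀) : ψ (a ⊗ₜ t) = a ⊗ₜ b t := rfl
  let χ : R ⊗[R₀] T₀ →+ B := TensorProduct.liftAddHom
    { toFun := fun r ↦ (DistribSMul.toAddMonoidHom B r).comp b'
      map_zero' := by ext; simp
      map_add' := fun a a' ↦ by ext; simp [add_smul] } (fun r a t ↦ by
        change (r • a) • b t = a • b (r • t)
        rw [hb_smul, ← mul_smul, Algebra.smul_def, mul_comm])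
  have hχ (z) : β (χ z) = TensorProduct.rid R₀ R (LinearMap.lTensor R T₀.subtype z) := by
    induction z using TensorProduct.induction_on with
    | zero => simp
    | add z w hz hw => simp [hz, hw]
    | tmul r t =>
      change β (r • b t) = _
      rw [_root_.map_smul, hb]
      simp [Algebra.smul_def, mul_comm]
  have hψs : Function.Surjective ψ := by
    intro z
    induction z using TensorProduct.induction_on with
    | zero => exact ⟨0, map_zero _⟩
    | add z w hz hw =>
      obtain ⟨x, rfl⟩ := hz
      obtain ⟨y, rfl⟩ := hw
      exact ⟨x + y, map_add _ _ _⟩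
    | tmul a c =>
      obtain ⟨z, hz⟩ := (hT (β c)).1 ⟨c, rfl⟩
      obtain rfl : c = χ z := hβ (by rw [hχ, hz])
      clear hz
      induction z using TensorProduct.induction_on with
      | zero => exact ⟨0, by simp⟩
      | add z w hz hw =>
        obtain ⟨x, hx⟩ := hz
        obtain ⟨y, hy⟩ := hw
        exact ⟨x + y, by rw [map_add, map_add, TensorProduct.tmul_add, hx, hy]⟩
      | tmul r t =>
        refine ⟨(r • a) ⊗ₜ t, ?_⟩
        change (r • a) ⊗ₜ b t = a ⊗ₜ (r • b t)
        rw [TensorProduct.smul_tmul]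
  have hm' (w : A ⊗[R₀] T₀) :
      TensorProduct.lift ((LinearMap.mul R R).compl₁₂ α β) (ψ w) = m w := by
    induction w using TensorProduct.induction_on with
    | zero => simp
    | add z w hz hw => simp only [map_add, hz, hw]
    | tmul a t =>
      rw [hψ]
      simp [m, α₀, hb, Algebra.smul_def, mul_comm]
  refine ⟨?_, ?_⟩
  · rw [injective_iff_map_eq_zero]
    intro z hz
    obtain ⟨w, rfl⟩ := hψs z
    rw [hm'] at hz
    rw [hm (hz.trans (map_zero m).symm), map_zero]
  · rintro r hr hr'
    obtain ⟨z, rfl⟩ := (hT r).1 hr'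
    -- Flatness of `Q` makes `Q ⊗ T₀ → Q` injective, and there `z` maps to the class of an element
    -- of `A`.
    have h0 : LinearMap.rTensor T₀ q z = 0 := by
      apply Module.Flat.lTensor_preserves_injective_linearMap (M := Q) _ T₀.subtype_injective
      apply (TensorProduct.rid R₀ Q).injective
      rw [map_zero, map_zero, ← (hαq _).2 hr]
      clear hr hr'
      induction z using TensorProduct.induction_on with
      | zero => simp
      | add z w hz hw => simp only [map_add, hz, hw]
      | tmul r t => simp
    obtain ⟨w, rfl⟩ := (rTensor_exact T₀ hex hq z).1 h0
    exact ⟨ψ w, hm' w⟩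

end FlatIdeals

/-! ### Powers of `X`, projections and diagonals -/

section PowerGeometry

variable {k : Type u} [Field k] {X : Scheme.{u}} (f : X ⟶ Spec (CommRingCat.of k))

theorem IsProjective.isSeparated {f : X ⟶ Spec (CommRingCat.of k)} (hX : IsProjective f) :
    IsSeparated f ∧ X.IsSeparated := by
  obtain ⟨n, i, hi, rfl⟩ := hX
  have h1 : (projectiveSpace k n).IsSeparated := by
    let := MvPolynomial.gradedAlgebra (σ := Fin (n + 1)) (R := k)
    exact inferInstanceAs (Scheme.IsSeparated
      (Proj (MvPolynomial.homogeneousSubmodule (Fin (n + 1)) k)))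
  have h2 : X.IsSeparated := by
    constructor
    rw [← terminal.comp_from i]
    infer_instance
  exact ⟨.of_comp _ (terminal.from _), h2⟩

section Lift

variable {T : Scheme.{u}} {r : ℕ}

/-- The morphism to `X(r)` with given components. -/
def liftPower (b : T ⟶ Spec (CommRingCat.of k)) (g : Fin r → (T ⟶ X)) (h : ∀ i, g i ≫ f = b) :
    T ⟶ power f r :=
  WidePullback.lift b g h

@[simp]
theorem liftPower_proj (b : T ⟶ Spec (CommRingCat.of k)) (g : Fin r → (T ⟶ X))
    (h : ∀ i, g i ≫ f = b) (i : Fin r) : liftPower f b g h ≫ proj f r i = g i :=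
  WidePullback.lift_π (fun _ : Fin r ↦ f) b g h i

variable {f}

theorem power_hom_ext {g h : T ⟶ power f (r + 1)}
    (H : ∀ i, g ≫ proj f (r + 1) i = h ≫ proj f (r + 1) i) : g = h := by
  refine WidePullback.hom_ext (fun _ : Fin (r + 1) ↦ f) g h H ?_
  rw [← WidePullback.π_arrow (fun _ : Fin (r + 1) ↦ f) 0]
  exact congr($(H 0) ≫ f)

end Lift

/-- The projection `X(r + 2) ⟶ X(r + 1)` that forgets one coordinate. -/
def drop {r : ℕ} (j : Fin (r + 2)) : power f (r + 2) ⟶ power f (r + 1) :=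
  liftPower f (proj f (r + 2) 0 ≫ f) (fun i ↦ proj f (r + 2) (j.succAbove i))
    fun _ ↦ proj_comp f _ _ _

theorem drop_proj {r : ℕ} (j : Fin (r + 2)) (i : Fin (r + 1)) :
    drop f j ≫ proj f (r + 1) i = proj f (r + 2) (j.succAbove i) :=
  liftPower_proj ..

theorem isPullback_drop {r : ℕ} (j : Fin (r + 2)) :
    IsPullback (drop f j) (proj f (r + 2) j) (proj f (r + 1) 0 ≫ f) f := by
  refine ⟨⟨by rw [← Category.assoc, drop_proj, proj_comp]⟩, ⟨PullbackCone.IsLimit.mk _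
    (fun s ↦ liftPower f (s.snd ≫ f) (j.insertNth s.snd fun i ↦ s.fst ≫ proj f (r + 1) i) ?_)
    (fun s ↦ power_hom_ext fun i ↦ ?_) (fun s ↦ ?_) fun s m h1 h2 ↦ power_hom_ext fun i ↦ ?_⟩⟩
  · intro i
    cases i using j.succAboveCases with
    | x => simp
    | p i =>
      rw [Fin.insertNth_apply_succAbove, Category.assoc, proj_comp f _ i 0]
      exact s.condition
  · rw [Category.assoc, drop_proj, liftPower_proj, Fin.insertNth_apply_succAbove]
  · rw [liftPower_proj, Fin.insertNth_apply_same]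
  · rw [liftPower_proj]
    cases i using j.succAboveCases with
    | x => simpa using h2
    | p i => rw [Fin.insertNth_apply_succAbove, ← h1, Category.assoc, drop_proj]

instance {r : ℕ} (j : Fin (r + 2)) [Flat f] : Flat (drop f j) :=
  MorphismProperty.of_isPullback (isPullback_drop f j).flip ‹_›

/-- The inclusion `X(r + 1) ⟶ X(r + 2)` of the diagonal where the first coordinate is repeated in
position `j + 1`. -/
def diag {r : ℕ} (j : Fin (r + 1)) : power f (r + 1) ⟶ power f (r + 2) :=
  liftPower f (proj f (r + 1) 0 ≫ f) (j.succ.insertNth (proj f (r + 1) 0) (proj f (r + 1)))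
    fun i ↦ by
      cases i using j.succ.succAboveCases with
      | x => simp
      | p i => rw [Fin.insertNth_apply_succAbove, proj_comp]

theorem diag_proj_same {r : ℕ} (j : Fin (r + 1)) :
    diag f j ≫ proj f (r + 2) j.succ = proj f (r + 1) 0 := by
  rw [diag, liftPower_proj, Fin.insertNth_apply_same]

theorem diag_proj_succAbove {r : ℕ} (j i : Fin (r + 1)) :
    diag f j ≫ proj f (r + 2) (j.succ.succAbove i) = proj f (r + 1) i := by
  rw [diag, liftPower_proj, Fin.insertNth_apply_succAbove]

theorem diag_proj_zero {r : ℕ} (j : Fin (r + 1)) :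
    diag f j ≫ proj f (r + 2) 0 = proj f (r + 1) 0 := by
  rw [← diag_proj_succAbove f j 0, Fin.succ_succAbove_zero]

theorem diag_drop {r : ℕ} (j : Fin (r + 1)) : diag f j ≫ drop f j.succ = 𝟙 _ :=
  power_hom_ext fun i ↦ by rw [Category.assoc, drop_proj, diag_proj_succAbove, Category.id_comp]

theorem projPair_fst (r : ℕ) (i j : Fin r) : projPair f r i j ≫ pullback.fst f f = proj f r i :=
  pullback.lift_fst ..

theorem projPair_snd (r : ℕ) (i j : Fin r) : projPair f r i j ≫ pullback.snd f f = proj f r j :=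
  pullback.lift_snd ..

/-- This replaces the fibre product in `diagonalIdeal` by `X(r + 1)` itself: a point of the diagonal
is recovered after dropping its repeated coordinate. -/
theorem isPullback_diag {r : ℕ} (j : Fin (r + 1)) :
    IsPullback (diag f j) (proj f (r + 1) 0) (projPair f (r + 2) 0 j.succ)
      (pullback.diagonal f) := by
  refine ⟨⟨pullback.hom_ext ?_ ?_⟩, ⟨PullbackCone.IsLimit.mk _ (fun s ↦ s.fst ≫ drop f j.succ)
    (fun s ↦ power_hom_ext fun i ↦ ?_) (fun s ↦ ?_) fun s m h1 _ ↦ ?_⟩⟩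
  · rw [Category.assoc, Category.assoc, projPair_fst, diag_proj_zero, pullback.diagonal_fst,
      Category.comp_id]
  · rw [Category.assoc, Category.assoc, projPair_snd, diag_proj_same, pullback.diagonal_snd,
      Category.comp_id]
  · have h1 := congr($(s.condition) ≫ pullback.fst f f)
    have h2 := congr($(s.condition) ≫ pullback.snd f f)
    rw [Category.assoc, Category.assoc, projPair_fst, pullback.diagonal_fst, Category.comp_id] at h1
    rw [Category.assoc, Category.assoc, projPair_snd, pullback.diagonal_snd, Category.comp_id] at h2
    cases i using j.succ.succAboveCases with
    | x => rw [Category.assoc, Category.assoc, diag_proj_same, drop_proj, Fin.succ_succAbove_zero,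
        h1, h2]
    | p i => rw [Category.assoc, Category.assoc, diag_proj_succAbove, drop_proj]
  · have h1 := congr($(s.condition) ≫ pullback.fst f f)
    rw [Category.assoc, Category.assoc, projPair_fst, pullback.diagonal_fst, Category.comp_id] at h1
    rw [Category.assoc, drop_proj, Fin.succ_succAbove_zero, h1]
  · rw [← h1, Category.assoc, diag_drop, Category.comp_id]

instance {r : ℕ} (j : Fin (r + 1)) [IsSeparated f] : IsClosedImmersion (diag f j) :=
  MorphismProperty.of_isPullback (isPullback_diag f j).flip inferInstance

theorem drop_projPair {r : ℕ} (j : Fin (r + 2)) (i i' : Fin (r + 1)) :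
    drop f j ≫ projPair f (r + 1) i i' = projPair f (r + 2) (j.succAbove i) (j.succAbove i') :=
  pullback.hom_ext (by rw [Category.assoc, projPair_fst, projPair_fst, drop_proj])
    (by rw [Category.assoc, projPair_snd, projPair_snd, drop_proj])

/-- The diagonals in `X(r + 2)` not involving position `j` come from `X(r + 1)`. -/
theorem isPullback_diag_drop {r : ℕ} {j : Fin (r + 1)} {i : Fin (r + 1)} (h : i ≠ j) :
    ∃ (Z : Scheme.{u}) (b : power f (r + 1) ⟶ Z) (g : Z ⟶ power f (r + 1)),
      IsPullback (diag f i) b (drop f j.succ) g ∧ (IsSeparated f → IsClosedImmersion g) := by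
  obtain ⟨i', hi'⟩ := Fin.exists_succAbove_eq (x := i.succ) (y := j.succ) (by simpa using h)
  have e : projPair f (r + 2) 0 i.succ = drop f j.succ ≫ projPair f (r + 1) 0 i' := by
    rw [drop_projPair, hi', Fin.succ_succAbove_zero]
  have H := isPullback_diag f i
  rw [e] at H
  let b : power f (r + 1) ⟶ pullback (projPair f (r + 1) 0 i') (pullback.diagonal f) :=
    pullback.lift (diag f i ≫ drop f j.succ) (proj f _ 0) ((Category.assoc _ _ _).trans H.w)
  have hb : b ≫ pullback.snd _ _ = proj f _ 0 := pullback.lift_snd ..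
  refine ⟨_, b, pullback.fst _ _, (IsPullback.of_right (h₁₁ := b) (h₁₂ := pullback.snd _ _)
    (v₁₂ := pullback.fst _ _) ?_ (pullback.lift_fst ..)
    (IsPullback.of_hasPullback (projPair f (r + 1) 0 i') (pullback.diagonal f)).flip).flip,
      fun _ ↦ inferInstance⟩
  rw [hb]
  exact H.flip

end PowerGeometry

/-! ### Tensor products of ideal sheaves under flatness -/

section FlatIdealSheaves

/-- Over affine open sets the functions on the fibre product are the tensor product of the function
rings, so vanishing on `S` can be tested there. -/
theorem tmul_one_eq_zero_of_isPullback {P P₀ S S₀ : Scheme.{u}} {a : P ⟶ P₀} {g : S ⟶ P}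
    {b : S ⟶ S₀} {g₀ : S₀ ⟶ P₀} (H : IsPullback g b a g₀) [IsAffineHom g₀] {V : P.Opens}
    {V₀ : P₀.Opens} (hV : IsAffineOpen V) (hV₀ : IsAffineOpen V₀) (h : V ≤ a ⁻¹ᵁ V₀) {r : Γ(P, V)}
    (hr : g.app V r = 0) :
    letI := (a.appLE V₀ V h).hom.toAlgebra
    letI := (g₀.app V₀).hom.toAlgebra
    r ⊗ₜ[Γ(P₀, V₀)] (1 : Γ(S₀, g₀ ⁻¹ᵁ V₀)) = 0 := by
  let _ := (a.appLE V₀ V h).hom.toAlgebra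
  let _ := (g₀.app V₀).hom.toAlgebra
  have H1 := (isIso_pushoutSection_iff H le_rfl h rfl).1
    (isIso_pushoutSection_of_isAffineOpen H le_rfl h rfl hV₀ (hV₀.preimage g₀) hV)
  let i₁ : Γ(P, V) ⟶ CommRingCat.of (Γ(P, V) ⊗[Γ(P₀, V₀)] Γ(S₀, g₀ ⁻¹ᵁ V₀)) :=
    CommRingCat.ofHom Algebra.TensorProduct.includeLeftRingHom
  let i₂ : Γ(S₀, g₀ ⁻¹ᵁ V₀) ⟶ CommRingCat.of (Γ(P, V) ⊗[Γ(P₀, V₀)] Γ(S₀, g₀ ⁻¹ᵁ V₀)) :=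
    CommRingCat.ofHom (Algebra.TensorProduct.includeRight (R := Γ(P₀, V₀))
      (A := Γ(P, V)) (B := Γ(S₀, g₀ ⁻¹ᵁ V₀))).toRingHom
  have w : a.appLE V₀ V h ≫ i₁ = g₀.appLE V₀ (g₀ ⁻¹ᵁ V₀) le_rfl ≫ i₂ := by
    rw [← Scheme.Hom.app_eq_appLE]
    ext x
    change (algebraMap Γ(P₀, V₀) Γ(P, V) x) ⊗ₜ 1 = 1 ⊗ₜ (algebraMap Γ(P₀, V₀) Γ(S₀, g₀ ⁻¹ᵁ V₀) x)
    rw [Algebra.algebraMap_eq_smul_one, Algebra.algebraMap_eq_smul_one, TensorProduct.smul_tmul]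
  have h1 : i₁ r = 0 := by
    rw [← H1.inl_desc i₁ i₂ w, CommRingCat.comp_apply]
    have : g.appLE V (g ⁻¹ᵁ V ⊓ b ⁻¹ᵁ (g₀ ⁻¹ᵁ V₀)) inf_le_left r = 0 := by
      have := g.map_appLE (U := V) (U' := V) (V := g ⁻¹ᵁ V) le_rfl (𝟙 _)
      rw [← Scheme.Hom.appLE_map g le_rfl (homOfLE inf_le_left).op, ← Scheme.Hom.app_eq_appLE,
        CommRingCat.comp_apply, hr, map_zero]
    rw [this, map_zero]
  exact h1

variable {P P₀ Z : Scheme.{u}} {a : P ⟶ P₀} [Flat a] {σ : Z ⟶ P} [IsClosedImmersion σ]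
  [Flat (σ ≫ a)] {ι : Type} [Finite ι] {S S₀ : ι → Scheme.{u}} {g : ∀ i, S i ⟶ P}
  {b : ∀ i, S i ⟶ S₀ i} {g₀ : ∀ i, S₀ i ⟶ P₀} [∀ i, IsAffineHom (g₀ i)]
  (H : ∀ i, IsPullback (g i) (b i) a (g₀ i)) {A B : P.Modules} {α : A ⟶ structureSheaf P}
  {β : B ⟶ structureSheaf P} (hα : ∀ U, Function.Injective (fn α U))
  (hα' : ∀ U r, r ∈ LinearMap.range (fn α U) ↔ σ.app U r = 0)
  (hβ : ∀ U, Function.Injective (fn β U))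
  (hβ' : ∀ U r, r ∈ LinearMap.range (fn β U) ↔ ∀ i, (g i).app U r = 0)
include H hα hα' hβ hβ'

/-- Geometric form of `tensor_ideals_of_flat`: `R₀` and `R` are the functions on `V₀` and `V`, `Q`
those on the part of `Z` over `V`, and `T₀` is the ideal of functions on `V₀` that vanish on every
`S₀ i`. -/
theorem tensor_ideals_of_isAffineOpen {V : P.Opens} {V₀ : P₀.Opens} (hV : IsAffineOpen V)
    (hV₀ : IsAffineOpen V₀) (h : V ≤ a ⁻¹ᵁ V₀) : Function.Injective (mulIdeals α β V) ∧
      LinearMap.range (fn α V) ⊓ LinearMap.range (fn β V) ≤ LinearMap.range (mulIdeals α β V) := by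
  let _ : Algebra Γ(P₀, V₀) Γ(P, V) := (a.appLE V₀ V h).hom.toAlgebra
  let _ : ∀ i, Algebra Γ(P₀, V₀) Γ(S₀ i, g₀ i ⁻¹ᵁ V₀) := fun i ↦ ((g₀ i).app V₀).hom.toAlgebra
  let _ : Algebra Γ(P₀, V₀) Γ(Z, σ ⁻¹ᵁ V) :=
    ((σ ≫ a).appLE V₀ (σ ⁻¹ᵁ V) (σ.preimage_mono h)).hom.toAlgebra
  have _ : Module.Flat Γ(P₀, V₀) Γ(P, V) := a.flat_appLE hV₀ hV h
  have _ : Module.Flat Γ(P₀, V₀) Γ(Z, σ ⁻¹ᵁ V) :=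
    (σ ≫ a).flat_appLE hV₀ (hV.preimage σ) (σ.preimage_mono h)
  let _ : Module Γ(P₀, V₀) Γ(A, V) := Module.compHom _ (algebraMap Γ(P₀, V₀) Γ(P, V))
  have _ : IsScalarTower Γ(P₀, V₀) Γ(P, V) Γ(A, V) := .of_algebraMap_smul fun _ _ ↦ rfl
  let q : Γ(P, V) →ₗ[Γ(P₀, V₀)] Γ(Z, σ ⁻¹ᵁ V) :=
    { (σ.app V).hom.toAddMonoidHom with
      map_smul' := fun c r ↦ by
        change σ.app V (a.appLE V₀ V h c * r) =
          (σ ≫ a).appLE V₀ (σ ⁻¹ᵁ V) (σ.preimage_mono h) c * σ.app V r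
        rw [map_mul, ← Scheme.Hom.appLE_comp_appLE σ a V₀ V (σ ⁻¹ᵁ V) h le_rfl,
          ← Scheme.Hom.app_eq_appLE, CommRingCat.comp_apply] }
  have key := tensor_ideals_of_flat q (σ.app_surjective V hV) (fn α V) (hα V)
    (fun r ↦ (hα' V r).symm)
    (⨅ i, LinearMap.ker (Algebra.linearMap Γ(P₀, V₀) Γ(S₀ i, g₀ i ⁻¹ᵁ V₀))) (fn β V) (hβ V)
    (fun r ↦ (hβ' V r).trans ⟨fun hr ↦ exists_sum_of_tmul_eq_zero
      fun i ↦ tmul_one_eq_zero_of_isPullback (H i) hV hV₀ h (hr i), ?_⟩)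
  · exact ⟨key.1, fun r hr ↦ key.2 r hr.1 hr.2⟩
  · rintro ⟨z, rfl⟩ i
    induction z using TensorProduct.induction_on with
    | zero => simp
    | add z w hz hw => rw [map_add, map_add, map_add, hz, hw, add_zero]
    | tmul r t =>
      have ht : (g₀ i).app V₀ t.1 = 0 := (Submodule.mem_iInf _).1 t.2 i
      have : (g i).app V (a.appLE V₀ V h t.1) = 0 := by
        rw [← CommRingCat.comp_apply, Scheme.Hom.app_eq_appLE, Scheme.Hom.appLE_comp_appLE]
        have e : (g i ≫ a).appLE V₀ (g i ⁻¹ᵁ V) ((g i).preimage_mono h) =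
          (b i ≫ g₀ i).appLE V₀ (g i ⁻¹ᵁ V) (by rw [← (H i).w]; exact (g i).preimage_mono h) := by
          simp only [(H i).w]
        rw [e, Scheme.Hom.comp_appLE, CommRingCat.comp_apply, ht, map_zero]
      simp only [LinearMap.lTensor_tmul, Submodule.subtype_apply, TensorProduct.rid_tmul]
      change (g i).app V (a.appLE V₀ V h t.1 * r) = 0
      rw [map_mul, this, zero_mul]

theorem exists_tensor_ideals_hom_of_flat :
    ∃ γ : tensor A B ⟶ structureSheaf P, (∀ U, Function.Injective (fn γ U)) ∧
      ∀ (U : P.Opens), LinearMap.range (fn γ U) =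
        LinearMap.range (fn α U) ⊓ LinearMap.range (fn β U) := by
  refine exists_tensor_ideals_hom hα hβ fun U x hx ↦ ?_
  obtain ⟨V₀, hV₀, hx₀, -⟩ := exists_isAffineOpen_mem_and_subset (U := ⊤) (x := a x) trivial
  obtain ⟨V, hV, hxV, hVU⟩ := exists_isAffineOpen_mem_and_subset (U := U ⊓ a ⁻¹ᵁ V₀) (x := x)
    ⟨hx, hx₀⟩
  exact ⟨V, fun y hy ↦ (hVU hy).1, hxV,
    tensor_ideals_of_isAffineOpen H hα hα' hβ hβ' hV hV₀ fun y hy ↦ (hVU hy).2⟩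

end FlatIdealSheaves

/-! ### The tensor product of the diagonal ideals is their intersection -/

section Diagonals

variable {k : Type u} [Field k] {X : Scheme.{u}} (f : X ⟶ Spec (CommRingCat.of k))

theorem app_eq_zero_iff_of_iso_comp {P Z Z' : Scheme.{u}} {e : Z' ⟶ Z} [IsIso e] {σ : Z ⟶ P}
    {σ' : Z' ⟶ P} (h : e ≫ σ = σ') (U : P.Opens) (r : Γ(P, U)) :
    σ'.app U r = 0 ↔ σ.app U r = 0 := by
  subst h
  have h : (e ≫ σ).app U r = e.app (σ ⁻¹ᵁ U) (σ.app U r) := congr($(Scheme.Hom.comp_app e σ U) r)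
  have he := (ConcreteCategory.bijective_of_isIso (e.app (σ ⁻¹ᵁ U))).1
  exact ⟨fun h0 ↦ he (h.symm.trans (h0.trans (map_zero _).symm)),
    fun h0 ↦ h.trans ((congrArg _ h0).trans (map_zero _))⟩

theorem exists_diagonalIdeal_hom {n : ℕ} (j : Fin (n + 1)) :
    ∃ α : diagonalIdeal f (n + 2) 0 j.succ ⟶ structureSheaf (power f (n + 2)),
      (∀ U, Function.Injective (fn α U)) ∧
      ∀ U r, r ∈ LinearMap.range (fn α U) ↔ (diag f j).app U r = 0 := by
  obtain ⟨α, h1, h2⟩ := exists_idealSheaf_hom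
    (pullback.fst (projPair f (n + 2) 0 j.succ) (pullback.diagonal f))
  exact ⟨α, h1, fun U r ↦ (h2 U r).trans
    (app_eq_zero_iff_of_iso_comp (isPullback_diag f j).isoPullback_hom_fst U r).symm⟩

/-- Induction on the list of diagonals. To add `Δ^{1,j}`, forget its coordinate: the diagonals
already treated are pulled back along this flat map since they differ from `Δ^{1,j}`, while
`Δ^{1,j}` maps isomorphically to the base. -/
theorem exists_firstDiagonalsIdeal_hom [Flat f] [IsSeparated f] (n : ℕ) :
    ∃ τ : firstDiagonalsIdeal f (n + 2) ⟶ structureSheaf (power f (n + 2)),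
      (∀ U, Function.Injective (fn τ U)) ∧
      ∀ U r, r ∈ LinearMap.range (fn τ U) ↔ ∀ j, (diag f j).app U r = 0 := by
  suffices h : ∀ l : List (Fin (n + 1)), l.Nodup →
      ∃ τ : tensorList ((l.map Fin.succ).map fun i ↦ diagonalIdeal f (n + 2) 0 i) ⟶
        structureSheaf (power f (n + 2)), (∀ U, Function.Injective (fn τ U)) ∧
      ∀ U r, r ∈ LinearMap.range (fn τ U) ↔ ∀ j ∈ l, (diag f j).app U r = 0 by
    have e : (List.finRange (n + 2)).tail = (List.finRange (n + 1)).map Fin.succ := by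
      rw [List.finRange_succ]; rfl
    unfold firstDiagonalsIdeal
    rw [e]
    simpa using h _ (List.nodup_finRange _)
  intro l hl
  induction l with
  | nil =>
    refine ⟨𝟙 _, fun U ↦ (unitSec U).injective, fun U r ↦ ?_⟩
    simpa using ⟨(unitSec U).symm r, (unitSec U).apply_symm_apply r⟩
  | cons j l ih =>
    obtain ⟨hj, hl⟩ := List.nodup_cons.1 hl
    obtain ⟨β, hβ, hβ'⟩ := ih hl
    obtain ⟨α, hα, hα'⟩ := exists_diagonalIdeal_hom f j
    have hne (i : {i // i ∈ l}) : i.1 ≠ j := fun h ↦ hj (h ▸ i.2)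
    choose S₀ b g₀ H hg₀ using fun i : {i // i ∈ l} ↦ isPullback_diag_drop f (hne i)
    -- This composite is the identity, which makes the quotient by the new ideal flat over `X(n +
    -- 1)`.
    have _ : Flat (diag f j ≫ drop f j.succ) := by rw [diag_drop]; infer_instance
    have _ (i) : IsClosedImmersion (g₀ i) := hg₀ i ‹_›
    obtain ⟨γ, h1, h2⟩ := exists_tensor_ideals_hom_of_flat H hα hα' hβ
      (fun U r ↦ (hβ' U r).trans (by simp))
    refine ⟨γ, h1, fun U r ↦ ?_⟩
    refine (congrArg (r ∈ ·) (h2 U)).to_iff.trans ?_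
    rw [Submodule.mem_inf, hα', hβ', List.forall_mem_cons]

end Diagonals

/-! ### Sections that vanish on a family of subschemes -/

section PullSections

variable {Y P : Scheme.{u}} (σ : Y ⟶ P) {M : P.Modules}

theorem pull_eq_zero_iff {κ : Type} [Fintype κ] {V : P.Opens} {e : κ → Γ(M, V)} (he : IsBasis M e)
    (m : Γ(M, V)) : pull σ M V m = 0 ↔ ∀ a, σ.app V (he.coord le_rfl m a) = 0 := by
  have h : (he.pull σ).coord le_rfl (pull σ M V m) = fun a ↦ σ.app V (he.coord le_rfl m a) := by
    apply IsBasis.coord_eq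
    conv_lhs => rw [← he.sum_coord le_rfl m, map_sum]
    simp [pull_smul]
  rw [← ((he.pull σ).coord le_rfl).map_eq_zero_iff, h, funext_iff]
  rfl

theorem pull_eq_zero_of_locally {U : P.Opens} {m : Γ(M, U)}
    (h : ∀ y : Y, σ y ∈ U → ∃ (V : P.Opens) (hV : V ≤ U), σ y ∈ V ∧ pull σ M V (res M hV m) = 0) :
    pull σ M U m = 0 := by
  refine section_ext fun y hy ↦ ?_
  obtain ⟨V, hV, hyV, h0⟩ := h y hy
  exact ⟨σ ⁻¹ᵁ V, σ.preimage_mono hV, hyV, by rw [← pull_res σ M hV m, h0, map_zero]⟩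

/-- Tensoring `M` with the ideal of functions that vanish on all `σ j` gives the sections of `M`
that vanish on all `σ j`. -/
theorem exists_ideal_tensor_hom_pull {J : Type*} {Y : J → Scheme.{u}} (σ : ∀ j, Y j ⟶ P)
    {T : P.Modules} (τ : T ⟶ structureSheaf P) (hτ : ∀ U, Function.Injective (fn τ U))
    (hτ' : ∀ U r, r ∈ LinearMap.range (fn τ U) ↔ ∀ j, (σ j).app U r = 0)
    (hM : ∀ x : P, ∃ (U : P.Opens) (n : ℕ) (e : Fin n → Γ(M, U)), x ∈ U ∧ IsBasis M e) :
    ∃ φ : tensor T M ⟶ M, (∀ U, Function.Injective (φ.app U)) ∧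
      ∀ (U : P.Opens) (m : Γ(M, U)), (∀ j, pull (σ j) M U m = 0) ↔ ∃ k, φ.app U k = m := by
  obtain ⟨φ, h1, h2⟩ := exists_ideal_tensor_hom τ hτ hM
  refine ⟨φ, h1, fun U m ↦ Iff.trans ⟨fun h x hx ↦ ?_, fun h j ↦ ?_⟩ (h2 U m)⟩
  · obtain ⟨V, n, e, hxV, he⟩ := hM x
    have he' := he.mono (inf_le_right : U ⊓ V ≤ V)
    refine ⟨U ⊓ V, inf_le_left, n, _, he', ⟨hx, hxV⟩, fun a ↦ (hτ' _ _).2 fun j ↦ ?_⟩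
    refine (pull_eq_zero_iff (σ j) he' _).1 ?_ a
    rw [pull_res, h j, map_zero]
  · refine pull_eq_zero_of_locally _ fun y hy ↦ ?_
    obtain ⟨V, hV, n, e, he, hyV, hr⟩ := h _ hy
    exact ⟨V, hV, hyV, (pull_eq_zero_iff (σ j) he _).2 fun a ↦ (hτ' _ _).1 (hr a) j⟩

/-- Sections given locally that agree on all `σ j` come from a global section, up to sections that
vanish on all `σ j`. -/
theorem exists_section_of_pull_eq {J : Type*} {Y : J → Scheme.{u}} (σ : ∀ j, Y j ⟶ P)
    {T : P.Modules} (τ : T ⟶ structureSheaf P) (hτ : ∀ U, Function.Injective (fn τ U))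
    (hτ' : ∀ U r, r ∈ LinearMap.range (fn τ U) ↔ ∀ j, (σ j).app U r = 0)
    (hM : ∀ x : P, ∃ (U : P.Opens) (n : ℕ) (e : Fin n → Γ(M, U)), x ∈ U ∧ IsBasis M e)
    (hH : Subsingleton (cohomology (tensor T M) 1)) {ι : Type u} (V : ι → P.Opens)
    (hV : ∀ x, ∃ i, x ∈ V i) (m : ∀ i, Γ(M, V i))
    (hm : ∀ i i' j, pull (σ j) M (V i ⊓ V i') (res M inf_le_left (m i)) =
      pull (σ j) M (V i ⊓ V i') (res M inf_le_right (m i'))) :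
    ∃ s : Γ(M, ⊤), ∀ i j, pull (σ j) M (V i) (res M le_top s) = pull (σ j) M (V i) (m i) := by
  obtain ⟨φ, h1, h2⟩ := exists_ideal_tensor_hom_pull σ τ hτ hτ' hM
  obtain ⟨s, hs⟩ := exists_section_of_subsingleton_cohomology φ h1 hH V hV m fun i i' ↦
    (h2 _ _).1 fun j ↦ by rw [map_sub, hm, sub_self]
  exact ⟨s, fun i j ↦ sub_eq_zero.1 (by rw [← map_sub]; exact (h2 _ _).2 (hs i) j)⟩

end PullSections

/-! ### Functions on open subsets as `k`-algebras, and functions on products -/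

section FunctionAlgebras

variable {k : Type u} [Field k] {X Y P : Scheme.{u}}

/-- The functions on an open subset of a `k`-scheme, as a `k`-algebra. -/
def Fn (_ : X ⟶ Spec (CommRingCat.of k)) (U : X.Opens) : Type u := Γ(X, U)

variable {f : X ⟶ Spec (CommRingCat.of k)} {g : Y ⟶ Spec (CommRingCat.of k)}
  {h : P ⟶ Spec (CommRingCat.of k)}

instance (U : X.Opens) : CommRing (Fn f U) := inferInstanceAs (CommRing Γ(X, U))

instance (U : X.Opens) : Algebra k (Fn f U) :=
  ((Scheme.ΓSpecIso (CommRingCat.of k)).inv ≫ f.appLE ⊤ U le_top).hom.toAlgebra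

theorem algebraMap_fn_eq_ores (U : X.Opens) (c : k) :
    algebraMap k (Fn f U) c = ores X le_top (scalarHom f c) := by
  have : (Scheme.ΓSpecIso (CommRingCat.of k)).inv ≫ f.appLE ⊤ U le_top =
    ((Scheme.ΓSpecIso (CommRingCat.of k)).inv ≫ f.appTop) ≫ X.presheaf.map (homOfLE le_top).op := rfl
  exact congr($this c)

/-- Pullback of functions. -/
def pb (a : P ⟶ X) (ha : a ≫ f = h) {U : X.Opens} {V : P.Opens} (hV : V ≤ a ⁻¹ᵁ U) :
    Fn f U →ₐ[k] Fn h V :=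
  { (a.appLE U V hV).hom with
    commutes' := fun c ↦ by
      subst ha
      have := congr((Scheme.ΓSpecIso (CommRingCat.of k)).inv ≫
        $(Scheme.Hom.appLE_comp_appLE a f ⊤ U V le_top hV))
      rw [← Category.assoc] at this
      exact congr($this c) }

theorem pb_apply (a : P ⟶ X) (ha : a ≫ f = h) {U : X.Opens} {V : P.Opens} (hV : V ≤ a ⁻¹ᵁ U)
    (r : Fn f U) : pb a ha hV r = a.appLE U V hV r := rfl

theorem pb_pb {a : P ⟶ X} (ha : a ≫ f = h) {U : X.Opens} {V : P.Opens} (hV : V ≤ a ⁻¹ᵁ U)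
    {b : Y ⟶ P} (hb : b ≫ h = g) {W : Y.Opens} (hW : W ≤ b ⁻¹ᵁ V) (r : Fn f U) :
    pb b hb hW (pb a ha hV r) = pb (b ≫ a) (by rw [Category.assoc, ha, hb])
      (hW.trans (b.preimage_mono hV)) r :=
  congr($(Scheme.Hom.appLE_comp_appLE b a U V W hV hW) r)

theorem pb_congr {a b : P ⟶ X} (e : a = b) {ha : a ≫ f = h} {hb : b ≫ f = h} {U : X.Opens}
    {V : P.Opens} {hV : V ≤ a ⁻¹ᵁ U} {hV' : V ≤ b ⁻¹ᵁ U} (r : Fn f U) :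
    pb a ha hV r = pb b hb hV' r := by
  subst e; rfl

/-- Restriction of functions. -/
abbrev fres {V U : X.Opens} (hV : V ≤ U) : Fn f U →ₐ[k] Fn f V :=
  pb (𝟙 X) (Category.id_comp f) hV

theorem fres_apply {V U : X.Opens} (hV : V ≤ U) (r : Fn f U) : fres hV r = ores X hV r := by
  have : (𝟙 X : X ⟶ X).appLE U V hV = X.presheaf.map (homOfLE hV).op := by
    simp only [Scheme.Hom.appLE, Scheme.Hom.id_app]
    exact Category.id_comp _
  exact congr($this r)

theorem fres_self {U : X.Opens} (r : Fn f U) : fres le_rfl r = r :=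
  (fres_apply le_rfl r).trans (ores_self (X := X) le_rfl r)

theorem fres_pb (a : P ⟶ X) (ha : a ≫ f = h) {U : X.Opens} {V W : P.Opens} (hV : V ≤ a ⁻¹ᵁ U)
    (hW : W ≤ V) (r : Fn f U) : fres hW (pb a ha hV r) = pb a ha (hW.trans hV) r :=
  (pb_pb ha hV _ hW r).trans (pb_congr (Category.id_comp a) r)

theorem pb_fres (a : P ⟶ X) (ha : a ≫ f = h) {U U' : X.Opens} {V : P.Opens} (hV : V ≤ a ⁻¹ᵁ U)
    (hU : U ≤ U') (r : Fn f U') : pb a ha hV (fres hU r) =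
      pb a ha (hV.trans (a.preimage_mono hU)) r :=
  (pb_pb _ hU ha hV r).trans (pb_congr (Category.comp_id a) r)

/-- The functions on a product of affine open subsets. -/
theorem bijective_productMap_pb {a : P ⟶ X} {b : P ⟶ Y} (H : IsPullback a b f g) (ha : a ≫ f = h)
    (hb : b ≫ g = h) {U : X.Opens} {V : Y.Opens} (hU : IsAffineOpen U) (hV : IsAffineOpen V)
    {W : P.Opens} (hW : W = a ⁻¹ᵁ U ⊓ b ⁻¹ᵁ V) :
    Function.Bijective (Algebra.TensorProduct.productMap
      (pb a ha (hW.le.trans inf_le_left) : Fn f U →ₐ[k] Fn h W) (pb b hb (hW.le.trans inf_le_right))) := by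
  have H1 := (isIso_pushoutSection_iff H le_top le_top hW).1
    (isIso_pushoutSection_of_isAffineOpen H le_top le_top hW (isAffineOpen_top _) hV hU)
  have _ : IsIso (Scheme.ΓSpecIso (CommRingCat.of k)).hom := inferInstance
  let p := Algebra.TensorProduct.productMap
      (pb a ha (hW.le.trans inf_le_left) : Fn f U →ₐ[k] Fn h W) (pb b hb (hW.le.trans inf_le_right))
  let i₁ : Γ(X, U) ⟶ CommRingCat.of (Fn f U ⊗[k] Fn g V) :=
    CommRingCat.ofHom (Algebra.TensorProduct.includeLeft (R := k) (S := k)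
      (A := Fn f U) (B := Fn g V)).toRingHom
  let i₂ : Γ(Y, V) ⟶ CommRingCat.of (Fn f U ⊗[k] Fn g V) :=
    CommRingCat.ofHom (Algebra.TensorProduct.includeRight (R := k)
      (A := Fn f U) (B := Fn g V)).toRingHom
  have w : f.appLE ⊤ U le_top ≫ i₁ = g.appLE ⊤ V le_top ≫ i₂ := by
    rw [← cancel_epi (Scheme.ΓSpecIso (CommRingCat.of k)).inv]
    ext c
    change i₁ (algebraMap k (Fn f U) c) = i₂ (algebraMap k (Fn g V) c)
    exact ((Algebra.TensorProduct.includeLeft (R := k) (S := k) (A := Fn f U)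
      (B := Fn g V)).commutes c).trans ((Algebra.TensorProduct.includeRight (R := k)
      (A := Fn f U) (B := Fn g V)).commutes c).symm
  let q := H1.desc i₁ i₂ w
  have e₁ (r : Fn f U) : q (pb a ha (hW.le.trans inf_le_left) r) = r ⊗ₜ 1 :=
    congr($(H1.inl_desc i₁ i₂ w) r)
  have e₂ (r : Fn g V) : q (pb b hb (hW.le.trans inf_le_right) r) = 1 ⊗ₜ r :=
    congr($(H1.inr_desc i₁ i₂ w) r)
  have hqp (z) : q (p z) = z := by
    induction z using TensorProduct.induction_on with
    | zero => rw [map_zero]; exact map_zero _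
    | add z w hz hw => rw [map_add]; exact (map_add q.hom _ _).trans (congrArg₂ _ hz hw)
    | tmul r s =>
      rw [Algebra.TensorProduct.productMap_apply_tmul]
      refine (map_mul q.hom _ _).trans ((congrArg₂ _ (e₁ r) (e₂ s)).trans ?_)
      exact (Algebra.TensorProduct.tmul_mul_tmul _ _ _ _).trans (by rw [one_mul, mul_one])
  have hpq : q ≫ CommRingCat.ofHom p.toRingHom = 𝟙 _ := by
    apply H1.hom_ext
    · rw [H1.inl_desc_assoc]
      ext r
      exact (Algebra.TensorProduct.productMap_apply_tmul _ _ _ _).trans (by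
        rw [map_one, mul_one]; rfl)
    · rw [H1.inr_desc_assoc]
      ext r
      exact (Algebra.TensorProduct.productMap_apply_tmul _ _ _ _).trans (by
        rw [map_one, one_mul]; rfl)
  exact ⟨fun z w hzw ↦ by rw [← hqp z, ← hqp w]; exact congrArg q hzw, fun r ↦ ⟨q r, congr($hpq r)⟩⟩

theorem isAffineOpen_of_isPullback {a : P ⟶ X} {b : P ⟶ Y} (H : IsPullback a b f g)
    {U : X.Opens} {V : Y.Opens} (hU : IsAffineOpen U) (hV : IsAffineOpen V)
    {W : P.Opens} (hW : W = a ⁻¹ᵁ U ⊓ b ⁻¹ᵁ V) : IsAffineOpen W := by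
  have _ : IsAffine _ := hU
  have _ : IsAffine _ := hV
  have _ : IsAffine _ := isAffineOpen_top (Spec (CommRingCat.of k))
  exact .of_isIso (Scheme.Hom.isPullback_resLE H
    (show V ≤ g ⁻¹ᵁ (⊤ : (Spec (CommRingCat.of k)).Opens) from le_top)
    (show U ≤ f ⁻¹ᵁ (⊤ : (Spec (CommRingCat.of k)).Opens) from le_top) hW).isoPullback.hom

end FunctionAlgebras

/-! ### Slices of tensors along functionals -/

section Slices

variable {k : Type*} [Field k]

theorem eq_zero_of_lTensor_functional {N C : Type*} [AddCommGroup N] [Module k N] [AddCommGroup C]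
    [Module k C] {x : N ⊗[k] C}
    (hx : ∀ θ : C →ₗ[k] k, TensorProduct.rid k N (LinearMap.lTensor N θ x) = 0) : x = 0 := by
  classical
  let b := Module.Basis.ofVectorSpace k C
  apply (TensorProduct.equivFinsuppOfBasisRight b).injective
  rw [map_zero]
  ext i
  rw [Finsupp.zero_apply, ← hx (b.coord i)]
  clear hx
  induction x using TensorProduct.induction_on with
  | zero => simp
  | add z w hz hw => simp only [map_add, Finsupp.add_apply, hz, hw]
  | tmul n c => simp

/-- A tensor in `N ⊗ C` all of whose slices lie in `S` belongs to `S ⊗ C`. This is phrased as being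
fixed by a projection onto `S`, so that projections in different coordinates can be applied one
after another to the same sum of products. -/
theorem exists_retraction_rTensor {N : Type*} (C : Type*) [AddCommGroup N] [Module k N]
    [AddCommGroup C] [Module k C] (S : Submodule k N) :
    ∃ ρ : N →ₗ[k] N, (∀ n, ρ n ∈ S) ∧ ∀ x : N ⊗[k] C,
      (∀ θ : C →ₗ[k] k, TensorProduct.rid k N (LinearMap.lTensor N θ x) ∈ S) →
        LinearMap.rTensor C ρ x = x := by
  obtain ⟨r, hr⟩ := S.subtype.exists_leftInverse_of_injective S.ker_subtype
  refine ⟨S.subtype ∘ₗ r, fun n ↦ (r n).2, fun x hx ↦ ?_⟩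
  rw [← sub_eq_zero]
  refine eq_zero_of_lTensor_functional fun θ ↦ ?_
  have h : TensorProduct.rid k N (LinearMap.lTensor N θ (LinearMap.rTensor C (S.subtype ∘ₗ r) x)) =
      (S.subtype ∘ₗ r) (TensorProduct.rid k N (LinearMap.lTensor N θ x)) := by
    clear hx
    induction x using TensorProduct.induction_on with
    | zero => simp
    | add z w hz hw => simp only [map_add, hz, hw]
    | tmul n c => simp
  rw [map_sub, map_sub, h, sub_eq_zero]
  exact congr((($hr ⟨_, hx θ⟩ : S) : N))

variable {A C R : Type*} [CommRing A] [Algebra k A] [CommRing C] [Algebra k C] [CommRing R]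
  [Algebra k R] {i : A →ₐ[k] R} {j : C →ₐ[k] R}
  (hp : Function.Bijective (Algebra.TensorProduct.productMap i j))

/-- The equivalence `A ⊗ C ≃ R`. -/
def prodEquiv : A ⊗[k] C ≃ₗ[k] R :=
  .ofBijective (Algebra.TensorProduct.productMap i j).toLinearMap hp

@[simp] theorem prodEquiv_tmul (a : A) (c : C) : prodEquiv hp (a ⊗ₜ c) = i a * j c :=
  Algebra.TensorProduct.productMap_apply_tmul i j a c

@[simp] theorem prodEquiv_symm_mul (a : A) (c : C) : (prodEquiv hp).symm (i a * j c) = a ⊗ₜ c := by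
  rw [← prodEquiv_tmul hp, LinearEquiv.symm_apply_apply]

include hp in
theorem prod_induction {p : R → Prop} (h0 : p 0) (hadd : ∀ x y, p x → p y → p (x + y))
    (hmul : ∀ a c, p (i a * j c)) (x : R) : p x := by
  obtain ⟨z, rfl⟩ := (prodEquiv hp).surjective x
  induction z using TensorProduct.induction_on with
  | zero => rwa [map_zero]
  | add z w hz hw => rw [map_add]; exact hadd _ _ hz hw
  | tmul a c => rw [prodEquiv_tmul]; exact hmul a c

/-- Integration of elements of `R ≃ A ⊗ C` along a functional on `C`. -/
def slice (θ : C →ₗ[k] k) : R →ₗ[k] A :=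
  (TensorProduct.rid k A).toLinearMap ∘ₗ LinearMap.lTensor A θ ∘ₗ (prodEquiv hp).symm.toLinearMap

theorem slice_mul (θ : C →ₗ[k] k) (a : A) (c : C) : slice hp θ (i a * j c) = θ c • a := by
  simp [slice]

theorem slice_left_mul (θ : C →ₗ[k] k) (a : A) (x : R) :
    slice hp θ (i a * x) = a * slice hp θ x := by
  induction x using prod_induction hp with
  | h0 => simp
  | hadd x y hx hy => rw [mul_add, map_add, map_add, hx, hy, mul_add]
  | hmul a' c => rw [← mul_assoc, ← map_mul, slice_mul, slice_mul, mul_smul_comm]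

theorem map_slice {A' R' : Type*} [CommRing A'] [Algebra k A'] [CommRing R']
    [Algebra k R'] {i' : A' →ₐ[k] R'} {j' : C →ₐ[k] R'}
    (hp' : Function.Bijective (Algebra.TensorProduct.productMap i' j')) (α : A →ₐ[k] A')
    (ρ : R →ₐ[k] R') (hi : ∀ a, ρ (i a) = i' (α a)) (hj : ∀ c, ρ (j c) = j' c) (θ : C →ₗ[k] k)
    (x : R) : α (slice hp θ x) = slice hp' θ (ρ x) := by
  induction x using prod_induction hp with
  | h0 => simp
  | hadd x y hx hy => simp only [map_add, hx, hy]
  | hmul a c => rw [map_mul ρ, hi, hj, slice_mul, slice_mul, _root_.map_smul]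

theorem exists_retraction (S : Submodule k A) : ∃ E : R →ₗ[k] R,
    (∀ a, ∃ a' ∈ S, ∀ c, E (i a * j c) = i a' * j c) ∧
      ∀ x, (∀ θ, slice hp θ x ∈ S) → E x = x := by
  obtain ⟨ρ, h1, h2⟩ := exists_retraction_rTensor C S
  refine ⟨(prodEquiv hp).toLinearMap ∘ₗ LinearMap.rTensor C ρ ∘ₗ (prodEquiv hp).symm.toLinearMap,
    fun a ↦ ⟨ρ a, h1 a, fun c ↦ by simp⟩, fun x hx ↦ ?_⟩
  change prodEquiv hp (LinearMap.rTensor C ρ ((prodEquiv hp).symm x)) = x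
  exact (congrArg _ (h2 _ hx)).trans (LinearEquiv.apply_symm_apply _ _)

variable (κ : Type*) [Fintype κ] [DecidableEq κ]

/-- The equivalence `Aᵏ ⊗ C ≃ Rᵏ`. -/
def piProdEquiv : (κ → A) ⊗[k] C ≃ₗ[k] (κ → R) :=
  TensorProduct.comm k (κ → A) C ≪≫ₗ TensorProduct.piRight k k C (fun _ : κ ↦ A) ≪≫ₗ
    LinearEquiv.piCongrRight fun _ ↦ TensorProduct.comm k C A ≪≫ₗ prodEquiv hp

theorem piProdEquiv_tmul (u : κ → A) (c : C) :
    piProdEquiv hp κ (u ⊗ₜ c) = fun a ↦ i (u a) * j c := by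
  ext a
  simp [piProdEquiv]

theorem slice_piProdEquiv (θ : C →ₗ[k] k) (x : (κ → A) ⊗[k] C) :
    (fun a ↦ slice hp θ (piProdEquiv hp κ x a)) =
      TensorProduct.rid k (κ → A) (LinearMap.lTensor (κ → A) θ x) := by
  induction x using TensorProduct.induction_on with
  | zero => ext; simp
  | add z w hz hw => rw [map_add, map_add, map_add, ← hz, ← hw]; ext; simp
  | tmul u c => rw [piProdEquiv_tmul]; ext; simp [slice_mul]

theorem exists_pi_retraction (S : Submodule k (κ → A)) : ∃ E : (κ → R) →ₗ[k] (κ → R),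
    (∀ u : κ → A, ∃ u' ∈ S, ∀ c, E (fun a ↦ i (u a) * j c) = fun a ↦ i (u' a) * j c) ∧
      ∀ x, (∀ θ, (fun a ↦ slice hp θ (x a)) ∈ S) → E x = x := by
  obtain ⟨ρ, h1, h2⟩ := exists_retraction_rTensor C S
  refine ⟨(piProdEquiv hp κ).toLinearMap ∘ₗ LinearMap.rTensor C ρ ∘ₗ
    (piProdEquiv hp κ).symm.toLinearMap,
    fun u ↦ ⟨ρ u, h1 u, fun c ↦ by simp [← piProdEquiv_tmul hp]⟩, fun x hx ↦ ?_⟩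
  obtain ⟨y, rfl⟩ := (piProdEquiv hp κ).surjective x
  simp only [slice_piProdEquiv] at hx
  simp [h2 _ hx]

end Slices

/-! ### From the Koszul complex to contractions of tensors -/

section KoszulTensor

variable {k : Type u} [Field k] {V B B' : Type u} [AddCommGroup V] [Module k V] [AddCommGroup B]
  [Module k B] [AddCommGroup B'] [Module k B']

theorem tensorPower_hom_ext {N : Type*} [AddCommGroup N] [Module k N] {n : ℕ}
    {f g : B ⊗[k] (⨂[k]^n V) →ₗ[k] N}
    (h : ∀ b v, f (b ⊗ₜ PiTensorProduct.tprod k v) = g (b ⊗ₜ PiTensorProduct.tprod k v)) : f = g := by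
  ext b v
  exact h b v

theorem exteriorPower_hom_ext {N : Type*} [AddCommGroup N] [Module k N] {n : ℕ}
    {f g : B ⊗[k] (⋀[k]^n V) →ₗ[k] N}
    (h : ∀ b v, f (b ⊗ₜ exteriorPower.ιMulti k n v) = g (b ⊗ₜ exteriorPower.ιMulti k n v)) :
    f = g := by
  ext b v
  exact h b v

/-- Multiplication of the `j`-th factor of `V ⊗ ⋯ ⊗ V` into `B`. -/
def contr (mul : V →ₗ[k] B →ₗ[k] B') {n : ℕ} (j : Fin (n + 1)) :
    B ⊗[k] (⨂[k]^(n + 1) V) →ₗ[k] B' ⊗[k] (⨂[k]^n V) :=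
  TensorProduct.lift (PiTensorProduct.lift (LinearMap.uncurryMid (M := fun _ ↦ V) j
    { toFun := fun v ↦ ((TensorProduct.mk k B' (⨂[k]^n V)).comp (mul v)).flip.compMultilinearMap
        (PiTensorProduct.tprod k)
      map_add' := fun v w ↦ by ext; simp
      map_smul' := fun c v ↦ by ext; simp [TensorProduct.smul_tmul'] })).flip

theorem contr_tmul (mul : V →ₗ[k] B →ₗ[k] B') {n : ℕ} (j : Fin (n + 1)) (b : B)
    (v : Fin (n + 1) → V) : contr mul j (b ⊗ₜ PiTensorProduct.tprod k v) =
      mul (v j) b ⊗ₜ PiTensorProduct.tprod k (j.removeNth v) := by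
  simp [contr]

/-- The projection from tensors to alternating tensors. -/
def wedge (B V : Type u) [AddCommGroup V] [Module k V] [AddCommGroup B] [Module k B] (n : ℕ) :
    B ⊗[k] (⨂[k]^n V) →ₗ[k] B ⊗[k] (⋀[k]^n V) :=
  LinearMap.lTensor B (PiTensorProduct.lift (exteriorPower.ιMulti k n).toMultilinearMap)

theorem wedge_tmul {n : ℕ} (b : B) (v : Fin n → V) :
    wedge B V n (b ⊗ₜ PiTensorProduct.tprod k v) = b ⊗ₜ exteriorPower.ιMulti k n v := by
  simp [wedge]

/-- Antisymmetrization. -/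
def antisymm (B V : Type u) [AddCommGroup V] [Module k V] [AddCommGroup B] [Module k B] (n : ℕ) :
    B ⊗[k] (⋀[k]^n V) →ₗ[k] B ⊗[k] (⨂[k]^n V) :=
  LinearMap.lTensor B (exteriorPower.toTensorPower k V n)

theorem antisymm_tmul {n : ℕ} (b : B) (v : Fin n → V) :
    antisymm B V n (b ⊗ₜ exteriorPower.ιMulti k n v) =
      ∑ σ : Equiv.Perm (Fin n), Equiv.Perm.sign σ •
        (b ⊗ₜ[k] PiTensorProduct.tprod k fun i ↦ v (σ i)) := by
  simp only [antisymm, LinearMap.lTensor_tmul, exteriorPower.toTensorPower_apply_ιMulti,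
    TensorProduct.tmul_sum, Units.smul_def]
  exact Finset.sum_congr rfl fun σ _ ↦ map_zsmul (TensorProduct.mk k B (⨂[k]^n V) b) _ _

theorem wedge_antisymm {n : ℕ} (z : B ⊗[k] (⋀[k]^n V)) :
    wedge B V n (antisymm B V n z) = (n.factorial : k) • z := by
  refine LinearMap.congr_fun (f := wedge B V n ∘ₗ antisymm B V n)
    (g := (n.factorial : k) • LinearMap.id) (exteriorPower_hom_ext fun b v ↦ ?_) z
  have h (σ : Equiv.Perm (Fin n)) : wedge B V n (Equiv.Perm.sign σ •
      (b ⊗ₜ[k] PiTensorProduct.tprod k fun i ↦ v (σ i))) = b ⊗ₜ exteriorPower.ιMulti k n v := by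
    have h1 := (exteriorPower.ιMulti k n).map_perm v σ
    rw [Units.smul_def, map_zsmul, wedge_tmul]
    change _ • (b ⊗ₜ exteriorPower.ιMulti k n (v ∘ σ)) = _
    rw [h1, Units.smul_def, TensorProduct.tmul_smul, smul_smul, ← Units.val_mul,
      Int.units_mul_self, Units.val_one, one_smul]
  rw [LinearMap.comp_apply, antisymm_tmul, map_sum, Finset.sum_congr rfl fun σ _ ↦ h σ,
    Finset.sum_const, Finset.card_univ, Fintype.card_perm, Fintype.card_fin, ← Nat.cast_smul_eq_nsmul k]
  rfl

theorem koszulDiff_wedge (mul : V →ₗ[k] B →ₗ[k] B') {n : ℕ} (z : B ⊗[k] (⨂[k]^(n + 1) V)) :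
    koszulDiff mul n (wedge B V (n + 1) z) =
      wedge B' V n (∑ j : Fin (n + 1), (-1 : ℤ) ^ (j : ℕ) • contr mul j z) := by
  refine (LinearMap.congr_fun (f := koszulDiff mul n ∘ₗ wedge B V (n + 1))
    (g := wedge B' V n ∘ₗ ∑ j : Fin (n + 1), (-1 : ℤ) ^ (j : ℕ) • contr mul j)
    (tensorPower_hom_ext fun b v ↦ ?_) z).trans (by simp)
  simp [wedge_tmul, koszulDiff_tmul, contr_tmul]

/-- The permutation that sends `j` to `i` and is given by `τ` on the complements. -/
def extendPerm {n : ℕ} (j : Fin (n + 1)) (p : Fin (n + 1) × Equiv.Perm (Fin n)) :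
    Equiv.Perm (Fin (n + 1)) :=
  p.1.cycleRange⁻¹ * Equiv.Perm.decomposeFin.symm (0, p.2) * j.cycleRange

theorem extendPerm_same {n : ℕ} (j : Fin (n + 1)) (p : Fin (n + 1) × Equiv.Perm (Fin n)) :
    extendPerm j p j = p.1 := by
  simp [extendPerm, Equiv.Perm.inv_def]

theorem extendPerm_succAbove {n : ℕ} (j : Fin (n + 1)) (p : Fin (n + 1) × Equiv.Perm (Fin n))
    (x : Fin n) : extendPerm j p (j.succAbove x) = p.1.succAbove (p.2 x) := by
  simp [extendPerm, Equiv.Perm.inv_def]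

theorem sign_extendPerm {n : ℕ} (j : Fin (n + 1)) (p : Fin (n + 1) × Equiv.Perm (Fin n)) :
    Equiv.Perm.sign (extendPerm j p) =
      (-1) ^ (j : ℕ) * ((-1) ^ (p.1 : ℕ) * Equiv.Perm.sign p.2) := by
  simp [extendPerm, Equiv.Perm.decomposeFin.symm_sign, mul_comm]

theorem bijective_extendPerm {n : ℕ} (j : Fin (n + 1)) : Function.Bijective (extendPerm j) := by
  rw [Fintype.bijective_iff_injective_and_card]
  refine ⟨fun p p' h ↦ ?_, by simp [Fintype.card_perm, Nat.factorial_succ]⟩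
  have h1 : p.1 = p'.1 := by rw [← extendPerm_same j p, h, extendPerm_same]
  refine Prod.ext h1 (Equiv.ext fun x ↦ ?_)
  have := extendPerm_succAbove j p x
  rw [h, extendPerm_succAbove, h1] at this
  exact (Fin.succAbove_right_injective this).symm

/-- Permutations of `n + 1` letters are sorted by the image `i` of `j` and the permutation `τ`
induced on the rest; the sum over `τ` is an antisymmetrization and the sum over `i` is the Koszul
differential. Consequently Koszul cycles antisymmetrize to tensors killed by every contraction. -/
theorem contr_antisymm (mul : V →ₗ[k] B →ₗ[k] B') {n : ℕ} (j : Fin (n + 1))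
    (z : B ⊗[k] (⋀[k]^(n + 1) V)) :
    contr mul j (antisymm B V (n + 1) z) =
      (-1 : ℤ) ^ (j : ℕ) • antisymm B' V n (koszulDiff mul n z) := by
  refine (LinearMap.congr_fun (f := contr mul j ∘ₗ antisymm B V (n + 1))
    (g := (-1 : ℤ) ^ (j : ℕ) • (antisymm B' V n ∘ₗ koszulDiff mul n))
    (exteriorPower_hom_ext fun b v ↦ ?_) z).trans (by simp)
  rw [LinearMap.comp_apply, antisymm_tmul, map_sum, ← (bijective_extendPerm j).sum_comp,
    Fintype.sum_prod_type, LinearMap.smul_apply, LinearMap.comp_apply, koszulDiff_tmul, map_sum,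
    Finset.smul_sum]
  refine Finset.sum_congr rfl fun i _ ↦ ?_
  rw [map_zsmul, antisymm_tmul, Finset.smul_sum, Finset.smul_sum]
  refine Finset.sum_congr rfl fun τ _ ↦ ?_
  have h : j.removeNth (fun x ↦ v (extendPerm j (i, τ) x)) = fun x ↦ i.removeNth v (τ x) := by
    ext x
    exact congrArg v (extendPerm_succAbove j (i, τ) x)
  rw [Units.smul_def, map_zsmul, contr_tmul, extendPerm_same, sign_extendPerm, h, Units.smul_def,
    smul_smul, smul_smul]
  simp [mul_assoc]

/-- Tensors killed by all multiplications of a factor of `V ⊗ ⋯ ⊗ V` into `B`. -/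
def IsContrClosed (mul : V →ₗ[k] B →ₗ[k] B') : ∀ {n : ℕ}, B ⊗[k] (⨂[k]^n V) → Prop
  | 0, _ => True
  | _ + 1, z => ∀ j, contr mul j z = 0

/-- The differential of the wedge of `y` is the alternating sum of the wedges of its contractions.
Only the last survives, with sign `(-1)^p`, and the wedge of an antisymmetrized element is `p!`
times that element. -/
theorem subsingleton_koszulCohomology [CharZero k] {B : ℕ → Type u} [∀ n, AddCommGroup (B n)]
    [∀ n, Module k (B n)] (mul : ∀ n, V →ₗ[k] B n →ₗ[k] B (n + 1)) (p q : ℕ)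
    (h : ∀ z : B (q + 1) ⊗[k] (⨂[k]^p V), IsContrClosed (mul (q + 1)) z →
      ∃ y : B q ⊗[k] (⨂[k]^(p + 1) V), (∀ j : Fin p, contr (mul q) j.castSucc y = 0) ∧
        contr (mul q) (Fin.last p) y = z) :
    Subsingleton (KoszulCohomology mul p (q + 1)) := by
  refine Submodule.Quotient.subsingleton_iff.2 (Submodule.submoduleOf_eq_top.2 fun z hz ↦ ?_)
  obtain ⟨y, hy, hy'⟩ := h (antisymm _ V p z) (by
    cases p with
    | zero => trivial
    | succ p =>
      intro j
      have hz' : koszulDiff (mul (q + 1)) p z = 0 := hz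
      rw [contr_antisymm, hz', map_zero, smul_zero])
  have h1 := koszulDiff_wedge (mul q) y
  rw [Fin.sum_univ_castSucc, Finset.sum_eq_zero fun j _ ↦ by rw [hy, smul_zero], zero_add, hy',
    map_zsmul, wedge_antisymm, Fin.val_last] at h1
  have hp : (p.factorial : k) ≠ 0 := Nat.cast_ne_zero.2 p.factorial_ne_zero
  -- The scalar undoes both the factor `p!` and the sign of the last contraction.
  refine ⟨(p.factorial : k)⁻¹ • (-1 : ℤ) ^ p • wedge _ V (p + 1) y, ?_⟩
  rw [_root_.map_smul, map_zsmul, h1, smul_smul, ← mul_pow]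
  simp [hp]

end KoszulTensor

/-! ### Evaluating tensors as products of functions -/

section Evaluation

variable {k : Type u} [Field k] {V B B' : Type u} [AddCommGroup V] [Module k V] [AddCommGroup B]
  [Module k B] [AddCommGroup B'] [Module k B'] {R : Type*} [CommRing R] [Algebra k R]

/-- The map `b ⊗ v₁ ⊗ ⋯ ⊗ vₙ ↦ β b * φ₁ v₁ * ⋯ * φₙ vₙ`. -/
def evalTensor {n : ℕ} (β : B →ₗ[k] R) (φ : Fin n → V →ₗ[k] R) : B ⊗[k] (⨂[k]^n V) →ₗ[k] R :=
  TensorProduct.lift ((LinearMap.mul k R).compl₁₂ β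
    (PiTensorProduct.lift ((MultilinearMap.mkPiAlgebra k (Fin n) R).compLinearMap φ)))

@[simp] theorem evalTensor_tmul {n : ℕ} (β : B →ₗ[k] R) (φ : Fin n → V →ₗ[k] R) (b : B)
    (v : Fin n → V) : evalTensor β φ (b ⊗ₜ PiTensorProduct.tprod k v) = β b * ∏ i, φ i (v i) := by
  simp [evalTensor]

/-- The algebra behind "contraction is restriction to a diagonal": once the `j`-th vector and `b`
are evaluated compatibly with the multiplication, nothing is lost by multiplying them first. -/
theorem evalTensor_contr {mul : V →ₗ[k] B →ₗ[k] B'} {n : ℕ} (j : Fin (n + 1)) {β : B →ₗ[k] R}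
    {β' : B' →ₗ[k] R} {φ : Fin (n + 1) → V →ₗ[k] R} (h : ∀ v b, β' (mul v b) = φ j v * β b)
    (z : B ⊗[k] (⨂[k]^(n + 1) V)) :
    evalTensor β' (fun i ↦ φ (j.succAbove i)) (contr mul j z) = evalTensor β φ z := by
  refine LinearMap.congr_fun (f := evalTensor β' (fun i ↦ φ (j.succAbove i)) ∘ₗ contr mul j)
    (tensorPower_hom_ext fun b v ↦ ?_) z
  rw [LinearMap.comp_apply, contr_tmul, evalTensor_tmul, evalTensor_tmul, h,
    Fin.prod_univ_succAbove _ j]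
  simp only [Fin.removeNth]
  ring

end Evaluation

/-! ### Products of affine open subsets and their functions -/

section Boxes

variable {k : Type u} [Field k] {X : Scheme.{u}} (f : X ⟶ Spec (CommRingCat.of k))

/-- The structure morphism of `X(n + 1)`. -/
def str (n : ℕ) : power f (n + 1) ⟶ Spec (CommRingCat.of k) := proj f (n + 1) 0 ≫ f

theorem proj_str (n : ℕ) (i : Fin (n + 1)) : proj f (n + 1) i ≫ f = str f n := proj_comp f _ _ _

theorem drop_str {n : ℕ} (j : Fin (n + 2)) : drop f j ≫ str f n = str f (n + 1) := by
  rw [str, ← Category.assoc, drop_proj, proj_str]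

theorem diag_str {n : ℕ} (j : Fin (n + 1)) : diag f j ≫ str f (n + 1) = str f n := by
  rw [str, ← Category.assoc, diag_proj_zero, str]

variable {f}

variable (f) in
/-- The isomorphism `X ⟶ X(1)`. -/
def toPowerOne : X ⟶ power f 1 := liftPower f f (fun _ : Fin 1 ↦ 𝟙 X) (fun _ ↦ Category.id_comp f)

variable (f) in
theorem toPowerOne_proj : toPowerOne f ≫ proj f 1 0 = 𝟙 X := liftPower_proj ..

variable (f) in
theorem proj_toPowerOne : proj f 1 0 ≫ toPowerOne f = 𝟙 (power f 1) :=
  power_hom_ext fun (i : Fin 1) ↦ by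
    rw [Subsingleton.elim i 0, Category.assoc, toPowerOne_proj, Category.comp_id, Category.id_comp]

/-- The product of open subsets. -/
def box {n : ℕ} (W : Fin (n + 1) → X.Opens) : (power f (n + 1)).Opens :=
  ⨅ i, proj f (n + 1) i ⁻¹ᵁ W i

theorem mem_box {n : ℕ} {W : Fin (n + 1) → X.Opens} {x : power f (n + 1)} :
    x ∈ box W ↔ ∀ i, proj f (n + 1) i x ∈ W i := by
  rw [← SetLike.mem_coe, box, Opens.coe_iInf, Set.mem_iInter]
  rfl

theorem box_le {n : ℕ} (W : Fin (n + 1) → X.Opens) (i : Fin (n + 1)) :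
    box W ≤ proj f (n + 1) i ⁻¹ᵁ W i :=
  iInf_le _ i

theorem proj_drop {n : ℕ} (j : Fin (n + 2)) (i : Fin (n + 1)) (x : power f (n + 2)) :
    proj f (n + 1) i (drop f j x) = proj f (n + 2) (j.succAbove i) x :=
  congr($(drop_proj f j i) x)

theorem proj_diag_same {n : ℕ} (j : Fin (n + 1)) (x : power f (n + 1)) :
    proj f (n + 2) j.succ (diag f j x) = proj f (n + 1) 0 x :=
  congr($(diag_proj_same f j) x)

theorem proj_diag_succAbove {n : ℕ} (j i : Fin (n + 1)) (x : power f (n + 1)) :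
    proj f (n + 2) (j.succ.succAbove i) (diag f j x) = proj f (n + 1) i x :=
  congr($(diag_proj_succAbove f j i) x)

theorem box_eq {n : ℕ} (W : Fin (n + 2) → X.Opens) (j : Fin (n + 2)) :
    box (f := f) W = proj f (n + 2) j ⁻¹ᵁ W j ⊓ drop f j ⁻¹ᵁ box fun i ↦ W (j.succAbove i) := by
  ext x
  change x ∈ box W ↔ proj f (n + 2) j x ∈ W j ∧ drop f j x ∈ box fun i ↦ W (j.succAbove i)
  simp only [mem_box, proj_drop]
  exact Fin.forall_iff_succAbove j

theorem isAffineOpen_box {n : ℕ} {W : Fin (n + 1) → X.Opens} (hW : ∀ i, IsAffineOpen (W i)) :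
    IsAffineOpen (box (f := f) W) := by
  induction n with
  | zero =>
    have _ : IsIso (proj f 1 0) := ⟨_, proj_toPowerOne f, toPowerOne_proj f⟩
    have h' : box (f := f) W = proj f 1 0 ⁻¹ᵁ W 0 := by
      ext x
      exact mem_box.trans Fin.forall_fin_one
    rw [h']
    exact (hW 0).preimage _
  | succ n ih =>
    exact isAffineOpen_of_isPullback (isPullback_drop f 0).flip (hW 0) (ih fun i ↦ hW _) (box_eq W 0)

theorem bijective_box {n : ℕ} {W : Fin (n + 2) → X.Opens} (hW : ∀ i, IsAffineOpen (W i))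
    (j : Fin (n + 2)) : Function.Bijective (Algebra.TensorProduct.productMap
      (pb (proj f (n + 2) j) (proj_str f _ j) (box_le W j))
      (pb (h := str f (n + 1)) (drop f j) (drop_str f j) ((box_eq W j).le.trans inf_le_right))) :=
  bijective_productMap_pb (isPullback_drop f j).flip _ _ (hW j) (isAffineOpen_box fun _ ↦ hW _)
    (box_eq W j)

theorem bijective_box' {n : ℕ} {W : Fin (n + 2) → X.Opens} (hW : ∀ i, IsAffineOpen (W i))
    (j : Fin (n + 2)) : Function.Bijective (Algebra.TensorProduct.productMap
      (pb (h := str f (n + 1)) (drop f j) (drop_str f j) ((box_eq W j).le.trans inf_le_right))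
      (pb (proj f (n + 2) j) (proj_str f _ j) (box_le W j))) :=
  bijective_productMap_pb (isPullback_drop f j) _ _ (isAffineOpen_box fun _ ↦ hW _) (hW j)
    ((box_eq W j).trans (inf_comm _ _))

end Boxes

section BoxFunctions

variable {k : Type u} [Field k] {X : Scheme.{u}} {f : X ⟶ Spec (CommRingCat.of k)}
  {W : X.Opens} {κ : Type}

/-- The pullback of functions along a projection. -/
abbrev pbProj {n : ℕ} (i : Fin (n + 1)) :
    Fn f W →ₐ[k] Fn (str f n) (box fun _ ↦ W) :=
  pb (proj f (n + 1) i) (proj_str f _ i) (box_le _ i)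

/-- The pullback of functions along the map that forgets a coordinate. -/
abbrev pbDrop {n : ℕ} (j : Fin (n + 2)) :
    Fn (str f n) (box fun _ ↦ W) →ₐ[k] Fn (str f (n + 1)) (box fun _ ↦ W) :=
  pb (drop f j) (drop_str f j) ((box_eq _ j).le.trans inf_le_right)

theorem pbDrop_pbProj {n : ℕ} (j : Fin (n + 2)) (i : Fin (n + 1)) (r : Fn f W) :
    pbDrop j (pbProj i r) = pbProj (j.succAbove i) r :=
  (pb_pb _ _ _ _ r).trans (pb_congr (drop_proj f j i) r)

theorem bijective_pbProj_pbDrop (hW : IsAffineOpen W) {n : ℕ} (j : Fin (n + 2)) :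
    Function.Bijective (Algebra.TensorProduct.productMap
      (pbProj (f := f) (W := W) j) (pbDrop j)) :=
  bijective_box (fun _ ↦ hW) j

theorem toPowerOne_str (f : X ⟶ Spec (CommRingCat.of k)) : toPowerOne f ≫ str f 0 = f := by
  rw [str, ← Category.assoc, toPowerOne_proj, Category.id_comp]

theorem le_toPowerOne_preimage (W : X.Opens) : W ≤ toPowerOne f ⁻¹ᵁ (box fun _ ↦ W) :=
  fun x hx ↦ mem_box.2 fun (i : Fin 1) ↦ by
    have : proj f 1 0 (toPowerOne f x) = x := congr($(toPowerOne_proj f) x)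
    rwa [Subsingleton.elim i 0, this]

theorem toPowerOne_left_inv (x : Fn (str f 0) (box fun _ ↦ W)) :
    pbProj 0 (pb (toPowerOne f) (toPowerOne_str f) (le_toPowerOne_preimage W) x) = x :=
  (pb_pb _ _ _ _ x).trans ((pb_congr (proj_toPowerOne f) x).trans (fres_self x))

theorem toPowerOne_right_inv (x : Fn f W) :
    pb (toPowerOne f) (toPowerOne_str f) (le_toPowerOne_preimage W) (pbProj 0 x) = x :=
  (pb_pb _ _ _ _ x).trans ((pb_congr (toPowerOne_proj f) x).trans (fres_self x))

/-- The vector of functions `u ⊠ c₁ ⊠ ⋯ ⊠ cₙ` on a product of copies of `W`. -/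
def gen {n : ℕ} (u : κ → Fn f W) (c : Fin n → Fn f W) : κ → Fn (str f n) (box fun _ ↦ W) :=
  fun a ↦ pbProj 0 (u a) * ∏ i : Fin n, pbProj i.succ (c i)

theorem box_induction (hW : IsAffineOpen W) {n : ℕ}
    {p : Fn (str f n) (box fun _ ↦ W) → Prop} (h0 : p 0)
    (hadd : ∀ x y, p x → p y → p (x + y)) (hp : ∀ c : Fin (n + 1) → Fn f W, p (∏ i, pbProj i (c i)))
    (x : Fn (str f n) (box fun _ ↦ W)) : p x := by
  induction n with
  | zero =>
    rw [← toPowerOne_left_inv x]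
    simpa using hp fun _ ↦ pb (toPowerOne f) (toPowerOne_str f) (le_toPowerOne_preimage W) x
  | succ n ih =>
    refine prod_induction (bijective_pbProj_pbDrop hW 0) h0 hadd (fun a c ↦ ?_) x
    refine ih (p := fun c ↦ p (pbProj 0 a * pbDrop 0 c)) (by simpa) (fun x y hx hy ↦ ?_)
      (fun c ↦ ?_) c
    · rw [map_add, mul_add]; exact hadd _ _ hx hy
    · convert hp (Fin.cons a c)
      rw [Fin.prod_univ_succ (n := n + 1), map_prod]
      simp only [pbDrop_pbProj, Fin.cons_zero, Fin.cons_succ, Fin.succAbove_zero]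

theorem mem_span_gen [Finite κ] (hW : IsAffineOpen W) {n : ℕ}
    (x : κ → Fn (str f n) (box fun _ ↦ W)) :
    x ∈ Submodule.span k {y | ∃ (u : κ → Fn f W) (c : Fin n → Fn f W), y = gen u c} := by
  classical
  have := Fintype.ofFinite κ
  rw [← Finset.univ_sum_single x]
  refine sum_mem fun a _ ↦ ?_
  refine box_induction hW (p := fun r ↦ (Pi.single a r : κ → _) ∈ Submodule.span k
    {y | ∃ (u : κ → Fn f W) (c : Fin n → Fn f W), y = gen u c})
    (by rw [Pi.single_zero]; exact zero_mem _) (fun r s hr hs ↦ ?_)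
    (fun c ↦ Submodule.subset_span ⟨Pi.single a (c 0), fun i ↦ c i.succ, ?_⟩) (x a)
  · rw [Pi.single_add]; exact add_mem hr hs
  · ext b
    rw [Fin.prod_univ_succ]
    by_cases h : b = a
    · subst h; simp [gen]
    · simp [gen, h]

theorem gen_eq {n : ℕ} (u : κ → Fn f W) (c : Fin (n + 1) → Fn f W) (l : Fin (n + 1)) (a : κ) :
    gen u c a = pbProj l.succ (c l) * pbDrop l.succ (gen u (fun i ↦ c (l.succAbove i)) a) := by
  rw [gen, gen, Fin.prod_univ_succAbove _ l, map_mul, map_prod]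
  simp only [pbDrop_pbProj, Fin.succ_succAbove_zero, Fin.succ_succAbove_succ]
  ring

theorem gen_eq_zero {n : ℕ} (u : κ → Fn f W) (c : Fin (n + 1) → Fn f W) (a : κ) :
    gen u c a = pbProj 0 (u a) * pbDrop 0 (∏ i, pbProj i (c i)) := by
  rw [gen, map_prod]
  simp only [pbDrop_pbProj, Fin.succAbove_zero]

/-- Any expression of `x` as a sum of products is improved one coordinate at a time. The projection
attached to a coordinate fixes `x`, moves that factor of every product into `T` (or `S` in position
`0`), and leaves the other factors alone. -/
theorem mem_span_gen_of_slice [Finite κ] (hW : IsAffineOpen W) {n : ℕ}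
    (x : κ → Fn (str f (n + 1)) (box fun _ ↦ W)) (S : Submodule k (κ → Fn f W))
    (T : Submodule k (Fn f W))
    (hS : ∀ θ, (fun a ↦ slice (bijective_pbProj_pbDrop hW 0) θ (x a)) ∈ S)
    (hT : ∀ (l : Fin (n + 1)) θ a, slice (bijective_pbProj_pbDrop hW l.succ) θ (x a) ∈ T) :
    x ∈ Submodule.span k {y | ∃ (u : κ → Fn f W) (c : Fin (n + 1) → Fn f W),
      u ∈ S ∧ (∀ i, c i ∈ T) ∧ y = gen u c} := by
  classical
  have := Fintype.ofFinite κ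
  -- `t` is the set of coordinates already moved into `T`; position `0` is treated at the end.
  have h1 (t : Finset (Fin (n + 1))) : x ∈ Submodule.span k
      {y | ∃ (u : κ → Fn f W) (c : Fin (n + 1) → Fn f W), (∀ i ∈ t, c i ∈ T) ∧ y = gen u c} := by
    induction t using Finset.induction_on with
    | empty => simpa using mem_span_gen hW x
    | insert l t hl ih =>
      obtain ⟨E, hE, hE'⟩ := exists_retraction (bijective_pbProj_pbDrop hW l.succ) T
      have hx : E.compLeft κ x = x := funext fun a ↦ hE' _ fun θ ↦ hT l θ a
      rw [← hx]
      refine (Submodule.map_span_le _ _ _).2 ?_ (Submodule.mem_map_of_mem ih)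
      rintro _ ⟨u, c, hc, rfl⟩
      obtain ⟨c', hc', h⟩ := hE (c l)
      refine Submodule.subset_span ⟨u, Function.update c l c', fun i hi ↦ ?_, funext fun a ↦ ?_⟩
      · by_cases hil : i = l
        · subst hil; simpa
        · rw [Function.update_of_ne hil]
          exact hc i (Finset.mem_of_mem_insert_of_ne hi hil)
      · change E (gen u c a) = _
        rw [gen_eq u c l, h, gen_eq _ _ l]
        simp
  obtain ⟨E, hE, hE'⟩ := exists_pi_retraction (bijective_pbProj_pbDrop hW 0) κ S
  rw [← hE' x hS]
  refine (Submodule.map_span_le _ _ _).2 ?_ (Submodule.mem_map_of_mem (h1 Finset.univ))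
  rintro _ ⟨u, c, hc, rfl⟩
  obtain ⟨u', hu', h⟩ := hE u
  refine Submodule.subset_span ⟨u', c, hu', fun i ↦ hc i (Finset.mem_univ i), ?_⟩
  rw [funext (gen_eq_zero u c), h, funext (gen_eq_zero u' c)]

end BoxFunctions

theorem exists_snocEquiv (k : Type u) [Field k] (B V : Type u) [AddCommGroup V] [Module k V]
    [AddCommGroup B] [Module k B] (n : ℕ) :
    ∃ ε : (B ⊗[k] (⨂[k]^n V)) ⊗[k] V ≃ₗ[k] B ⊗[k] (⨂[k]^(n + 1) V), ∀ (b : B) (v : Fin n → V) (x : V),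
      ε ((b ⊗ₜ PiTensorProduct.tprod k v) ⊗ₜ x) =
        b ⊗ₜ PiTensorProduct.tprod k (Fin.snoc v x : Fin (n + 1) → V) := by
  let e : (⨂[k]^n V) ⊗[k] V ≃ₗ[k] (⨂[k]^n V) ⊗[k] (⨂[k]^1 V) :=
    LinearEquiv.lTensor (⨂[k]^n V)
      (PiTensorProduct.subsingletonEquiv (R := k) (s := fun _ : Fin 1 ↦ V) 0).symm
  let e' : (⨂[k]^n V) ⊗[k] (⨂[k]^1 V) ≃ₗ[k] (⨂[k]^(n + 1) V) := TensorPower.mulEquiv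
  refine ⟨TensorProduct.assoc k B (⨂[k]^n V) V ≪≫ₗ LinearEquiv.lTensor B (e ≪≫ₗ e'),
    fun b v x ↦ ?_⟩
  have h1 : e (PiTensorProduct.tprod k v ⊗ₜ x) =
      PiTensorProduct.tprod k v ⊗ₜ PiTensorProduct.tprod k fun _ : Fin 1 ↦ x := by
    simp [e]
  have h2 : e' (PiTensorProduct.tprod k v ⊗ₜ PiTensorProduct.tprod k fun _ : Fin 1 ↦ x) =
      PiTensorProduct.tprod k (Fin.append v fun _ : Fin 1 ↦ x) :=
    TensorPower.tprod_mul_tprod k v fun _ : Fin 1 ↦ x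
  rw [Fin.append_right_eq_snoc] at h2
  exact congrArg (b ⊗ₜ[k] ·) ((congrArg e' h1).trans h2)

/-! ### Tensors as functions on boxes -/

section BoxEvaluation

variable {k : Type u} [Field k] {X : Scheme.{u}} {f : X ⟶ Spec (CommRingCat.of k)}
  {W : X.Opens} {κ : Type} {V B : Type u} [AddCommGroup V] [Module k V] [AddCommGroup B] [Module k B]
  (β : B →ₗ[k] (κ → Fn f W)) (φ : V →ₗ[k] Fn f W)

/-- The functions `β b ⊠ φ v₁ ⊠ ⋯ ⊠ φ vₙ`. -/
def evalBox (n : ℕ) : B ⊗[k] (⨂[k]^n V) →ₗ[k] (κ → Fn (str f n) (box fun _ ↦ W)) :=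
  LinearMap.pi fun a ↦ evalTensor ((pbProj 0).toLinearMap ∘ₗ LinearMap.proj a ∘ₗ β)
    fun i ↦ (pbProj i.succ).toLinearMap ∘ₗ φ

theorem evalBox_tmul {n : ℕ} (b : B) (v : Fin n → V) :
    evalBox β φ n (b ⊗ₜ PiTensorProduct.tprod k v) = gen (β b) fun i ↦ φ (v i) := by
  ext a
  simp [evalBox, gen]

theorem exists_evalBox_eq [Finite κ] (hW : IsAffineOpen W) {n : ℕ}
    (x : κ → Fn (str f (n + 1)) (box fun _ ↦ W))
    (hS : ∀ θ, ∃ b, (fun a ↦ slice (bijective_pbProj_pbDrop hW 0) θ (x a)) = β b)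
    (hT : ∀ (l : Fin (n + 1)) θ a,
      ∃ v, slice (bijective_pbProj_pbDrop hW l.succ) θ (x a) = φ v) :
    ∃ y, evalBox β φ (n + 1) y = x := by
  have h := mem_span_gen_of_slice hW x (LinearMap.range β) (LinearMap.range φ)
    (fun θ ↦ (hS θ).imp fun _ ↦ Eq.symm) fun l θ a ↦ (hT l θ a).imp fun _ ↦ Eq.symm
  suffices h' : _ ≤ LinearMap.range (evalBox β φ (n + 1)) from h' h
  refine Submodule.span_le.2 ?_
  rintro _ ⟨_, c, ⟨b, rfl⟩, hc, rfl⟩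
  choose v hv using hc
  exact ⟨b ⊗ₜ PiTensorProduct.tprod k v, by rw [evalBox_tmul, funext hv]⟩

/-- Splitting off the last factor turns the evaluation into the tensor product of the previous one
with `φ`, and tensor products of injective maps over a field are injective. The induction starts
from `X(1) ≅ X`. -/
theorem evalBox_injective [Finite κ] (hW : IsAffineOpen W) (hβ : Function.Injective β)
    (hφ : Function.Injective φ) (n : ℕ) : Function.Injective (evalBox β φ n) := by
  classical
  have := Fintype.ofFinite κ
  induction n with
  | zero =>
    let ε : B ⊗[k] (⨂[k]^0 V) ≃ₗ[k] B :=
      LinearEquiv.lTensor B (PiTensorProduct.isEmptyEquiv (Fin 0)) ≪≫ₗ TensorProduct.rid k B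
    have hε (b : B) : ε.symm b = b ⊗ₜ PiTensorProduct.tprod k isEmptyElim := by
      rw [LinearEquiv.symm_apply_eq]
      simp [ε]
    refine Function.Injective.of_comp_right (g := ε.symm) (fun b b' h ↦ hβ (funext fun a ↦ ?_))
      ε.symm.surjective
    simp only [Function.comp, hε, evalBox_tmul] at h
    have := congr_fun h a
    simp only [gen, Finset.univ_eq_empty, Finset.prod_empty, mul_one] at this
    rw [← toPowerOne_right_inv (β b a), this, toPowerOne_right_inv]
  | succ n ih =>
    have hp : Function.Bijective (Algebra.TensorProduct.productMap (pbDrop (f := f) (W := W)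
      (Fin.last (n + 1))) (pbProj (Fin.last (n + 1)))) := bijective_box' (fun _ ↦ hW) _
    obtain ⟨ε, hε⟩ := exists_snocEquiv k B V n
    have key : evalBox β φ (n + 1) ∘ₗ ε.toLinearMap =
        (piProdEquiv hp κ).toLinearMap ∘ₗ TensorProduct.map (evalBox β φ n) φ := by
      refine TensorProduct.ext' fun z x ↦ LinearMap.congr_fun
        (f := (evalBox β φ (n + 1) ∘ₗ ε.toLinearMap) ∘ₗ (TensorProduct.mk k _ V).flip x)
        (g := ((piProdEquiv hp κ).toLinearMap ∘ₗ TensorProduct.map (evalBox β φ n) φ) ∘ₗ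
          (TensorProduct.mk k _ V).flip x) (tensorPower_hom_ext fun b v ↦ ?_) z
      change evalBox β φ (n + 1) (ε ((b ⊗ₜ PiTensorProduct.tprod k v) ⊗ₜ x)) =
        piProdEquiv hp κ (evalBox β φ n (b ⊗ₜ PiTensorProduct.tprod k v) ⊗ₜ φ x)
      rw [hε, evalBox_tmul, evalBox_tmul, piProdEquiv_tmul]
      ext a
      rw [gen, gen, Fin.prod_univ_castSucc, map_mul, map_prod, mul_assoc]
      simp [pbDrop_pbProj]
    refine Function.Injective.of_comp_right (g := ε) ?_ ε.surjective
    have h := (piProdEquiv hp κ).injective.comp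
      (TensorProduct.map_injective_of_flat_flat _ _ ih hφ)
    exact (congrArg (fun g : _ →ₗ[k] _ ↦ Function.Injective g) key).mpr h

end BoxEvaluation

/-! ### Products of sections in external tensor products -/

section ProdList

variable {X : Scheme.{u}} {ι : Type} {N : ι → X.Modules} {U : X.Opens}

theorem prodList_cons (s : ∀ i, Γ(N i, U)) (i : ι) (l : List ι) :
    prodList s (i :: l) = tmul (N := tensorList (l.map N)) (s i) (prodList s l) := rfl

theorem prodList_congr {s s' : ∀ i, Γ(N i, U)} {l : List ι} (h : ∀ i ∈ l, s i = s' i) :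
    prodList s l = prodList s' l := by
  induction l with
  | nil => rfl
  | cons i l ih =>
    rw [prodList_cons, prodList_cons, h i (by simp), ih fun j hj ↦ h j (by simp [hj])]

theorem prodList_update_of_notMem [DecidableEq ι] (s : ∀ i, Γ(N i, U)) {i : ι} (x : Γ(N i, U))
    {l : List ι} (hi : i ∉ l) : prodList (Function.update s i x) l = prodList s l :=
  prodList_congr fun j hj ↦ Function.update_of_ne (fun h : j = i ↦ hi (h ▸ hj)) _ _

theorem prodList_update_add [DecidableEq ι] (s : ∀ i, Γ(N i, U)) {i : ι} (x y : Γ(N i, U))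
    {l : List ι} (hl : l.Nodup) (hi : i ∈ l) :
    prodList (Function.update s i (x + y)) l =
      prodList (Function.update s i x) l + prodList (Function.update s i y) l := by
  induction l with
  | nil => simp at hi
  | cons j l ih =>
    obtain ⟨hj, hl⟩ := List.nodup_cons.1 hl
    by_cases h : i = j
    · subst h
      simp only [prodList_cons, Function.update_self, prodList_update_of_notMem s _ hj, add_tmul]
      rfl
    · simp only [prodList_cons, Function.update_of_ne (Ne.symm h)]
      rw [ih hl ((List.mem_cons.1 hi).resolve_left h), tmul_add]
      rfl

theorem prodList_update_smul [DecidableEq ι] (s : ∀ i, Γ(N i, U)) {i : ι} (c : Γ(X, U))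
    (x : Γ(N i, U)) {l : List ι} (hl : l.Nodup) (hi : i ∈ l) :
    prodList (Function.update s i (c • x)) l = c • prodList (Function.update s i x) l := by
  induction l with
  | nil => simp at hi
  | cons j l ih =>
    obtain ⟨hj, hl⟩ := List.nodup_cons.1 hl
    by_cases h : i = j
    · subst h
      simp only [prodList_cons, Function.update_self, prodList_update_of_notMem s _ hj, smul_tmul]
      rfl
    · simp only [prodList_cons, Function.update_of_ne (Ne.symm h)]
      rw [ih hl ((List.mem_cons.1 hi).resolve_left h), tmul_smul]
      rfl

theorem isBasis_prodList_cons {κ : Type} [Fintype κ] (s : κ → ∀ i, Γ(N i, U)) (t : ∀ i, Γ(N i, U))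
    (i : ι) (l : List ι) (hi : IsBasis (N i) fun a ↦ s a i) (hl : ∀ j ∈ l, ∀ a, s a j = t j)
    (ht : ∀ j ∈ l, IsBasis (N j) fun _ : Unit ↦ t j) :
    IsBasis (tensorList ((i :: l).map N)) fun a ↦ prodList (s a) (i :: l) := by
  have h := IsBasis.tmul (N := tensorList (l.map N)) hi (isBasis_prodList t l ht)
  have e (a : κ) : prodList (s a) (i :: l) =
      tmul (N := tensorList (l.map N)) (s a i) (prodList t l) := by
    rw [prodList_cons, prodList_congr fun j hj ↦ hl j hj a]
  exact (congrArg (IsBasis (tensor (N i) (tensorList (l.map N)))) (funext e)).mpr h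

end ProdList

section BoxSections

variable {k : Type u} [Field k] {X : Scheme.{u}} {f : X ⟶ Spec (CommRingCat.of k)} {n : ℕ}
  {F : Fin (n + 1) → X.Modules} {U : (power f (n + 1)).Opens}

/-- The product of sections of the pullbacks along the projections. -/
def boxProd (s : ∀ i, Γ((Scheme.Modules.pullback (proj f (n + 1) i)).obj (F i), U)) :
    Γ(boxTensor f (n + 1) F, U) :=
  prodList s (List.finRange (n + 1))

theorem res_boxProd {V : (power f (n + 1)).Opens} (h : V ≤ U)
    (s : ∀ i, Γ((Scheme.Modules.pullback (proj f (n + 1) i)).obj (F i), U)) :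
    res _ h (boxProd s) = boxProd fun i ↦ res _ h (s i) :=
  res_prodList h s _

theorem boxProd_smul (c : Fin (n + 1) → Γ(power f (n + 1), U))
    (s : ∀ i, Γ((Scheme.Modules.pullback (proj f (n + 1) i)).obj (F i), U)) :
    boxProd (fun i ↦ c i • s i) = (∏ i, c i) • boxProd s := by
  rw [Fin.prod_univ_def]
  exact prodList_smul c s _

theorem boxProd_update_add
    (s : ∀ i, Γ((Scheme.Modules.pullback (proj f (n + 1) i)).obj (F i), U)) (i : Fin (n + 1))
    (x y : Γ((Scheme.Modules.pullback (proj f (n + 1) i)).obj (F i), U)) :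
    boxProd (Function.update s i (x + y)) =
      boxProd (Function.update s i x) + boxProd (Function.update s i y) :=
  prodList_update_add s x y (List.nodup_finRange _) (List.mem_finRange _)

theorem boxProd_update_smul
    (s : ∀ i, Γ((Scheme.Modules.pullback (proj f (n + 1) i)).obj (F i), U)) (i : Fin (n + 1))
    (c : Γ(power f (n + 1), U))
    (x : Γ((Scheme.Modules.pullback (proj f (n + 1) i)).obj (F i), U)) :
    boxProd (Function.update s i (c • x)) = c • boxProd (Function.update s i x) :=
  prodList_update_smul s c x (List.nodup_finRange _) (List.mem_finRange _)

theorem isBasis_boxProd {κ : Type} [Fintype κ]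
    (s : κ → ∀ i, Γ((Scheme.Modules.pullback (proj f (n + 1) i)).obj (F i), U))
    (t : ∀ i, Γ((Scheme.Modules.pullback (proj f (n + 1) i)).obj (F i), U))
    (h0 : IsBasis ((Scheme.Modules.pullback (proj f (n + 1) 0)).obj (F 0)) fun a ↦ s a 0)
    (hs : ∀ (i : Fin n) a, s a i.succ = t i.succ)
    (ht : ∀ i : Fin n, IsBasis ((Scheme.Modules.pullback (proj f (n + 1) i.succ)).obj (F i.succ))
      fun _ : Unit ↦ t i.succ) :
    IsBasis (boxTensor f (n + 1) F) fun a ↦ boxProd (s a) := by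
  suffices h : ∀ l : List (Fin (n + 1)), l = 0 :: (List.finRange n).map Fin.succ →
      IsBasis (tensorList (l.map fun i ↦ (Scheme.Modules.pullback (proj f (n + 1) i)).obj (F i)))
        fun a ↦ prodList (s a) l from h _ (List.finRange_succ)
  rintro _ rfl
  refine isBasis_prodList_cons s t 0 _ h0 ?_ ?_
  · intro j hj a
    obtain ⟨i, -, rfl⟩ := List.mem_map.1 hj
    exact hs i a
  · intro j hj
    obtain ⟨i, -, rfl⟩ := List.mem_map.1 hj
    exact ht i

end BoxSections

theorem IsBasis.coord_congr {X : Scheme.{u}} {M : X.Modules} {κ : Type} [Fintype κ] {U V : X.Opens}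
    {e e' : κ → Γ(M, U)} (he : IsBasis M e) (he' : IsBasis M e') (h : e = e') (hV : V ≤ U)
    (s : Γ(M, V)) : he.coord hV s = he'.coord hV s := by
  subst h; rfl

/-! ### Integrating a section over all coordinates but one -/

section SliceSections

variable {k : Type u} [Field k] {X : Scheme.{u}} {f : X ⟶ Spec (CommRingCat.of k)} {n : ℕ}

/-- The product of `W` in position `l` and copies of `W₀` elsewhere. -/
def slab (f : X ⟶ Spec (CommRingCat.of k)) (W₀ : X.Opens) (l : Fin (n + 2)) (W : X.Opens) :
    (power f (n + 2)).Opens :=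
  proj f (n + 2) l ⁻¹ᵁ W ⊓ drop f l ⁻¹ᵁ box fun _ ↦ W₀

variable {W₀ : X.Opens} {l : Fin (n + 2)}

theorem slab_mono {V W : X.Opens} (h : V ≤ W) : slab f W₀ l V ≤ slab f W₀ l W :=
  inf_le_inf_right _ ((proj f (n + 2) l).preimage_mono h)

theorem slab_le (W : X.Opens) : slab f W₀ l W ≤ proj f (n + 2) l ⁻¹ᵁ W := inf_le_left

theorem slab_le_of_ne (W : X.Opens) {i : Fin (n + 2)} (h : i ≠ l) :
    slab f W₀ l W ≤ proj f (n + 2) i ⁻¹ᵁ W₀ := by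
  obtain ⟨i, rfl⟩ := Fin.exists_succAbove_eq h
  intro x hx
  have := mem_box.1 hx.2 i
  rwa [proj_drop] at this

theorem bijective_slab (hW₀ : IsAffineOpen W₀) {W : X.Opens} (hW : IsAffineOpen W) :
    Function.Bijective (Algebra.TensorProduct.productMap
      (pb (proj f (n + 2) l) (proj_str f _ l) (slab_le (W₀ := W₀) W))
      (pb (h := str f (n + 1)) (V := slab f W₀ l W) (drop f l) (drop_str f l) inf_le_right)) :=
  bijective_productMap_pb (isPullback_drop f l).flip _ _ hW (isAffineOpen_box fun _ ↦ hW₀) rfl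

/-- Integration of functions on a slab along a functional on the other coordinates. -/
def slabSlice (l : Fin (n + 2)) (hW₀ : IsAffineOpen W₀) {W : X.Opens} (hW : IsAffineOpen W)
    (θ : Fn (str f n) (box fun _ ↦ W₀) →ₗ[k] k) :
    Γ(power f (n + 2), slab f W₀ l W) →+ Γ(X, W) :=
  (slice (bijective_slab hW₀ hW) θ).toAddMonoidHom

variable (hW₀ : IsAffineOpen W₀) (θ : Fn (str f n) (box fun _ ↦ W₀) →ₗ[k] k)

theorem slabSlice_mul {W : X.Opens} (hW : IsAffineOpen W) (c : Γ(X, W))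
    (x : Γ(power f (n + 2), slab f W₀ l W)) :
    slabSlice l hW₀ hW θ ((proj f (n + 2) l).appLE W (slab f W₀ l W) (slab_le W) c * x) =
      c * slabSlice l hW₀ hW θ x :=
  slice_left_mul (bijective_slab hW₀ hW) θ c x

theorem ores_slabSlice {V W : X.Opens} (hV : IsAffineOpen V) (hW : IsAffineOpen W) (h : V ≤ W)
    (x : Γ(power f (n + 2), slab f W₀ l W)) :
    ores X h (slabSlice l hW₀ hW θ x) = slabSlice l hW₀ hV θ (ores _ (slab_mono h) x) := by
  have := map_slice (bijective_slab (f := f) (l := l) hW₀ hW) (bijective_slab hW₀ hV) (fres h)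
    (fres (slab_mono h)) (fun a ↦ (fres_pb _ _ _ _ a).trans (pb_fres _ _ _ _ a).symm)
    (fun c ↦ fres_pb _ _ _ _ c) θ x
  exact (fres_apply h _).symm.trans (this.trans (congrArg _ (fres_apply (slab_mono h) _)))

-- `ν ξ W` stands for inserting a section of `G` in position `l` of a product whose other factors
-- are fixed basis sections over `W₀`. The index `ξ` runs over the choice of these sections, and `K`
-- indexes the possible shapes of local bases of `G`, so that the rank may vary.
variable {G : X.Modules} {M : (power f (n + 2)).Modules} {κx : Type} [Fintype κx] {K : Type}
  {κb : K → Type} [∀ i, Fintype (κb i)]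
  (ν : κx → ∀ W : X.Opens, Γ(G, W) →+ Γ(M, slab f W₀ l W))
  (hν : ∀ ξ {V W : X.Opens} (h : V ≤ W) s, res M (slab_mono h) (ν ξ W s) = ν ξ V (res G h s))
  (hνs : ∀ ξ W c s, ν ξ W (c • s) = (proj f (n + 2) l).appLE W (slab f W₀ l W) (slab_le W) c • ν ξ W s)
  (hνb : ∀ (i : K) (W : X.Opens) (g : κb i → Γ(G, W)), IsBasis G g →
    IsBasis M fun p : κx × κb i ↦ ν p.1 W (g p.2))
  (m : Γ(M, ⊤)) (ξ : κx)

/-- The section of `G` over `W` obtained from a section of `M` by integration along the other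
coordinates. -/
def sliceSection {i : K} {W : X.Opens} (hW : IsAffineOpen W) {g : κb i → Γ(G, W)}
    (hg : IsBasis G g) : Γ(G, W) :=
  ∑ b, slabSlice l hW₀ hW θ ((hνb i W g hg).coord le_rfl (res M le_top m) (ξ, b)) • g b

include hν in
theorem res_sliceSection {i : K} {V W : X.Opens} (hV : IsAffineOpen V) (hW : IsAffineOpen W)
    {g : κb i → Γ(G, W)} (hg : IsBasis G g) (h : V ≤ W) :
    res G h (sliceSection hW₀ θ ν hνb m ξ hW hg) =
      sliceSection hW₀ θ ν hνb m ξ hV (hg.mono h) := by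
  have e : (fun p : κx × κb i ↦ ν p.1 V (res G h (g p.2))) =
      fun p ↦ res M (slab_mono h) (ν p.1 W (g p.2)) := funext fun p ↦ (hν _ _ _).symm
  rw [sliceSection, sliceSection, map_sum]
  refine Finset.sum_congr rfl fun b _ ↦ ?_
  rw [res_smul, ores_slabSlice hW₀ θ hV,
    IsBasis.coord_congr _ ((hνb i W g hg).mono (slab_mono h)) e, IsBasis.coord_mono,
    ← congr_fun (IsBasis.coord_res _ _ (slab_mono h) _) (ξ, b), res_res]

include hνs in
-- The change-of-basis matrix is pulled back from the `l`-th factor, so it comes out of the integral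
-- over the other coordinates.
theorem sliceSection_eq {i i' : K} {W : X.Opens} (hW : IsAffineOpen W) {g : κb i → Γ(G, W)}
    (hg : IsBasis G g) {g' : κb i' → Γ(G, W)} (hg' : IsBasis G g') :
    sliceSection hW₀ θ ν hνb m ξ hW hg = sliceSection hW₀ θ ν hνb m ξ hW hg' := by
  let T (c : κb i') (b : κb i) : Γ(X, W) := hg.coord le_rfl (g' c) b
  have hT (c : κb i') : g' c = ∑ b, T c b • g b := by
    conv_lhs => rw [← hg.sum_coord le_rfl (g' c)]
    simp [T]
  have h1 : (hνb i W g hg).coord le_rfl (res M le_top m) = fun p : κx × κb i ↦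
      ∑ c, (proj f (n + 2) l).appLE W (slab f W₀ l W) (slab_le W) (T c p.2) *
        (hνb i' W g' hg').coord le_rfl (res M le_top m) (p.1, c) := by
    apply IsBasis.coord_eq
    conv_lhs => rw [← (hνb i' W g' hg').sum_coord le_rfl (res M le_top m)]
    simp only [Fintype.sum_prod_type, res_self, Finset.sum_smul]
    refine Finset.sum_congr rfl fun ξ _ ↦ ?_
    rw [Finset.sum_comm]
    refine Finset.sum_congr rfl fun c _ ↦ ?_
    rw [hT, map_sum, Finset.smul_sum]
    refine Finset.sum_congr rfl fun b _ ↦ ?_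
    rw [hνs, smul_smul, mul_comm]
  rw [sliceSection, sliceSection, h1]
  simp only [map_sum, slabSlice_mul, Finset.sum_smul]
  rw [Finset.sum_comm]
  refine Finset.sum_congr rfl fun c _ ↦ ?_
  conv_rhs => rw [hT, Finset.smul_sum]
  refine Finset.sum_congr rfl fun b _ ↦ ?_
  rw [smul_smul, mul_comm]

include hν hνs in
-- Only the coordinates being integrated are confined to `W₀`; position `l` is free to vary over all
-- of `X`. Since the slices are compatible with restriction and independent of the basis, they glue
-- to a global section.
theorem exists_sliceSection (hG : ∀ x : X, ∃ (W : X.Opens) (i : K) (g : κb i → Γ(G, W)),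
      x ∈ W ∧ IsBasis G g) :
    ∃ s : Γ(G, ⊤), ∀ (i : K) (W : X.Opens) (hW : IsAffineOpen W) (g : κb i → Γ(G, W))
      (hg : IsBasis G g), res G le_top s = sliceSection hW₀ θ ν hνb m ξ hW hg := by
  have hG' (x : X) : ∃ (W : X.Opens) (i : K) (g : κb i → Γ(G, W)),
      IsAffineOpen W ∧ x ∈ W ∧ IsBasis G g := by
    obtain ⟨W, i, g, hx, hg⟩ := hG x
    obtain ⟨V, hV, hxV, hVW⟩ := exists_isAffineOpen_mem_and_subset hx
    exact ⟨V, i, _, hV, hxV, hg.mono hVW⟩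
  choose W i g hW hx hg using hG'
  have key {i i' : K} {V V' W : X.Opens} (hV : IsAffineOpen V) (hV' : IsAffineOpen V')
      {g : κb i → Γ(G, V)} (hg : IsBasis G g) {g' : κb i' → Γ(G, V')} (hg' : IsBasis G g')
      (h : W ≤ V) (h' : W ≤ V') :
      res G h (sliceSection hW₀ θ ν hνb m ξ hV hg) =
        res G h' (sliceSection hW₀ θ ν hνb m ξ hV' hg') := by
    refine section_ext fun z hz ↦ ?_
    obtain ⟨U, hU, hzU, hUW⟩ := exists_isAffineOpen_mem_and_subset hz
    have hUW' : U ≤ W := hUW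
    refine ⟨U, hUW', hzU, ?_⟩
    rw [res_res, res_res, res_sliceSection hW₀ θ ν hν hνb m ξ hU hV hg (hUW'.trans h),
      res_sliceSection hW₀ θ ν hν hνb m ξ hU hV' hg' (hUW'.trans h')]
    exact sliceSection_eq hW₀ θ ν hνs hνb m ξ hU _ _
  obtain ⟨s, hs⟩ := section_glue (M := G) (U := ⊤) W (fun _ ↦ le_top) (fun x _ ↦ ⟨x, hx x⟩)
    (fun x ↦ sliceSection hW₀ θ ν hνb m ξ (hW x) (hg x)) fun x y ↦ key _ _ _ _ _ _
  refine ⟨s, fun i' W' hW' g' hg' ↦ section_ext fun z hz ↦ ?_⟩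
  refine ⟨W z ⊓ W', inf_le_right, ⟨hx z, hz⟩, ?_⟩
  rw [res_res, ← key (hW z) hW' (hg z) hg' inf_le_left inf_le_right, ← hs z, res_res]

end SliceSections

section Reindex

variable {X : Scheme.{u}} {M : X.Modules} {κ κ' : Type} [Fintype κ] [Fintype κ'] {U : X.Opens}
  {e : κ → Γ(M, U)} (he : IsBasis M e) (σ : κ' ≃ κ)
include he

theorem IsBasis.reindex : IsBasis M fun a ↦ e (σ a) := fun V h ↦ by
  refine (congrArg Function.Bijective (funext fun c ↦ ?_)).mp
    ((he V h).comp (Equiv.arrowCongr σ (Equiv.refl Γ(X, V))).bijective)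
  exact (Fintype.sum_equiv σ _ _ fun a ↦ by simp).symm

theorem IsBasis.coord_reindex {V : X.Opens} (h : V ≤ U) (s : Γ(M, V)) (a : κ') :
    (he.reindex σ).coord h s a = he.coord h s (σ a) := by
  refine congr_fun ((he.reindex σ).coord_eq h (c := fun a ↦ he.coord h s (σ a)) ?_) a
  conv_lhs => rw [← he.sum_coord h s]
  exact (Fintype.sum_equiv σ _ _ fun a ↦ rfl).symm

end Reindex

/-! ### Coordinates of global sections on an open subset -/

section GlobalCoordinates

variable {k : Type u} [Field k] {X : Scheme.{u}} (f : X ⟶ Spec (CommRingCat.of k)) {M : X.Modules}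
  {κ : Type} [Fintype κ] {W : X.Opens} {e : κ → Γ(M, W)} (he : IsBasis M e)

/-- The coordinates of global sections on an open subset. -/
def globalCoord : globalSections f M →ₗ[k] (κ → Fn f W) where
  toFun s := he.coord le_rfl (res M le_top s)
  map_add' s t := ((congrArg _ (map_add (res M le_top) s t)).trans
    ((he.coord le_rfl).map_add _ _))
  map_smul' c s := by
    have h (s : Γ(M, ⊤)) (r : Γ(X, ⊤)) : he.coord le_rfl (res M le_top (r • s)) =
        ores X (le_top : W ≤ ⊤) r • he.coord le_rfl (res M (le_top : W ≤ ⊤) s) := by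
      rw [res_smul, LinearEquiv.map_smul]
    refine (h s (scalarHom f c)).trans (funext fun a ↦ ?_)
    refine Eq.trans ?_ (Algebra.smul_def (A := Fn f W) c _).symm
    rw [algebraMap_fn_eq_ores]
    rfl

/-- In a local basis the claim reduces to functions, and on an integral scheme functions inject into
those on a smaller nonempty open set. -/
theorem res_injective [IsIntegral X]
    (hM : ∀ x : X, ∃ (U : X.Opens) (n : ℕ) (e : Fin n → Γ(M, U)), x ∈ U ∧ IsBasis M e)
    {W : X.Opens} (hW : (W : Set X).Nonempty) : Function.Injective (res M (le_top : W ≤ ⊤)) := by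
  rw [injective_iff_map_eq_zero]
  intro s hs
  refine section_ext fun x _ ↦ ?_
  obtain ⟨U, n, e, hx, he⟩ := hM x
  refine ⟨U, le_top, hx, (he.coord le_rfl).injective (funext fun a ↦ ?_)⟩
  obtain ⟨y, hyU, hyW⟩ := nonempty_preirreducible_inter U.2 W.2 ⟨x, hx⟩ hW
  have _ : Nonempty (U ⊓ W : X.Opens) := ⟨⟨y, hyU, hyW⟩⟩
  apply map_injective_of_isIntegral X (homOfLE (inf_le_left : U ⊓ W ≤ U))
  have h (t : Γ(M, U)) := congr_fun (he.coord_res le_rfl (inf_le_left : U ⊓ W ≤ U) t) a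
  refine (h _).symm.trans (Eq.trans ?_ (h _))
  rw [res_res, map_zero, map_zero, ← res_res M (le_top : W ≤ ⊤) inf_le_right, hs, map_zero]

theorem globalCoord_injective [IsIntegral X]
    (hM : ∀ x : X, ∃ (U : X.Opens) (n : ℕ) (e : Fin n → Γ(M, U)), x ∈ U ∧ IsBasis M e)
    (hW : (W : Set X).Nonempty) : Function.Injective (globalCoord f he) :=
  (he.coord le_rfl).injective.comp (res_injective hM hW)

end GlobalCoordinates

/-! ### Varying one factor of an external product -/

section Slots

variable {k : Type u} [Field k] {X : Scheme.{u}} {f : X ⟶ Spec (CommRingCat.of k)} {n : ℕ}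
  {F : Fin (n + 2) → X.Modules} {W₀ : X.Opens}

/-- The product over a product of copies of `W₀` of sections over `W₀`. -/
def boxSection {n : ℕ} {F : Fin (n + 1) → X.Modules} (t : ∀ i, Γ(F i, W₀)) :
    Γ(boxTensor f (n + 1) F, box fun _ ↦ W₀) :=
  boxProd fun i ↦ res _ (box_le _ i) (pull (proj f (n + 1) i) (F i) W₀ (t i))

/-- The sections `t i` in positions `i ≠ l`. -/
def slotFamily (t : ∀ i, Γ(F i, W₀)) (l : Fin (n + 2)) (W : X.Opens) (i : Fin (n + 2)) :
    Γ((Scheme.Modules.pullback (proj f (n + 2) i)).obj (F i), slab f W₀ l W) :=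
  if h : i = l then 0 else res _ (slab_le_of_ne W h) (pull (proj f (n + 2) i) (F i) W₀ (t i))

theorem slotFamily_of_ne (t : ∀ i, Γ(F i, W₀)) {l i : Fin (n + 2)} (W : X.Opens) (h : i ≠ l) :
    slotFamily (f := f) t l W i =
      res _ (slab_le_of_ne W h) (pull (proj f (n + 2) i) (F i) W₀ (t i)) :=
  dif_neg h

theorem res_slotFamily (t : ∀ i, Γ(F i, W₀)) (l : Fin (n + 2)) {V W : X.Opens} (hVW : V ≤ W)
    (i : Fin (n + 2)) :
    res _ (slab_mono hVW) (slotFamily (f := f) t l W i) = slotFamily (f := f) t l V i := by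
  by_cases h : i = l
  · subst h; simp [slotFamily]
  · rw [slotFamily_of_ne t W h, slotFamily_of_ne t V h, res_res]

/-- The product of a section in position `l` and of the sections `t i` in positions `i ≠ l`. -/
def slot (t : ∀ i, Γ(F i, W₀)) (l : Fin (n + 2)) (W : X.Opens) :
    Γ(F l, W) →+ Γ(boxTensor f (n + 2) F, slab f W₀ l W) :=
  AddMonoidHom.mk' (fun s ↦ boxProd (Function.update (slotFamily t l W) l
    (res _ (slab_le W) (pull (proj f (n + 2) l) (F l) W s))))
    fun s s' ↦ by rw [map_add, map_add, boxProd_update_add]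

theorem slot_apply (t : ∀ i, Γ(F i, W₀)) (l : Fin (n + 2)) (W : X.Opens) (s : Γ(F l, W)) :
    slot (f := f) t l W s = boxProd (Function.update (slotFamily t l W) l
      (res _ (slab_le W) (pull (proj f (n + 2) l) (F l) W s))) := rfl

theorem slot_smul (t : ∀ i, Γ(F i, W₀)) (l : Fin (n + 2)) (W : X.Opens) (c : Γ(X, W))
    (s : Γ(F l, W)) : slot (f := f) t l W (c • s) =
      (proj f (n + 2) l).appLE W (slab f W₀ l W) (slab_le W) c • slot t l W s := by
  rw [slot_apply, slot_apply, pull_smul, res_smul, boxProd_update_smul]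
  rfl

theorem res_slot (t : ∀ i, Γ(F i, W₀)) (l : Fin (n + 2)) {V W : X.Opens} (h : V ≤ W)
    (s : Γ(F l, W)) : res _ (slab_mono h) (slot (f := f) t l W s) = slot (f := f) t l V (res _ h s) := by
  rw [slot_apply, slot_apply, res_boxProd]
  congr 1
  funext i
  by_cases hi : i = l
  · subst hi
    rw [Function.update_self, Function.update_self, res_res, pull_res, res_res]
  · rw [Function.update_of_ne hi, Function.update_of_ne hi, res_slotFamily t l h]

theorem box_le_slab (l : Fin (n + 2)) : box (fun _ ↦ W₀) ≤ slab f W₀ l W₀ := (box_eq _ l).le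

theorem res_slot_box (t : ∀ i, Γ(F i, W₀)) (l : Fin (n + 2)) (s : Γ(F l, W₀)) :
    res _ (box_le_slab l) (slot (f := f) t l W₀ s) = boxSection (Function.update t l s) := by
  rw [slot_apply, res_boxProd]
  refine congrArg boxProd (funext fun i ↦ ?_)
  by_cases hi : i = l
  · subst hi
    rw [Function.update_self, Function.update_self, res_res]
  · rw [Function.update_of_ne hi, Function.update_of_ne hi, slotFamily_of_ne t _ hi, res_res]

theorem isBasis_boxSection {n : ℕ} {F : Fin (n + 1) → X.Modules} {κ : Type} [Fintype κ]
    {e : κ → Γ(F 0, W₀)} (he : IsBasis (F 0) e) {t : ∀ i : Fin n, Γ(F i.succ, W₀)}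
    (ht : ∀ i, IsBasis (F i.succ) fun _ : Unit ↦ t i) : IsBasis (boxTensor f (n + 1) F) fun a ↦
      boxSection (f := f) (Fin.cons (α := fun i ↦ Γ(F i, W₀)) (e a) t) :=
  isBasis_boxProd _ (fun i ↦ res _ (box_le _ i) (pull (proj f (n + 1) i) (F i) W₀
    (Fin.cons (α := fun i ↦ Γ(F i, W₀)) 0 t i))) ((he.pull _).mono _) (fun _ _ ↦ rfl)
    fun i ↦ ((ht i).pull _).mono _

variable {κ : Type} [Fintype κ] {t : ∀ i : Fin (n + 1), Γ(F i.succ, W₀)}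
  (ht : ∀ i, IsBasis (F i.succ) fun _ : Unit ↦ t i)
include ht

/-- `t₀` only fills position `0`, which is overwritten by `g b`. -/
theorem isBasis_slot_zero (t₀ : Γ(F 0, W₀)) {W : X.Opens} {g : κ → Γ(F 0, W)}
    (hg : IsBasis (F 0) g) : IsBasis (boxTensor f (n + 2) F) fun b ↦
      slot (f := f) (Fin.cons (α := fun i ↦ Γ(F i, W₀)) t₀ t) 0 W (g b) := by
  refine isBasis_boxProd (F := F) _ (slotFamily (f := f)
    (Fin.cons (α := fun i ↦ Γ(F i, W₀)) t₀ t) 0 W) ?_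
    (fun i a ↦ Function.update_of_ne (Fin.succ_ne_zero i) _ _) fun i ↦ ?_
  · simp only [Function.update_self]
    exact (hg.pull _).mono _
  · rw [slotFamily_of_ne _ W (Fin.succ_ne_zero i)]
    exact ((ht i).pull _).mono _

theorem isBasis_slot_succ {e : κ → Γ(F 0, W₀)} (he : IsBasis (F 0) e) (j : Fin (n + 1))
    {W : X.Opens} {g : Unit → Γ(F j.succ, W)} (hg : IsBasis (F j.succ) g) :
    IsBasis (boxTensor f (n + 2) F) fun a ↦
      slot (f := f) (Fin.cons (α := fun i ↦ Γ(F i, W₀)) (e a) t) j.succ W (g ()) := by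
  refine isBasis_boxProd (F := F) _ (Function.update (slotFamily (f := f)
    (Fin.cons (α := fun i ↦ Γ(F i, W₀)) 0 t) j.succ W) j.succ
    (res _ (slab_le W) (pull (proj f (n + 2) j.succ) (F j.succ) W (g ())))) ?_ (fun i a ↦ ?_)
    fun i ↦ ?_
  · have h (a : κ) := slotFamily_of_ne (f := f) (Fin.cons (α := fun i ↦ Γ(F i, W₀)) (e a) t) W
      (Fin.succ_ne_zero j).symm
    simp only [Function.update_of_ne (Fin.succ_ne_zero j).symm, h]
    exact (he.pull _).mono _
  · by_cases hi : i = j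
    · subst hi
      rw [Function.update_self, Function.update_self]
    · have hi' : i.succ ≠ j.succ := by simpa using hi
      rw [Function.update_of_ne hi', Function.update_of_ne hi', slotFamily_of_ne _ W hi',
        slotFamily_of_ne _ W hi']
      rfl
  · by_cases hi : i = j
    · subst hi
      simp only [Function.update_self]
      exact (hg.pull _).mono _
    · have hi' : i.succ ≠ j.succ := by simpa using hi
      simp only [Function.update_of_ne hi']
      rw [slotFamily_of_ne _ W hi']
      exact ((ht i).pull _).mono _

end Slots

/-! ### Global sections of an external tensor product -/

section GlobalSections

variable {k : Type u} [Field k] {X : Scheme.{u}} {f : X ⟶ Spec (CommRingCat.of k)} {n : ℕ}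
  {W₀ : X.Opens} (hW₀ : IsAffineOpen W₀)

/-- The slab over `W₀` is the box, but with another description. This compares integration on the
two, together with a reindexing of the basis. -/
theorem slabSlice_coord {M : (power f (n + 2)).Modules} {κ κ' : Type} [Fintype κ] [Fintype κ']
    {l : Fin (n + 2)} {E : κ' → Γ(M, slab f W₀ l W₀)} (hE : IsBasis M E)
    {E₀ : κ → Γ(M, box fun _ ↦ W₀)} (hE₀ : IsBasis M E₀) (σ : κ' ≃ κ)
    (h : ∀ p, res M (box_le_slab l) (E p) = E₀ (σ p)) (m : Γ(M, ⊤)) (p : κ')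
    (θ : Fn (str f n) (box fun _ ↦ W₀) →ₗ[k] k) :
    slabSlice l hW₀ hW₀ θ (hE.coord le_rfl (res M le_top m) p) =
      slice (bijective_pbProj_pbDrop hW₀ l) θ (hE₀.coord le_rfl (res M le_top m) (σ p)) := by
  have h1 := map_slice (bijective_slab (f := f) (l := l) hW₀ hW₀)
    (bijective_pbProj_pbDrop hW₀ l) (AlgHom.id k _) (fres (box_le_slab l))
    (fun a ↦ fres_pb _ _ _ _ a) (fun c ↦ fres_pb _ _ _ _ c) θ
    (hE.coord le_rfl (res M le_top m) p)
  refine h1.trans (congrArg _ ((fres_apply (box_le_slab l) _).trans ?_))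
  have h2 := congr_fun (hE.coord_res le_rfl (box_le_slab l) (res M le_top m)) p
  refine h2.symm.trans ?_
  rw [res_res, ← hE₀.coord_reindex σ, ← hE.coord_mono (box_le_slab l) le_rfl]
  exact congr_fun (IsBasis.coord_congr _ _ (funext h) _ _) p

section

variable {F : Fin (n + 2) → X.Modules} {t : ∀ i : Fin (n + 1), Γ(F i.succ, W₀)}
  (ht : ∀ i, IsBasis (F i.succ) fun _ : Unit ↦ t i) {r : ℕ} {e : Fin r → Γ(F 0, W₀)}
  (he : IsBasis (F 0) e) (m : Γ(boxTensor f (n + 2) F, ⊤))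
  (θ : Fn (str f n) (box fun _ ↦ W₀) →ₗ[k] k)

/-- Integration over all coordinates except the first, applied with `exists_sliceSection`. The other
factors have a single basis section, so `κx` is `Unit`, while `K = ℕ` records the local rank of `F
0`. -/
theorem exists_slice_zero_eq_coord
    (h0 : ∀ x : X, ∃ (U : X.Opens) (r : ℕ) (e : Fin r → Γ(F 0, U)), x ∈ U ∧ IsBasis (F 0) e) :
    ∃ s : Γ(F 0, ⊤), ∀ a, slice (bijective_pbProj_pbDrop hW₀ 0) θ
      ((isBasis_boxSection (f := f) he ht).coord le_rfl (res _ le_top m) a) =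
        he.coord le_rfl (res _ le_top s) a := by
  have hb (i : ℕ) (W : X.Opens) (g' : Fin i → Γ(F 0, W)) (hg' : IsBasis (F 0) g') :=
    (isBasis_slot_zero (f := f) ht 0 hg').reindex (Equiv.punitProd (Fin i))
  obtain ⟨s, hs⟩ := exists_sliceSection hW₀ θ (K := ℕ) (κb := Fin) (κx := Unit)
    (fun _ ↦ slot (f := f) (Fin.cons (α := fun i ↦ Γ(F i, W₀)) 0 t) 0)
    (fun _ _ _ h s ↦ res_slot _ 0 h s) (fun _ _ _ _ ↦ slot_smul _ 0 _ _ _) hb m () h0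
  refine ⟨s, fun a ↦ ?_⟩
  have h1 : he.coord le_rfl (res _ le_top s) a = slabSlice 0 hW₀ hW₀ θ
      ((hb r W₀ e he).coord le_rfl (res _ le_top m) ((), a)) := by
    refine congr_fun (he.coord_eq le_rfl (c := fun a ↦ slabSlice 0 hW₀ hW₀ θ
      ((hb r W₀ e he).coord le_rfl (res _ le_top m) ((), a))) ?_) a
    refine (hs r W₀ hW₀ e he).trans ?_
    simp only [sliceSection, res_self]
    rfl
  rw [h1]
  refine (slabSlice_coord hW₀ (hb r W₀ e he) _ (Equiv.punitProd (Fin r)) (fun p ↦ ?_) m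
    ((), a) θ).symm
  refine (res_slot_box _ _ _).trans (congrArg boxSection ?_)
  exact Fin.update_cons_zero _ _ _

/-- The counterpart for a factor of rank one: `κx = Fin r` now selects the basis section used in the
first factor. -/
theorem exists_slice_succ_eq_coord (j : Fin (n + 1)) (a : Fin r)
    (hj : ∀ x : X, ∃ (U : X.Opens) (e : Unit → Γ(F j.succ, U)), x ∈ U ∧ IsBasis (F j.succ) e) :
    ∃ s : Γ(F j.succ, ⊤), slice (bijective_pbProj_pbDrop hW₀ j.succ) θ
      ((isBasis_boxSection (f := f) he ht).coord le_rfl (res _ le_top m) a) =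
        (ht j).coord le_rfl (res _ le_top s) () := by
  have hb (i : Unit) (W : X.Opens) (g' : Unit → Γ(F j.succ, W)) (hg' : IsBasis (F j.succ) g') :
      IsBasis (boxTensor f (n + 2) F) fun p : Fin r × Unit ↦
        slot (f := f) (Fin.cons (α := fun i ↦ Γ(F i, W₀)) (e p.1) t) j.succ W (g' p.2) :=
    (isBasis_slot_succ (f := f) ht he j hg').reindex (Equiv.prodPUnit (Fin r))
  obtain ⟨s, hs⟩ := exists_sliceSection hW₀ θ (K := Unit) (κb := fun _ ↦ Unit) (κx := Fin r)
    (fun a ↦ slot (f := f) (Fin.cons (α := fun i ↦ Γ(F i, W₀)) (e a) t) j.succ)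
    (fun _ _ _ h s ↦ res_slot _ _ h s) (fun _ _ _ _ ↦ slot_smul _ _ _ _ _) hb m a
    (fun x ↦ (hj x).imp fun _ h ↦ ⟨(), h⟩)
  refine ⟨s, ?_⟩
  have h1 : (ht j).coord le_rfl (res _ le_top s) () = slabSlice j.succ hW₀ hW₀ θ
      ((hb () W₀ _ (ht j)).coord le_rfl (res _ le_top m) (a, ())) := by
    refine congr_fun ((ht j).coord_eq le_rfl (c := fun b ↦ slabSlice j.succ hW₀ hW₀ θ
      ((hb () W₀ _ (ht j)).coord le_rfl (res _ le_top m) (a, b))) ?_) ()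
    refine (hs () W₀ hW₀ _ (ht j)).trans ?_
    simp only [sliceSection, res_self]
  rw [h1]
  refine (slabSlice_coord hW₀ (hb () W₀ _ (ht j)) _ (Equiv.prodPUnit (Fin r)) (fun p ↦ ?_) m
    (a, ()) θ).symm
  refine (res_slot_box _ _ _).trans (congrArg boxSection ?_)
  refine (Fin.cons_update _ _ _ _).symm.trans ?_
  rw [Function.update_eq_self]
  rfl

end

/-- The family `A, L, …, L`. -/
abbrev consFamily (A L : X.Modules) (n : ℕ) : Fin (n + 1) → X.Modules := Fin.cons A fun _ ↦ L

section

variable {A L : X.Modules} {W : X.Opens} {κ : Type} [Fintype κ] {e : κ → Γ(A, W)}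
  (he : IsBasis A e) {g : Γ(L, W)} (hg : IsBasis L fun _ : Unit ↦ g)

include he in
theorem isBasis_consFamily_zero (n : ℕ) : IsBasis (consFamily A L n 0) e := he

include hg in
theorem isBasis_consFamily_succ {n : ℕ} (i : Fin n) :
    IsBasis (consFamily A L n i.succ) fun _ : Unit ↦ g := hg

include he hg in
theorem isBasis_boxSection_consFamily (n : ℕ) :
    IsBasis (boxTensor f (n + 1) (consFamily A L n)) fun a ↦
      boxSection (f := f) (F := consFamily A L n)
        (Fin.cons (α := fun i ↦ Γ(consFamily A L n i, W)) (e a) fun _ ↦ g) :=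
  isBasis_boxSection (n := n) (F := consFamily A L n) (e := e) (t := fun _ ↦ g)
    (isBasis_consFamily_zero he n) (isBasis_consFamily_succ hg)

end

include hW₀ in
/-- Global sections of an external tensor product come from products of global sections. -/
theorem exists_evalBox_eq_coord {A L : X.Modules}
    (hA : ∀ x : X, ∃ (U : X.Opens) (r : ℕ) (e : Fin r → Γ(A, U)), x ∈ U ∧ IsBasis A e)
    (hL : ∀ x : X, ∃ (U : X.Opens) (e : Unit → Γ(L, U)), x ∈ U ∧ IsBasis L e)
    {r : ℕ} {e : Fin r → Γ(A, W₀)} (he : IsBasis A e) {g : Γ(L, W₀)}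
    (hg : IsBasis L fun _ : Unit ↦ g) (m : Γ(boxTensor f (n + 2) (consFamily A L (n + 1)), ⊤)) :
    ∃ y : globalSections f A ⊗[k] (⨂[k]^(n + 1) (globalSections f L)),
      evalBox (globalCoord f he) (LinearMap.proj () ∘ₗ globalCoord f hg) (n + 1) y =
        (isBasis_boxSection_consFamily (f := f) he hg (n + 1)).coord le_rfl (res _ le_top m) := by
  let x : Fin r → Fn (str f (n + 1)) (box fun _ ↦ W₀) :=
    (isBasis_boxSection_consFamily (f := f) he hg (n + 1)).coord le_rfl (res _ le_top m)
  have h0 (θ) : ∃ b, (fun a ↦ slice (bijective_pbProj_pbDrop hW₀ 0) θ (x a)) =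
      globalCoord f he b := by
    obtain ⟨s, hs⟩ := exists_slice_zero_eq_coord hW₀ (F := consFamily A L (n + 1)) (t := fun _ ↦ g)
      (isBasis_consFamily_succ hg) (isBasis_consFamily_zero he (n + 1)) m θ hA
    exact ⟨s, funext hs⟩
  have h1 (j : Fin (n + 1)) (θ) (a : Fin r) : ∃ v,
      slice (bijective_pbProj_pbDrop hW₀ j.succ) θ (x a) =
        (LinearMap.proj () ∘ₗ globalCoord f hg) v :=
    exists_slice_succ_eq_coord hW₀ (F := consFamily A L (n + 1)) (t := fun _ ↦ g)
      (isBasis_consFamily_succ hg) (isBasis_consFamily_zero he (n + 1)) m θ j a hL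
  exact exists_evalBox_eq _ _ hW₀ x h0 h1

end GlobalSections

/-! ### Explicit local sections of external products and their coordinates -/

section PullTo

variable {X P : Scheme.{u}} {M : X.Modules} (a : P ⟶ X) {W : X.Opens} {U : P.Opens}

/-- The pullback of sections, restricted to an open subset. -/
def pullTo (h : U ≤ a ⁻¹ᵁ W) : Γ(M, W) →+ Γ((Scheme.Modules.pullback a).obj M, U) :=
  (res _ h).comp (pull a M W)

theorem pullTo_smul (h : U ≤ a ⁻¹ᵁ W) (c : Γ(X, W)) (s : Γ(M, W)) :
    pullTo a h (c • s) = a.appLE W U h c • pullTo a h s := by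
  change res _ h (pull a M W (c • s)) = _
  rw [pull_smul, res_smul]
  rfl

theorem pullTo_res {V : X.Opens} (h : U ≤ a ⁻¹ᵁ V) (hV : V ≤ W) (s : Γ(M, W)) :
    pullTo a h (res M hV s) = pullTo a (h.trans (a.preimage_mono hV)) s := by
  change res _ h (pull a M V (res M hV s)) = _
  rw [pull_res, res_res]
  rfl

theorem res_pullTo (h : U ≤ a ⁻¹ᵁ W) {V : P.Opens} (hV : V ≤ U) (s : Γ(M, W)) :
    res _ hV (pullTo a h s) = pullTo a (hV.trans h) s :=
  res_res _ _ _ _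

end PullTo

section BoxCons

variable {k : Type u} [Field k] {X : Scheme.{u}} {f : X ⟶ Spec (CommRingCat.of k)} {n : ℕ}
  {F : Fin (n + 1) → X.Modules} {U : (power f (n + 1)).Opens}

/-- The product of sections of the pullbacks along the projections, as a linear map in the first
factor. -/
def boxCons
    (s : ∀ i : Fin n, Γ((Scheme.Modules.pullback (proj f (n + 1) i.succ)).obj (F i.succ), U)) :
    Γ((Scheme.Modules.pullback (proj f (n + 1) 0)).obj (F 0), U) →ₗ[Γ(power f (n + 1), U)]
      Γ(boxTensor f (n + 1) F, U) where
  toFun x := boxProd (Fin.cons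
    (α := fun i ↦ Γ((Scheme.Modules.pullback (proj f (n + 1) i)).obj (F i), U)) x s)
  map_add' x y := by
    have h (z) := Fin.update_cons_zero
      (α := fun i ↦ Γ((Scheme.Modules.pullback (proj f (n + 1) i)).obj (F i), U)) 0 s z
    rw [← h x, ← h y, ← h (x + y), boxProd_update_add]
  map_smul' c x := by
    have h (z) := Fin.update_cons_zero
      (α := fun i ↦ Γ((Scheme.Modules.pullback (proj f (n + 1) i)).obj (F i), U)) 0 s z
    rw [← h x, ← h (c • x), boxProd_update_smul]
    rfl

theorem boxCons_apply
    (s : ∀ i : Fin n, Γ((Scheme.Modules.pullback (proj f (n + 1) i.succ)).obj (F i.succ), U))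
    (x : Γ((Scheme.Modules.pullback (proj f (n + 1) 0)).obj (F 0), U)) :
    boxCons s x = boxProd (Fin.cons
      (α := fun i ↦ Γ((Scheme.Modules.pullback (proj f (n + 1) i)).obj (F i), U)) x s) := rfl

theorem boxCons_smul (c : Fin n → Γ(power f (n + 1), U))
    (s : ∀ i : Fin n, Γ((Scheme.Modules.pullback (proj f (n + 1) i.succ)).obj (F i.succ), U))
    (x : Γ((Scheme.Modules.pullback (proj f (n + 1) 0)).obj (F 0), U)) :
    boxCons (fun i ↦ c i • s i) x = (∏ i, c i) • boxCons s x := by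
  have h := boxProd_smul (Fin.cons (α := fun _ ↦ Γ(power f (n + 1), U)) 1 c) (Fin.cons
    (α := fun i ↦ Γ((Scheme.Modules.pullback (proj f (n + 1) i)).obj (F i), U)) x s)
  rw [Fin.prod_univ_succ, Fin.cons_zero, one_mul] at h
  refine Eq.trans (congrArg boxProd (funext fun i ↦ ?_)) h
  cases i using Fin.cases with
  | zero => exact (one_smul _ _).symm
  | succ i => rfl

theorem res_boxCons {V : (power f (n + 1)).Opens} (h : V ≤ U)
    (s : ∀ i : Fin n, Γ((Scheme.Modules.pullback (proj f (n + 1) i.succ)).obj (F i.succ), U))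
    (x : Γ((Scheme.Modules.pullback (proj f (n + 1) 0)).obj (F 0), U)) :
    res _ h (boxCons s x) = boxCons (fun i ↦ res _ h (s i)) (res _ h x) := by
  rw [boxCons_apply, boxCons_apply, res_boxProd]
  refine congrArg boxProd (funext fun i ↦ ?_)
  cases i using Fin.cases <;> rfl

variable {W : X.Opens} {T : Fin n → X.Opens} (h0 : U ≤ proj f (n + 1) 0 ⁻¹ᵁ W)
  (h1 : ∀ i : Fin n, U ≤ proj f (n + 1) i.succ ⁻¹ᵁ T i) {κ : Type} [Fintype κ]
  {e : κ → Γ(F 0, W)} (he : IsBasis (F 0) e) {t : ∀ i : Fin n, Γ(F i.succ, T i)}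
  (ht : ∀ i, IsBasis (F i.succ) fun _ : Unit ↦ t i)

include he ht in
theorem isBasis_boxCons : IsBasis (boxTensor f (n + 1) F) fun a ↦
    boxCons (fun i ↦ pullTo (proj f (n + 1) i.succ) (h1 i) (t i))
      (pullTo (proj f (n + 1) 0) h0 (e a)) :=
  isBasis_boxProd _ (Fin.cons
      (α := fun i ↦ Γ((Scheme.Modules.pullback (proj f (n + 1) i)).obj (F i), U)) 0
        fun i ↦ pullTo (proj f (n + 1) i.succ) (h1 i) (t i))
    ((he.pull _).mono h0) (fun _ _ ↦ rfl) fun i ↦ ((ht i).pull _).mono (h1 i)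

theorem coord_boxCons {E : κ → Γ(boxTensor f (n + 1) F, U)} (hE : IsBasis (boxTensor f (n + 1) F) E)
    (hEe : ∀ a, E a = boxCons (fun i ↦ pullTo (proj f (n + 1) i.succ) (h1 i) (t i))
      (pullTo (proj f (n + 1) 0) h0 (e a))) (x : Γ(F 0, W)) (y : ∀ i : Fin n, Γ(F i.succ, T i)) :
    hE.coord le_rfl (boxCons (fun i ↦ pullTo (proj f (n + 1) i.succ) (h1 i) (y i))
      (pullTo (proj f (n + 1) 0) h0 x)) = fun a ↦
        (∏ i : Fin n, (proj f (n + 1) i.succ).appLE (T i) U (h1 i)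
          ((ht i).coord le_rfl (y i) ())) *
            (proj f (n + 1) 0).appLE W U h0 (he.coord le_rfl x a) := by
  apply IsBasis.coord_eq
  have hy (i : Fin n) : pullTo (proj f (n + 1) i.succ) (h1 i) (y i) =
      (proj f (n + 1) i.succ).appLE (T i) U (h1 i) ((ht i).coord le_rfl (y i) ()) •
        pullTo (proj f (n + 1) i.succ) (h1 i) (t i) := by
    rw [← pullTo_smul]
    conv_lhs => rw [← (ht i).sum_coord le_rfl (y i)]
    simp
  have hx : pullTo (proj f (n + 1) 0) h0 x =
      ∑ a, (proj f (n + 1) 0).appLE W U h0 (he.coord le_rfl x a) •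
        pullTo (proj f (n + 1) 0) h0 (e a) := by
    conv_lhs => rw [← he.sum_coord le_rfl x, map_sum]
    simp only [res_self, pullTo_smul]
  rw [funext hy, boxCons_smul, hx, map_sum, Finset.smul_sum]
  refine Finset.sum_congr rfl fun a _ ↦ ?_
  rw [LinearMap.map_smul, smul_smul, hEe, res_self]

end BoxCons

theorem IsBasis.coord_tmul {X : Scheme.{u}} {M N : X.Modules} {κ : Type} [Fintype κ] {U : X.Opens}
    {e : κ → Γ(M, U)} (he : IsBasis M e) {g : Unit → Γ(N, U)} (hg : IsBasis N g) {V : X.Opens}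
    (h : V ≤ U) (s : Γ(M, V)) (t : Γ(N, V)) (a : κ) :
    (he.tmul hg).coord h (GreenKoszul.tmul s t) a = he.coord h s a * hg.coord h t () := by
  refine congr_fun ((he.tmul hg).coord_eq h
    (c := fun a ↦ he.coord h s a * hg.coord h t ()) ?_) a
  conv_lhs => rw [← he.sum_coord h s, ← hg.sum_coord h t]
  simp only [Finset.univ_unique, Finset.sum_singleton, sum_tmul, smul_tmul, tmul_smul, res_tmul,
    mul_smul, Finset.smul_sum]
  exact Finset.sum_congr rfl fun a _ ↦ smul_comm _ _ _

section GlobalCoordinates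

variable {k : Type u} [Field k] {X : Scheme.{u}} {f : X ⟶ Spec (CommRingCat.of k)} {M L : X.Modules}
  {κ : Type} [Fintype κ] {W : X.Opens} {e : κ → Γ(M, W)} (he : IsBasis M e)

theorem globalCoord_mono {V : X.Opens} (h : V ≤ W) (s : globalSections f M) (a : κ) :
    globalCoord f (he.mono h) s a = fres h (globalCoord f he s a) := by
  refine Eq.trans ?_ (fres_apply h _).symm
  have h1 := congr_fun (he.coord_res le_rfl h (res M le_top (show Γ(M, ⊤) from s))) a
  rw [res_res] at h1
  exact (congr_fun (he.coord_mono h le_rfl _) a).trans h1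

theorem globalCoord_sectionsMul {l : Unit → Γ(L, W)} (hl : IsBasis L l) (v : globalSections f L)
    (b : globalSections f M) (a : κ) : globalCoord f (he.tmul hl) (sectionsMul f L M v b) a =
      globalCoord f hl v () * globalCoord f he b a := by
  have h : res (tensor M L) (le_top : W ≤ ⊤) (tmul (show Γ(M, ⊤) from b) (show Γ(L, ⊤) from v)) =
    tmul (res M le_top b) (res L le_top v) := res_tmul _ _ _
  refine (congrArg (fun z ↦ (he.tmul hl).coord le_rfl z a) h).trans ?_
  exact (he.coord_tmul hl le_rfl _ _ a).trans (mul_comm _ _)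

end GlobalCoordinates

/-! ### Evaluating tensors of global sections along maps to `X` -/

section EvalCoord

variable {k : Type u} [Field k] {X : Scheme.{u}} {f : X ⟶ Spec (CommRingCat.of k)}
  {M L : X.Modules} {κ : Type} [Fintype κ] {n : ℕ} {Y : Scheme.{u}}
  {h : Y ⟶ Spec (CommRingCat.of k)} {U : Y.Opens} {D : X.Opens} {g : κ → Γ(M, D)}
  (hg : IsBasis M g) (a : κ) {ρ₀ : Y ⟶ X} (hρ₀ : ρ₀ ≫ f = h) (h₀ : U ≤ ρ₀ ⁻¹ᵁ D)
  {T : Fin n → X.Opens} {t : ∀ i, Γ(L, T i)} (ht : ∀ i, IsBasis L fun _ : Unit ↦ t i)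
  {ρ : Fin n → (Y ⟶ X)} (hρ : ∀ i, ρ i ≫ f = h) (hU : ∀ i, U ≤ ρ i ⁻¹ᵁ T i)

/-- The products of the pullbacks of coordinates of global sections. -/
def evalCoord : globalSections f M ⊗[k] (⨂[k]^n (globalSections f L)) →ₗ[k] Fn h U :=
  evalTensor ((pb ρ₀ hρ₀ h₀).toLinearMap ∘ₗ LinearMap.proj a ∘ₗ globalCoord f hg)
    fun i ↦ (pb (ρ i) (hρ i) (hU i)).toLinearMap ∘ₗ LinearMap.proj () ∘ₗ globalCoord f (ht i)

theorem evalCoord_tmul (b : globalSections f M) (v : Fin n → globalSections f L) :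
    evalCoord hg a hρ₀ h₀ ht hρ hU (b ⊗ₜ PiTensorProduct.tprod k v) =
      pb ρ₀ hρ₀ h₀ (globalCoord f hg b a) *
        ∏ i, pb (ρ i) (hρ i) (hU i) (globalCoord f (ht i) (v i) ()) :=
  evalTensor_tmul _ _ _ _

theorem evalCoord_congr {ρ₀' : Y ⟶ X} {ρ' : Fin n → (Y ⟶ X)} (e₀ : ρ₀ = ρ₀') (e : ρ = ρ')
    (z : globalSections f M ⊗[k] (⨂[k]^n (globalSections f L))) :
    evalCoord hg a hρ₀ h₀ ht hρ hU z = evalCoord hg a (ρ₀ := ρ₀') (e₀ ▸ hρ₀) (e₀ ▸ h₀) ht (ρ := ρ')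
      (e ▸ hρ) (e ▸ hU) z := by
  subst e₀ e; rfl

/-- The evaluation maps `ρ₀`, `ρ i` are arbitrary precisely so that restriction, in particular to a
diagonal, becomes composition. -/
theorem pb_evalCoord {Z : Scheme.{u}} {h' : Z ⟶ Spec (CommRingCat.of k)} (σ : Z ⟶ Y)
    (hσ : σ ≫ h = h') {V : Z.Opens} (hV : V ≤ σ ⁻¹ᵁ U)
    (z : globalSections f M ⊗[k] (⨂[k]^n (globalSections f L))) :
    pb σ hσ hV (evalCoord hg a hρ₀ h₀ ht hρ hU z) =
      evalCoord hg a (ρ₀ := σ ≫ ρ₀) (by rw [Category.assoc, hρ₀, hσ])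
        (hV.trans (σ.preimage_mono h₀)) ht (ρ := fun i ↦ σ ≫ ρ i)
        (fun i ↦ by rw [Category.assoc, hρ, hσ]) (fun i ↦ hV.trans (σ.preimage_mono (hU i))) z := by
  refine LinearMap.congr_fun (f := (pb σ hσ hV).toLinearMap ∘ₗ evalCoord hg a hρ₀ h₀ ht hρ hU)
    (tensorPower_hom_ext fun b v ↦ ?_) z
  rw [evalCoord_tmul, LinearMap.comp_apply, evalCoord_tmul, AlgHom.toLinearMap_apply, map_mul,
    map_prod, pb_pb]
  simp only [pb_pb]

theorem evalCoord_mono {D' : X.Opens} (hD : D' ≤ D) (h₀' : U ≤ ρ₀ ⁻¹ᵁ D')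
    (z : globalSections f M ⊗[k] (⨂[k]^n (globalSections f L))) :
    evalCoord (hg.mono hD) a hρ₀ h₀' ht hρ hU z = evalCoord hg a hρ₀ h₀ ht hρ hU z := by
  refine LinearMap.congr_fun (tensorPower_hom_ext fun b v ↦ ?_) z
  rw [evalCoord_tmul, evalCoord_tmul, globalCoord_mono, pb_fres]

theorem evalCoord_basis_congr {g' : κ → Γ(M, D)} (hg' : IsBasis M g') (e : g = g')
    (z : globalSections f M ⊗[k] (⨂[k]^n (globalSections f L))) :
    evalCoord hg a hρ₀ h₀ ht hρ hU z = evalCoord hg' a hρ₀ h₀ ht hρ hU z := by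
  subst e; rfl

end EvalCoord

section Contraction

variable {k : Type u} [Field k] {X : Scheme.{u}} {f : X ⟶ Spec (CommRingCat.of k)}
  {M L : X.Modules} {κ : Type} [Fintype κ] {n : ℕ} {Y : Scheme.{u}}
  {h : Y ⟶ Spec (CommRingCat.of k)} {U : Y.Opens} {D D' : X.Opens} {g : κ → Γ(M, D)}
  (hg : IsBasis M g) (a : κ) {ρ₀ : Y ⟶ X} (hρ₀ : ρ₀ ≫ f = h) (h₀ : U ≤ ρ₀ ⁻¹ᵁ D)

/-- When `ρ j = ρ₀`, the `j`-th section and the first one are evaluated at the same point and may be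
multiplied beforehand. Thus contraction is restriction to a diagonal; `D'` is a common domain for
the two local bases. -/
theorem evalCoord_contr {T : Fin (n + 1) → X.Opens} {t : ∀ i, Γ(L, T i)}
    (ht : ∀ i, IsBasis L fun _ : Unit ↦ t i) {ρ : Fin (n + 1) → (Y ⟶ X)} (hρ : ∀ i, ρ i ≫ f = h)
    (hU : ∀ i, U ≤ ρ i ⁻¹ᵁ T i) (j : Fin (n + 1)) (e : ρ j = ρ₀) (hD : D' ≤ D) (hT : D' ≤ T j)
    (h₀' : U ≤ ρ₀ ⁻¹ᵁ D') (z : globalSections f M ⊗[k] (⨂[k]^(n + 1) (globalSections f L))) :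
    evalCoord hg a hρ₀ h₀ ht hρ hU z =
      evalCoord ((hg.mono hD).tmul ((ht j).mono hT)) a hρ₀ h₀' (fun i ↦ ht (j.succAbove i))
        (fun i ↦ hρ (j.succAbove i)) (fun i ↦ hU (j.succAbove i))
        (contr (sectionsMul f L M) j z) := by
  refine (evalTensor_contr j (fun v b ↦ ?_) z).symm
  change _ =
    pb (ρ j) (hρ j) (hU j) (globalCoord f (ht j) v ()) * pb ρ₀ hρ₀ h₀ (globalCoord f hg b a)
  refine (congrArg (pb ρ₀ hρ₀ h₀')
    (globalCoord_sectionsMul (hg.mono hD) ((ht j).mono hT) v b a)).trans ?_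
  rw [map_mul, globalCoord_mono, globalCoord_mono, pb_fres, pb_fres,
    pb_congr e]

theorem evalCoord_eq_zero {T : Fin n → X.Opens} {t : ∀ i, Γ(L, T i)}
    (ht : ∀ i, IsBasis L fun _ : Unit ↦ t i) {ρ : Fin n → (Y ⟶ X)} (hρ : ∀ i, ρ i ≫ f = h)
    (hU : ∀ i, U ≤ ρ i ⁻¹ᵁ T i) (j : Fin n) (e : ρ j = ρ₀)
    {z : globalSections f M ⊗[k] (⨂[k]^n (globalSections f L))}
    (hz : IsContrClosed (sectionsMul f L M) z) : evalCoord hg a hρ₀ h₀ ht hρ hU z = 0 := by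
  cases n with
  | zero => exact j.elim0
  | succ n =>
    rw [evalCoord_contr hg a hρ₀ h₀ ht hρ hU j e (inf_le_left : D ⊓ T j ≤ D) inf_le_right
      (le_inf h₀ (e ▸ hU j)), hz j, map_zero]

end Contraction

/-! ### Local solutions near the last diagonal -/

section LocalSections

variable {k : Type u} [Field k] {X : Scheme.{u}} {f : X ⟶ Spec (CommRingCat.of k)}
  {A L : X.Modules} {n N : ℕ} {W : X.Opens}

variable (f n W) in
/-- The points of `X(n + 2)` whose first and last coordinates are in `W`. -/
def lastSlab : (power f (n + 2)).Opens :=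
  proj f (n + 2) 0 ⁻¹ᵁ W ⊓ proj f (n + 2) (Fin.last n).succ ⁻¹ᵁ W

theorem lastSlab_le_zero : lastSlab f n W ≤ proj f (n + 2) 0 ⁻¹ᵁ W := inf_le_left

theorem lastSlab_le_last : lastSlab f n W ≤ proj f (n + 2) (Fin.last n).succ ⁻¹ᵁ W := inf_le_right

/-- The section `∑ b ⊠ v₁ ⊠ ⋯ ⊠ vₙ ⊠ l`. -/
def localSection (l : Γ(L, W)) (b : Fin N → Γ(A, W)) (v : Fin N → Fin n → globalSections f L) :
    Γ(boxTensor f (n + 2) (consFamily A L (n + 1)), lastSlab f n W) :=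
  ∑ α, boxCons (F := consFamily A L (n + 1))
    (Fin.lastCases (motive := fun i : Fin (n + 1) ↦
      Γ((Scheme.Modules.pullback (proj f (n + 2) i.succ)).obj L, lastSlab f n W))
      (pullTo (proj f (n + 2) (Fin.last n).succ) lastSlab_le_last l)
      fun i ↦ pullTo (W := ⊤) (proj f (n + 2) i.castSucc.succ) (fun _ _ ↦ trivial) (v α i))
    (pullTo (M := A) (proj f (n + 2) 0) lastSlab_le_zero (b α))

variable {W₀ : X.Opens} {T : Fin (n + 1) → X.Opens} {U : (power f (n + 2)).Opens}
  (h0 : U ≤ proj f (n + 2) 0 ⁻¹ᵁ W₀) (h1 : ∀ i : Fin (n + 1), U ≤ proj f (n + 2) i.succ ⁻¹ᵁ T i)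
  (hW : W₀ ≤ W) (hT : T (Fin.last n) ≤ W)

include h0 h1 hW hT in
theorem le_lastSlab : U ≤ lastSlab f n W :=
  le_inf (h0.trans (Scheme.Hom.preimage_mono _ hW))
    ((h1 (Fin.last n)).trans (Scheme.Hom.preimage_mono _ hT))

theorem res_localSection (l : Γ(L, W)) (b : Fin N → Γ(A, W))
    (v : Fin N → Fin n → globalSections f L) :
    res _ (le_lastSlab h0 h1 hW hT) (localSection l b v) =
      ∑ α, boxCons (F := consFamily A L (n + 1)) (fun i : Fin (n + 1) ↦
        pullTo (M := L) (proj f (n + 2) i.succ) (h1 i) (Fin.lastCases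
          (motive := fun i : Fin (n + 1) ↦ Γ(L, T i)) (res L hT l)
          (fun i ↦ res L le_top (show Γ(L, ⊤) from v α i)) i))
        (pullTo (M := A) (proj f (n + 2) 0) h0 (res A hW (b α))) := by
  rw [localSection, map_sum]
  refine Finset.sum_congr rfl fun α _ ↦ ?_
  refine (res_boxCons _ _ _).trans ?_
  congr 1
  · congr 1
    funext i
    cases i using Fin.lastCases with
    | last =>
      simp only [Fin.lastCases_last]
      exact (res_pullTo _ _ _ _).trans (pullTo_res _ _ _ _).symm
    | cast i =>
      simp only [Fin.lastCases_castSucc]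
      exact (res_pullTo _ _ _ _).trans (pullTo_res _ _ _ _).symm
  · exact (res_pullTo _ _ _ _).trans (pullTo_res _ _ _ _).symm

theorem globalCoord_of_eq_tmul {κ : Type} [Fintype κ] {e : κ → Γ(A, W)} (he : IsBasis A e)
    {g : Unit → Γ(L, W)} (hg : IsBasis L g) {b : globalSections f (tensor A L)} {s : Γ(A, W)}
    {r : Γ(L, W)} (hb : res (tensor A L) le_top (show Γ(tensor A L, ⊤) from b) = tmul s r) (a : κ) :
    globalCoord f (he.tmul hg) b a = he.coord le_rfl s a * hg.coord le_rfl r () :=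
  (congrArg (fun z ↦ (he.tmul hg).coord le_rfl z a) hb).trans (he.coord_tmul hg le_rfl s r a)

/-- The coordinates split into those of the tensor `∑ b ⊗ v`, computed with the basis `e ⊗ l` of `A
⊗ L`, and one function of the last coordinate. The first factor gives vanishing on the other
diagonals; the second corrects the choice of `l` on the last one. -/
theorem coord_localSection {κ : Type} [Fintype κ] {e : κ → Γ(A, W₀)} (he : IsBasis A e)
    {t : ∀ i, Γ(L, T i)} (ht : ∀ i, IsBasis L fun _ : Unit ↦ t i)
    {E : κ → Γ(boxTensor f (n + 2) (consFamily A L (n + 1)), U)}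
    (hE : IsBasis (boxTensor f (n + 2) (consFamily A L (n + 1))) E)
    (hEe : ∀ a, E a = boxCons (F := consFamily A L (n + 1)) (fun i : Fin (n + 1) ↦
      pullTo (M := L) (proj f (n + 2) i.succ) (h1 i) (t i))
        (pullTo (M := A) (proj f (n + 2) 0) h0 (e a)))
    {l : Γ(L, W)} (hl : IsBasis L fun _ : Unit ↦ l) {b : Fin N → globalSections f (tensor A L)}
    {b' : Fin N → Γ(A, W)}
    (hb : ∀ α, res (tensor A L) le_top (show Γ(tensor A L, ⊤) from b α) = tmul (b' α) l)
    (v : Fin N → Fin n → globalSections f L) (a : κ) :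
    (hE.coord le_rfl (res _ (le_lastSlab h0 h1 hW hT) (localSection l b' v)) a :
        Fn (str f (n + 1)) U) =
      evalCoord (he.tmul (hl.mono hW)) a (proj_str f _ 0) h0 (fun i : Fin n ↦ ht i.castSucc)
        (fun i ↦ proj_str f _ i.castSucc.succ) (fun i ↦ h1 i.castSucc)
        (∑ α, b α ⊗ₜ PiTensorProduct.tprod k (v α)) *
          pb (proj f (n + 2) (Fin.last n).succ) (proj_str f _ _) (h1 (Fin.last n))
            ((ht (Fin.last n)).coord le_rfl (res L hT l) ()) := by
  have h2 (α : Fin N) := coord_boxCons (F := consFamily A L (n + 1)) h0 h1 he ht hE hEe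
    (res A hW (b' α)) (Fin.lastCases (motive := fun i : Fin (n + 1) ↦ Γ(L, T i)) (res L hT l)
          (fun i ↦ res L le_top (show Γ(L, ⊤) from v α i)))
  have h3 (α : Fin N) : globalCoord f (he.tmul (hl.mono hW)) (b α) a =
      he.coord le_rfl (res A hW (b' α)) a := by
    refine (globalCoord_of_eq_tmul he (hl.mono hW) (s := res A hW (b' α)) (r := res L hW l) ?_
      a).trans ?_
    · rw [← res_tmul, ← hb, res_res]
    · have h4 : (hl.mono hW).coord le_rfl (res L hW l) = fun _ ↦ 1 :=
        (hl.mono hW).coord_eq le_rfl (by simp)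
      rw [h4]
      exact mul_one _
  rw [res_localSection, map_sum, Finset.sum_apply, map_sum, Finset.sum_mul]
  refine Finset.sum_congr rfl fun α _ ↦ ?_
  rw [evalCoord_tmul, h3]
  refine (congr_fun (h2 α) a).trans ?_
  rw [Fin.prod_univ_castSucc]
  simp only [Fin.lastCases_last, Fin.lastCases_castSucc]
  refine (mul_comm _ _).trans (mul_assoc _ _ _).symm

end LocalSections

/-! ### Changing the local generator of `L` -/

section ChangeOfGenerator

variable {k : Type u} [Field k] {X : Scheme.{u}} {f : X ⟶ Spec (CommRingCat.of k)}
  {A L : X.Modules} {κ : Type} [Fintype κ]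

theorem coord_tmul_change {D : X.Opens} {e : κ → Γ(A, D)} (he : IsBasis A e) {l t : Unit → Γ(L, D)}
    (hl : IsBasis L l) (ht : IsBasis L t) (s : Γ(tensor A L, D)) (a : κ) :
    (he.tmul ht).coord le_rfl s a =
      (he.tmul hl).coord le_rfl s a * ht.coord le_rfl (l ()) () := by
  refine congr_fun ((he.tmul ht).coord_eq le_rfl (c := fun a ↦
    (he.tmul hl).coord le_rfl s a * ht.coord le_rfl (l ()) ()) ?_) a
  have h : l () = ht.coord le_rfl (l ()) () • t () := by
    conv_lhs => rw [← ht.sum_coord le_rfl (l ())]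
    simp
  conv_lhs => rw [← (he.tmul hl).sum_coord le_rfl s]
  refine Finset.sum_congr rfl fun a _ ↦ ?_
  rw [res_self, res_self, mul_smul]
  exact congrArg (_ • ·) ((congrArg (tmul (e a)) h).trans (tmul_smul _ _ _))

theorem globalCoord_tmul_mono {D D' : X.Opens} (h : D' ≤ D) {e : κ → Γ(A, D)} (he : IsBasis A e)
    {l : Unit → Γ(L, D)} (hl : IsBasis L l) (b : globalSections f (tensor A L)) (a : κ) :
    globalCoord f ((he.mono h).tmul (hl.mono h)) b a = fres h (globalCoord f (he.tmul hl) b a) := by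
  rw [← globalCoord_mono]
  exact congr_fun (IsBasis.coord_congr ((he.mono h).tmul (hl.mono h)) ((he.tmul hl).mono h)
    (funext fun a ↦ (res_tmul h _ _).symm) le_rfl _) a

theorem evalCoord_change {M : X.Modules} {n : ℕ} {Y : Scheme.{u}}
    {h : Y ⟶ Spec (CommRingCat.of k)} {U : Y.Opens} {D D' : X.Opens} {g : κ → Γ(M, D)}
    (hg : IsBasis M g) {g' : κ → Γ(M, D')} (hg' : IsBasis M g') (a : κ) {ρ₀ : Y ⟶ X}
    (hρ₀ : ρ₀ ≫ f = h) (h₀ : U ≤ ρ₀ ⁻¹ᵁ D) (h₀' : U ≤ ρ₀ ⁻¹ᵁ D') {T : Fin n → X.Opens}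
    {t : ∀ i, Γ(L, T i)} (ht : ∀ i, IsBasis L fun _ : Unit ↦ t i) {ρ : Fin n → (Y ⟶ X)}
    (hρ : ∀ i, ρ i ≫ f = h) (hU : ∀ i, U ≤ ρ i ⁻¹ᵁ T i) (c : Fn h U)
    (hc : ∀ b, pb ρ₀ hρ₀ h₀' (globalCoord f hg' b a) = pb ρ₀ hρ₀ h₀ (globalCoord f hg b a) * c)
    (z : globalSections f M ⊗[k] (⨂[k]^n (globalSections f L))) :
    evalCoord hg' a hρ₀ h₀' ht hρ hU z = evalCoord hg a hρ₀ h₀ ht hρ hU z * c := by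
  refine LinearMap.congr_fun (g := LinearMap.mulRight k c ∘ₗ evalCoord hg a hρ₀ h₀ ht hρ hU)
    (tensorPower_hom_ext fun b v ↦ ?_) z
  rw [LinearMap.comp_apply, LinearMap.mulRight_apply, evalCoord_tmul, evalCoord_tmul, hc,
    mul_right_comm]

theorem globalCoord_tmul_change {W W₀ T : X.Opens} (hW : W₀ ≤ W) (hT : T ≤ W) {e : κ → Γ(A, W₀)}
    (he : IsBasis A e) {l : Γ(L, W)} (hl : IsBasis L fun _ : Unit ↦ l) {t : Γ(L, T)}
    (ht : IsBasis L fun _ : Unit ↦ t) {c : Fn f T} (hc : ht.coord le_rfl (res L hT l) () = c)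
    (b : globalSections f (tensor A L)) (a : κ) :
    globalCoord f ((he.mono (inf_le_left : W₀ ⊓ T ≤ W₀)).tmul (ht.mono inf_le_right)) b a =
      fres inf_le_left (globalCoord f (he.tmul (hl.mono hW)) b a) *
        fres (inf_le_right : W₀ ⊓ T ≤ T) c := by
  rw [← globalCoord_tmul_mono inf_le_left he (hl.mono hW)]
  have h1 := coord_tmul_change (he.mono (inf_le_left : W₀ ⊓ T ≤ W₀))
    (l := fun _ ↦ res L (inf_le_left : W₀ ⊓ T ≤ W₀) (res L hW l))
    ((hl.mono hW).mono inf_le_left) (ht.mono inf_le_right)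
    (res (tensor A L) le_top (show Γ(tensor A L, ⊤) from b)) a
  refine h1.trans (congrArg (_ * ·) ?_)
  refine Eq.trans ?_ (fres_apply (inf_le_right : W₀ ⊓ T ≤ T) c).symm
  have h := congr_fun (ht.coord_res le_rfl (inf_le_right : W₀ ⊓ T ≤ T) (res L hT l)) ()
  rw [res_res] at h
  rw [IsBasis.coord_mono, res_res, ← hc]
  exact h

end ChangeOfGenerator

/-! ### Restricting the local solutions to the diagonals -/

section Diagonals

variable {k : Type u} [Field k] {X : Scheme.{u}} {f : X ⟶ Spec (CommRingCat.of k)}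
  {A L : X.Modules} {n N : ℕ} {W : X.Opens}
  (hA : ∀ x : X, ∃ (U : X.Opens) (r : ℕ) (e : Fin r → Γ(A, U)), x ∈ U ∧ IsBasis A e)
  (hL : ∀ x : X, ∃ (U : X.Opens) (e : Unit → Γ(L, U)), x ∈ U ∧ IsBasis L e)

theorem diag_last_proj (i : Fin n) :
    diag f (Fin.last n) ≫ proj f (n + 2) i.castSucc.succ = proj f (n + 1) i.succ := by
  have h := diag_proj_succAbove f (Fin.last n) i.succ
  rwa [Fin.succ_succAbove_succ, Fin.succAbove_last] at h

theorem proj_diag_zero (j : Fin (n + 1)) (x : power f (n + 1)) :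
    proj f (n + 2) 0 (diag f j x) = proj f (n + 1) 0 x :=
  congr($(diag_proj_zero f j) x)

theorem app_eq_pb {P Y : Scheme.{u}} {h : P ⟶ Spec (CommRingCat.of k)}
    {h' : Y ⟶ Spec (CommRingCat.of k)} (σ : Y ⟶ P) (hσ : σ ≫ h = h') (U : P.Opens) (r : Γ(P, U)) :
    σ.app U r = pb σ hσ le_rfl (r : Fn h U) := by
  refine Eq.trans ?_ (pb_apply σ hσ le_rfl _).symm
  rw [Scheme.Hom.app_eq_appLE]

include hA hL in
-- A box around `x` on which `A` has a basis in the first factor and `L` a generator in each other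
-- factor. Only the first and last factors are shrunk into `W`, since `l` and `b'` live there while
-- the `v α i` are global.
theorem exists_chart {x : power f (n + 2)} (hx : x ∈ lastSlab f n W) :
    ∃ (W₀ : X.Opens) (T : Fin (n + 1) → X.Opens) (U : (power f (n + 2)).Opens)
      (_ : U ≤ proj f (n + 2) 0 ⁻¹ᵁ W₀) (_ : ∀ i : Fin (n + 1), U ≤ proj f (n + 2) i.succ ⁻¹ᵁ T i)
      (_ : W₀ ≤ W) (_ : T (Fin.last n) ≤ W) (r : ℕ) (e : Fin r → Γ(A, W₀)) (t : ∀ i, Γ(L, T i)),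
      x ∈ U ∧ IsBasis A e ∧ ∀ i, IsBasis L fun _ : Unit ↦ t i := by
  obtain ⟨W₁, r, e, hxW, he⟩ := hA (proj f (n + 2) 0 x)
  choose T t hxT ht using fun i : Fin (n + 1) ↦ hL (proj f (n + 2) i.succ x)
  let T' (i : Fin (n + 1)) : X.Opens := T i ⊓ if i = Fin.last n then W else ⊤
  refine ⟨W₁ ⊓ W, T', box (Fin.cons (W₁ ⊓ W) T'), box_le (Fin.cons (W₁ ⊓ W) T') 0,
    fun i ↦ box_le (Fin.cons (W₁ ⊓ W) T') i.succ, inf_le_right, inf_le_right.trans (by simp), r,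
    _, fun i ↦ res L inf_le_left (t i ()), mem_box.2 fun i ↦ ?_, he.mono inf_le_left,
    fun i ↦ (ht i).mono inf_le_left⟩
  cases i using Fin.cases with
  | zero => exact ⟨hxW, hx.1⟩
  | succ i =>
    refine ⟨hxT i, ?_⟩
    by_cases h : i = Fin.last n
    · subst h
      rw [if_pos rfl]
      exact hx.2
    · rw [if_neg h]
      trivial

section

variable {l : Γ(L, W)} (hl : IsBasis L fun _ : Unit ↦ l)
  {b : Fin N → globalSections f (tensor A L)} {b' : Fin N → Γ(A, W)}
  (hb : ∀ α, res (tensor A L) le_top (show Γ(tensor A L, ⊤) from b α) = tmul (b' α) l)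
  (v : Fin N → Fin n → globalSections f L)

include hA hL hl hb in
-- On this diagonal the coordinate factor coming from the tensor is an evaluation of its `j`-th
-- contraction, which is zero.
theorem pull_localSection_eq_zero (hz : IsContrClosed (sectionsMul f L (tensor A L))
      (∑ α, b α ⊗ₜ PiTensorProduct.tprod k (v α))) (j : Fin n) :
    pull (diag f j.castSucc) _ (lastSlab f n W) (localSection l b' v) = 0 := by
  refine pull_eq_zero_of_locally _ fun y hy ↦ ?_
  obtain ⟨W₀, T, U, h0, h1, hW, hT, r, e, t, hyU, he, ht⟩ := exists_chart hA hL hy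
  refine ⟨U, le_lastSlab h0 h1 hW hT, hyU, ?_⟩
  have hE := isBasis_boxCons (F := consFamily A L (n + 1)) h0 h1 he ht
  refine (pull_eq_zero_iff _ hE _).2 fun a ↦ ?_
  refine (app_eq_pb _ (diag_str f _) U _).trans ?_
  refine (congrArg (pb (diag f j.castSucc) (diag_str f _) le_rfl)
    (coord_localSection h0 h1 hW hT he ht hE (fun _ ↦ rfl) hl hb v a)).trans ?_
  rw [map_mul, pb_evalCoord, evalCoord_eq_zero _ _ _ _ _ _ _ j
    ((diag_proj_same f j.castSucc).trans (diag_proj_zero f j.castSucc).symm) hz, zero_mul]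
  rfl

include hl hb in
-- On the last diagonal the first and last coordinates agree, so the coordinate of `l` with respect
-- to `t` is exactly the factor that passes from `e ⊗ l` to `e ⊗ t`. What remains is the evaluation
-- of the original tensor, with no trace of `l`.
theorem pb_diag_last_coord_localSection {W₀ : X.Opens} {T : Fin (n + 1) → X.Opens}
    {U : (power f (n + 2)).Opens} (h0 : U ≤ proj f (n + 2) 0 ⁻¹ᵁ W₀)
    (h1 : ∀ i : Fin (n + 1), U ≤ proj f (n + 2) i.succ ⁻¹ᵁ T i) (hW : W₀ ≤ W)
    (hT : T (Fin.last n) ≤ W) {κ : Type} [Fintype κ] {e : κ → Γ(A, W₀)} (he : IsBasis A e)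
    {t : ∀ i, Γ(L, T i)} (ht : ∀ i, IsBasis L fun _ : Unit ↦ t i)
    {E : κ → Γ(boxTensor f (n + 2) (consFamily A L (n + 1)), U)}
    (hE : IsBasis (boxTensor f (n + 2) (consFamily A L (n + 1))) E)
    (hEe : ∀ a, E a = boxCons (F := consFamily A L (n + 1)) (fun i : Fin (n + 1) ↦
      pullTo (M := L) (proj f (n + 2) i.succ) (h1 i) (t i))
        (pullTo (M := A) (proj f (n + 2) 0) h0 (e a))) (a : κ)
    {V : (power f (n + 1)).Opens} (hV : V ≤ diag f (Fin.last n) ⁻¹ᵁ U)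
    (h0' : V ≤ proj f (n + 1) 0 ⁻¹ᵁ (W₀ ⊓ T (Fin.last n)))
    (h1' : ∀ i : Fin n, V ≤ proj f (n + 1) i.succ ⁻¹ᵁ T i.castSucc) :
    pb (diag f (Fin.last n)) (diag_str f _) hV (hE.coord le_rfl
        (res _ (le_lastSlab h0 h1 hW hT) (localSection l b' v)) a : Fn (str f (n + 1)) U) =
      evalCoord ((he.mono inf_le_left).tmul ((ht (Fin.last n)).mono inf_le_right)) a
        (proj_str f _ 0) h0' (fun i : Fin n ↦ ht i.castSucc) (fun i ↦ proj_str f _ i.succ) h1'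
        (∑ α, b α ⊗ₜ PiTensorProduct.tprod k (v α)) := by
  -- `c` is the coordinate of `l` in terms of the generator `t (Fin.last n)`.
  have key (c : Fn f (T (Fin.last n))) (hc : (ht (Fin.last n)).coord le_rfl (res L hT l) () = c) :
      pb (diag f (Fin.last n)) (diag_str f _) hV (evalCoord (he.tmul (hl.mono hW)) a
        (proj_str f _ 0) h0 (fun i : Fin n ↦ ht i.castSucc)
        (fun i ↦ proj_str f _ i.castSucc.succ) (fun i ↦ h1 i.castSucc)
        (∑ α, b α ⊗ₜ PiTensorProduct.tprod k (v α)) *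
          pb (proj f (n + 2) (Fin.last n).succ) (proj_str f _ _) (h1 (Fin.last n)) c) =
      evalCoord ((he.mono inf_le_left).tmul ((ht (Fin.last n)).mono inf_le_right)) a
        (proj_str f _ 0) h0' (fun i : Fin n ↦ ht i.castSucc) (fun i ↦ proj_str f _ i.succ) h1'
        (∑ α, b α ⊗ₜ PiTensorProduct.tprod k (v α)) := by
    rw [map_mul, pb_evalCoord, evalCoord_congr _ _ _ _ _ _ _ (diag_proj_zero f (Fin.last n))
      (funext diag_last_proj)]
    refine (evalCoord_change _ _ _ _ _ _ _ _ _ _ (fun b ↦ ?_) _).symm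
    rw [globalCoord_tmul_change hW hT he hl (ht (Fin.last n)) hc, map_mul, pb_fres, pb_fres, pb_pb,
      pb_congr (diag_proj_same f (Fin.last n))]
  refine (congrArg (pb (diag f (Fin.last n)) (diag_str f _) hV)
    (coord_localSection h0 h1 hW hT he ht hE hEe hl hb v a)).trans (key _ rfl)

include hA hL hl hb in
theorem pull_diag_last_localSection {W' : X.Opens} {l' : Γ(L, W')}
    (hl' : IsBasis L fun _ : Unit ↦ l') {b'' : Fin N → Γ(A, W')}
    (hb' : ∀ α, res (tensor A L) le_top (show Γ(tensor A L, ⊤) from b α) = tmul (b'' α) l') :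
    pull (diag f (Fin.last n)) _ (lastSlab f n W ⊓ lastSlab f n W')
        (res _ inf_le_left (localSection l b' v)) =
      pull (diag f (Fin.last n)) _ (lastSlab f n W ⊓ lastSlab f n W')
        (res _ inf_le_right (localSection l' b'' v)) := by
  rw [← sub_eq_zero, ← map_sub]
  refine pull_eq_zero_of_locally _ fun y hy ↦ ?_
  obtain ⟨W₀, T, U, h0, h1, hW, hT, r, e, t, hyU, he, ht⟩ := exists_chart (W := W ⊓ W') hA hL
    (x := diag f (Fin.last n) y) ⟨⟨hy.1.1, hy.2.1⟩, ⟨hy.1.2, hy.2.2⟩⟩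
  refine ⟨U, le_inf (le_lastSlab h0 h1 (hW.trans inf_le_left) (hT.trans inf_le_left))
    (le_lastSlab h0 h1 (hW.trans inf_le_right) (hT.trans inf_le_right)), hyU, ?_⟩
  have hE := isBasis_boxCons (F := consFamily A L (n + 1)) h0 h1 he ht
  refine (pull_eq_zero_iff _ hE _).2 fun a ↦ ?_
  rw [map_sub, map_sub, res_res, res_res, Pi.sub_apply, map_sub, sub_eq_zero]
  have h2 : diag f (Fin.last n) ⁻¹ᵁ U ≤ proj f (n + 1) 0 ⁻¹ᵁ (W₀ ⊓ T (Fin.last n)) := fun x hx ↦ by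
    have h3 := h0 hx
    have h4 := h1 (Fin.last n) hx
    change proj f (n + 2) (Fin.last n).succ _ ∈ T (Fin.last n) at h4
    rw [proj_diag_same] at h4
    change proj f (n + 2) 0 _ ∈ W₀ at h3
    rw [proj_diag_zero] at h3
    exact ⟨h3, h4⟩
  have h3 (i : Fin n) : diag f (Fin.last n) ⁻¹ᵁ U ≤ proj f (n + 1) i.succ ⁻¹ᵁ T i.castSucc := by
    rw [← diag_last_proj]
    exact Scheme.Hom.preimage_mono _ (h1 i.castSucc)
  refine (app_eq_pb _ (diag_str f _) U _).trans (Eq.trans ?_ (app_eq_pb _ (diag_str f _) U _).symm)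
  exact (pb_diag_last_coord_localSection hl hb v h0 h1 (hW.trans inf_le_left)
    (hT.trans inf_le_left) he ht hE (fun _ ↦ rfl) a le_rfl h2 h3).trans
    (pb_diag_last_coord_localSection hl' hb' v h0 h1 (hW.trans inf_le_right)
    (hT.trans inf_le_right) he ht hE (fun _ ↦ rfl) a le_rfl h2 h3).symm

end

end Diagonals

theorem exists_sum_tmul_tprod {k : Type u} [Field k] {B V : Type u} [AddCommGroup B] [Module k B]
    [AddCommGroup V] [Module k V] {n : ℕ} (z : B ⊗[k] (⨂[k]^n V)) :
    ∃ (N : ℕ) (b : Fin N → B) (v : Fin N → Fin n → V),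
      z = ∑ α, b α ⊗ₜ PiTensorProduct.tprod k (v α) := by
  let S := Submodule.span k {z : B ⊗[k] (⨂[k]^n V) | ∃ (b : B) (v : Fin n → V), z = b ⊗ₜ PiTensorProduct.tprod k v}
  have h : S.mkQ = 0 := tensorPower_hom_ext fun b v ↦
    (Submodule.Quotient.mk_eq_zero S).2 (Submodule.subset_span ⟨b, v, rfl⟩)
  have hz : z ∈ S := (Submodule.Quotient.mk_eq_zero S).1 (LinearMap.congr_fun h z)
  obtain ⟨N, c, g, hg⟩ := Submodule.mem_span_set'.1 hz
  choose b v hbv using fun α ↦ (g α).2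
  exact ⟨N, fun α ↦ c α • b α, v, by simp only [← hg, hbv, TensorProduct.smul_tmul']⟩

/-! ### The global solution and its tensor -/

section Diagonals

variable {k : Type u} [Field k] {X : Scheme.{u}} {f : X ⟶ Spec (CommRingCat.of k)}
  {A L : X.Modules} {n : ℕ}

theorem box_le_diag_preimage (W : X.Opens) (j : Fin (n + 1)) :
    box (f := f) (fun _ : Fin (n + 1) ↦ W) ≤ diag f j ⁻¹ᵁ box fun _ ↦ W := fun x hx ↦ by
  refine mem_box.2 fun i ↦ ?_
  cases i using j.succ.succAboveCases with
  | x => rw [proj_diag_same]; exact mem_box.1 hx 0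
  | p i => rw [proj_diag_succAbove]; exact mem_box.1 hx i

theorem pb_diag_evalBox {κ : Type} [Fintype κ] {W : X.Opens} {e : κ → Γ(A, W)} (he : IsBasis A e)
    {g : Γ(L, W)} (hg : IsBasis L fun _ : Unit ↦ g) (j : Fin (n + 1)) (a : κ)
    (y : globalSections f A ⊗[k] (⨂[k]^(n + 1) (globalSections f L))) :
    pb (diag f j) (diag_str f j) (box_le_diag_preimage W j)
        (evalBox (globalCoord f he) (LinearMap.proj () ∘ₗ globalCoord f hg) (n + 1) y a) =
      evalBox (globalCoord f (he.tmul hg)) (LinearMap.proj () ∘ₗ globalCoord f hg) n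
        (contr (sectionsMul f L A) j y) a := by
  refine (pb_evalCoord he a (proj_str f _ 0) (box_le _ 0) (fun _ ↦ hg)
    (fun i : Fin (n + 1) ↦ proj_str f _ i.succ) (fun i ↦ box_le _ i.succ) (diag f j) (diag_str f j)
    (box_le_diag_preimage W j) y).trans ?_
  have h (i : Fin n) : diag f j ≫ proj f (n + 2) (j.succAbove i).succ = proj f (n + 1) i.succ := by
    rw [← Fin.succ_succAbove_succ, diag_proj_succAbove]
  have h0 : box (f := f) (fun _ : Fin (n + 1) ↦ W) ≤ (diag f j ≫ proj f (n + 2) 0) ⁻¹ᵁ W :=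
    (box_le_diag_preimage W j).trans (Scheme.Hom.preimage_mono _ (box_le _ 0))
  refine (evalCoord_contr he a _ _ (fun _ ↦ hg) _ _ j
    ((diag_proj_same f j).trans (diag_proj_zero f j).symm) le_rfl le_rfl h0 y).trans ?_
  refine (evalCoord_congr _ _ _ _ _ _ _ (diag_proj_zero f j) (funext h) _).trans ?_
  exact evalCoord_basis_congr _ _ _ _ _ _ _ (he.tmul hg)
    (funext fun a ↦ by rw [res_self, res_self]) _

theorem isBasis_boxTensor_consFamily
    (hA : ∀ x : X, ∃ (U : X.Opens) (r : ℕ) (e : Fin r → Γ(A, U)), x ∈ U ∧ IsBasis A e)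
    (hL : ∀ x : X, ∃ (U : X.Opens) (e : Unit → Γ(L, U)), x ∈ U ∧ IsBasis L e)
    (x : power f (n + 2)) : ∃ (U : (power f (n + 2)).Opens) (r : ℕ)
      (E : Fin r → Γ(boxTensor f (n + 2) (consFamily A L (n + 1)), U)), x ∈ U ∧ IsBasis _ E := by
  obtain ⟨W₀, T, U, h0, h1, hW, hT, r, e, t, hx, he, ht⟩ :=
    exists_chart (W := ⊤) hA hL (x := x) ⟨trivial, trivial⟩
  exact ⟨U, r, _, hx, isBasis_boxCons (F := consFamily A L (n + 1)) h0 h1 he ht⟩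

/-- The open sets `lastSlab f n (W x)` cover the last diagonal and carry the local solutions; its
complement carries `0`. All of them vanish on the other diagonals and agree on the last, so the
vanishing of `H¹` produces a global section with the same restrictions. -/
theorem exists_section_pull_diag_eq [Flat f] [IsSeparated f]
    (hA : ∀ x : X, ∃ (U : X.Opens) (r : ℕ) (e : Fin r → Γ(A, U)), x ∈ U ∧ IsBasis A e)
    (hL : ∀ x : X, ∃ (U : X.Opens) (e : Unit → Γ(L, U)), x ∈ U ∧ IsBasis L e)
    (hH : Subsingleton (cohomology (tensor (firstDiagonalsIdeal f (n + 2))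
      (boxTensor f (n + 2) (consFamily A L (n + 1)))) 1)) {N : ℕ}
    (b : Fin N → globalSections f (tensor A L)) (v : Fin N → Fin n → globalSections f L)
    (hz : IsContrClosed (sectionsMul f L (tensor A L))
      (∑ α, b α ⊗ₜ PiTensorProduct.tprod k (v α))) :
    ∃ s : Γ(boxTensor f (n + 2) (consFamily A L (n + 1)), ⊤), ∀ x : X, ∃ (W : X.Opens)
      (l : Γ(L, W)) (b' : Fin N → Γ(A, W)), x ∈ W ∧ IsBasis L (fun _ : Unit ↦ l) ∧
        (∀ α, res (tensor A L) le_top (show Γ(tensor A L, ⊤) from b α) = tmul (b' α) l) ∧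
        (∀ j : Fin n, pull (diag f j.castSucc) _ (lastSlab f n W) (res _ le_top s) = 0) ∧
        pull (diag f (Fin.last n)) _ (lastSlab f n W) (res _ le_top s) =
          pull (diag f (Fin.last n)) _ (lastSlab f n W) (localSection l b' v) := by
  choose W l hxW hl using hL
  have hb (x : X) (α : Fin N) : ∃ b' : Γ(A, W x),
      res (tensor A L) le_top (show Γ(tensor A L, ⊤) from b α) = tmul b' (l x ()) := by
    obtain ⟨m, hm⟩ := (bijective_sum_tmul (M := A) (hl x) le_rfl).2
      (res (tensor A L) le_top (show Γ(tensor A L, ⊤) from b α))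
    exact ⟨m (), by rw [← hm]; simp⟩
  choose b' hb' using hb
  have hL (x : X) : ∃ (U : X.Opens) (e : Unit → Γ(L, U)), x ∈ U ∧ IsBasis L e :=
    ⟨W x, l x, hxW x, hl x⟩
  obtain ⟨τ, hτ, hτ'⟩ := exists_firstDiagonalsIdeal_hom f n
  have hcl : IsClosed (Set.range (diag f (Fin.last n))) :=
    (diag f (Fin.last n)).isClosedEmbedding.isClosed_range
  let C : (power f (n + 2)).Opens := ⟨(Set.range (diag f (Fin.last n)))ᶜ, hcl.isOpen_compl⟩
  -- `none` is the complement of the last diagonal, `some x` the neighbourhood built from the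
  -- generator of `L` near `x`.
  let V : Option X → (power f (n + 2)).Opens := fun i ↦ i.elim C fun x ↦ lastSlab f n (W x)
  let m : ∀ i, Γ(boxTensor f (n + 2) (consFamily A L (n + 1)), V i) := fun i ↦
    match i with
    | none => 0
    | some x => localSection (l x ()) (b' x) v
  have h0 (i : Option X) (j : Fin n) : pull (diag f j.castSucc) _ (V i) (m i) = 0 := by
    cases i with
    | none => exact map_zero _
    | some x => exact pull_localSection_eq_zero hA hL (hl x) (hb' x) v hz j
  have hC (y : power f (n + 1)) (hy : y ∈ diag f (Fin.last n) ⁻¹ᵁ C) : False := hy ⟨y, rfl⟩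
  have hV (x : power f (n + 2)) : ∃ i, x ∈ V i := by
    by_cases hx : x ∈ Set.range (diag f (Fin.last n))
    · obtain ⟨y, rfl⟩ := hx
      refine ⟨some (proj f (n + 1) 0 y), ?_, ?_⟩
      · change proj f (n + 2) 0 (diag f (Fin.last n) y) ∈ W _
        rw [proj_diag_zero]
        exact hxW _
      · change proj f (n + 2) (Fin.last n).succ (diag f (Fin.last n) y) ∈ W _
        rw [proj_diag_same]
        exact hxW _
    · exact ⟨none, hx⟩
  have hm (i i' : Option X) (j : Fin (n + 1)) :
      pull (diag f j) _ (V i ⊓ V i') (res _ inf_le_left (m i)) =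
        pull (diag f j) _ (V i ⊓ V i') (res _ inf_le_right (m i')) := by
    cases j using Fin.lastCases with
    | cast j => rw [pull_res, pull_res, h0, h0, map_zero, map_zero]
    | last =>
      match i, i' with
      | none, _ => exact section_ext fun y hy ↦ (hC y hy.1).elim
      | some _, none => exact section_ext fun y hy ↦ (hC y hy.2).elim
      | some x, some x' =>
        exact pull_diag_last_localSection hA hL (hl x) (hb' x) v (hl x') (hb' x')
  obtain ⟨s, hs⟩ := exists_section_of_pull_eq (fun j ↦ diag f j) τ hτ hτ'
    (isBasis_boxTensor_consFamily hA hL) hH V hV m hm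
  exact ⟨s, fun x ↦ ⟨W x, l x (), b' x, hxW x, hl x, hb' x,
    fun j ↦ (hs (some x) j.castSucc).trans (h0 (some x) j), hs (some x) (Fin.last n)⟩⟩

theorem pb_coord_eq_of_pull_eq {P Y : Scheme.{u}} {h : P ⟶ Spec (CommRingCat.of k)}
    {h' : Y ⟶ Spec (CommRingCat.of k)} {σ : Y ⟶ P} (hσ : σ ≫ h = h') {M : P.Modules} {κ : Type}
    [Fintype κ] {U : P.Opens} {E : κ → Γ(M, U)} (hE : IsBasis M E) {m m' : Γ(M, U)}
    (hm : pull σ M U m = pull σ M U m') {V : Y.Opens} (hV : V ≤ σ ⁻¹ᵁ U) (a : κ) :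
    pb σ hσ hV (hE.coord le_rfl m a : Fn h U) = pb σ hσ hV (hE.coord le_rfl m' a : Fn h U) := by
  have h1 := (pull_eq_zero_iff σ hE (m - m')).1 (by rw [map_sub, hm, sub_self]) a
  rw [map_sub, Pi.sub_apply, map_sub, sub_eq_zero] at h1
  have h2 : pb σ hσ le_rfl (hE.coord le_rfl m a : Fn h U) =
      pb σ hσ le_rfl (hE.coord le_rfl m' a : Fn h U) :=
    (app_eq_pb σ hσ U _).symm.trans (h1.trans (app_eq_pb σ hσ U _))
  exact (fres_pb σ hσ le_rfl hV _).symm.trans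
    ((congrArg (fres hV) h2).trans (fres_pb σ hσ le_rfl hV _))

/-- The global section with prescribed restrictions comes from a tensor `y`, and contractions of `y`
are its restrictions to diagonals. Both are compared on a single affine box, where evaluation of
tensors is injective. -/
theorem exists_contr_eq [IsIntegral X] [Flat f] [IsSeparated f]
    (hA : ∀ x : X, ∃ (U : X.Opens) (r : ℕ) (e : Fin r → Γ(A, U)), x ∈ U ∧ IsBasis A e)
    (hL : ∀ x : X, ∃ (U : X.Opens) (e : Unit → Γ(L, U)), x ∈ U ∧ IsBasis L e)
    (hH : Subsingleton (cohomology (tensor (firstDiagonalsIdeal f (n + 2))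
      (boxTensor f (n + 2) (consFamily A L (n + 1)))) 1))
    (z : globalSections f (tensor A L) ⊗[k] (⨂[k]^n (globalSections f L)))
    (hz : IsContrClosed (sectionsMul f L (tensor A L)) z) :
    ∃ y : globalSections f A ⊗[k] (⨂[k]^(n + 1) (globalSections f L)),
      (∀ j : Fin n, contr (sectionsMul f L A) j.castSucc y = 0) ∧
        contr (sectionsMul f L A) (Fin.last n) y = z := by
  obtain ⟨N, b, v, rfl⟩ := exists_sum_tmul_tprod z
  obtain ⟨s, hs⟩ := exists_section_pull_diag_eq hA hL hH b v hz
  obtain ⟨x⟩ : Nonempty X := inferInstance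
  obtain ⟨W, l, b', hxW, hl, hb, hs0, hs1⟩ := hs x
  obtain ⟨W', r, e', hxW', he'⟩ := hA x
  obtain ⟨W₀, hW₀, hx, hle⟩ := exists_isAffineOpen_mem_and_subset
    (show x ∈ W ⊓ W' from ⟨hxW, hxW'⟩)
  have hW : W₀ ≤ W := le_trans (b := W ⊓ W') hle inf_le_left
  have he := he'.mono (le_trans (b := W ⊓ W') hle inf_le_right)
  have hg := hl.mono hW
  obtain ⟨y, hy⟩ := exists_evalBox_eq_coord (f := f) (n := n) hW₀ hA hL he hg s
  have hinj : Function.Injective (evalBox (f := f) (globalCoord f (he.tmul hg))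
      (LinearMap.proj () ∘ₗ globalCoord f hg) n) := by
    refine evalBox_injective _ _ hW₀ (globalCoord_injective f (he.tmul hg) (fun x ↦ ?_) ⟨x, hx⟩)
      (fun s t h ↦ globalCoord_injective f hg (fun x ↦ ?_) ⟨x, hx⟩ (funext fun _ ↦ h)) n
    · obtain ⟨U, r, e, hxU, he⟩ := hA x
      obtain ⟨U', e', hxU', he'⟩ := hL x
      exact ⟨U ⊓ U', r, _, ⟨hxU, hxU'⟩, (he.mono inf_le_left).tmul (he'.mono inf_le_right)⟩
    · obtain ⟨U, e, hxU, he⟩ := hL x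
      exact ⟨U, 1, _, hxU, he.reindex (Equiv.ofUnique (Fin 1) Unit)⟩
  have hE := isBasis_boxSection_consFamily (f := f) he hg (n + 1)
  -- Contracting `y` and evaluating on the smaller box is the same as restricting the coordinates of
  -- `s` to the `j`-th diagonal.
  have key (j : Fin (n + 1)) (a : Fin r) : evalBox (globalCoord f (he.tmul hg))
      (LinearMap.proj () ∘ₗ globalCoord f hg) n (contr (sectionsMul f L A) j y) a =
        pb (diag f j) (diag_str f j) (box_le_diag_preimage W₀ j)
          (hE.coord le_rfl (res _ le_top s) a : Fn (str f (n + 1)) (box fun _ ↦ W₀)) :=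
    (pb_diag_evalBox he hg j a y).symm.trans (congrArg (pb (diag f j) (diag_str f j)
      (box_le_diag_preimage W₀ j)) (congr_fun hy a))
  have hV : box (fun _ ↦ W₀) ≤ lastSlab f n W :=
    le_lastSlab (T := fun _ ↦ W₀) (box_le _ 0) (fun i ↦ box_le _ i.succ) hW hW
  refine ⟨y, fun j ↦ hinj (funext fun a ↦ ?_), hinj (funext fun a ↦ ?_)⟩
  · refine (key _ a).trans ((pb_coord_eq_of_pull_eq (diag_str f j.castSucc) hE (m' := 0) ?_
      (box_le_diag_preimage W₀ _) a).trans ?_)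
    · rw [map_zero, ← res_res _ (le_top : lastSlab f n W ≤ ⊤) hV, pull_res, hs0, map_zero]
    · rw [map_zero, map_zero]
      exact map_zero _
  · refine (key _ a).trans ((pb_coord_eq_of_pull_eq (diag_str f (Fin.last n)) hE
      (m' := res _ hV (localSection l b' v)) ?_ (box_le_diag_preimage W₀ _) a).trans ?_)
    · rw [← res_res _ (le_top : lastSlab f n W ≤ ⊤) hV, pull_res, hs1, pull_res]
    · refine (pb_diag_last_coord_localSection hl hb v (box_le _ 0) (fun i ↦ box_le _ i.succ)
        (T := fun _ ↦ W₀) hW hW he (fun _ ↦ hg) hE (fun a ↦ ?_) a (box_le_diag_preimage W₀ _)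
        ((box_le _ 0).trans (Scheme.Hom.preimage_mono _ (le_inf le_rfl le_rfl)))
        fun i ↦ box_le _ i.succ).trans ?_
      -- The basis of the box written with `boxSection` is the one written with `boxCons`; the
      -- factors are compared position by position.
      · refine congrArg boxProd (funext fun i ↦ ?_)
        cases i using Fin.cases <;> rfl
      · refine (evalCoord_basis_congr _ _ _ _ _ _ _ ((he.tmul hg).mono inf_le_left)
          (funext fun a ↦ (res_tmul _ _ _).symm) _).trans ?_
        exact evalCoord_mono _ _ _ (box_le _ 0) _ _ _ _ _ _

end Diagonals

end GreenKoszul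

end

theorem mainTheorem7 {k : Type u} [Field k] [IsAlgClosed k] [CharZero k]
    {X : Scheme.{u}} (f : X ⟶ Spec (CommRingCat.of k))
    [IsIntegral X] [Smooth f] (hX : GreenKoszul.IsProjective f)
    (L E : X.Modules) (hL : GreenKoszul.IsLineBundle L) (hE : GreenKoszul.IsVectorBundle E)
    (p : ℕ)
    (H : ∀ (r : ℕ) [NeZero r], 2 ≤ r → r ≤ p + 2 → ∀ m : ℕ, 1 ≤ m →
      Subsingleton (GreenKoszul.cohomology
        (GreenKoszul.tensor (GreenKoszul.firstDiagonalsIdeal f r)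
          (GreenKoszul.boxTensor f r
            (fun i ↦ if i = 0 then GreenKoszul.twist E L m else L))) 1)) :
    ∀ q : ℕ, 2 ≤ q → Subsingleton (GreenKoszul.KoszulGroup f E L p q) := by
  intro q hq
  -- The sheaf `A` is `twist E L m`, so that `A ⊗ L` is the twist in degree `q`; `q ≥ 2` gives the
  -- `m ≥ 1` needed in `H`.
  obtain ⟨m, rfl⟩ : ∃ m, q = m + 1 := ⟨q - 1, by omega⟩
  have _ : IsSeparated f := hX.isSeparated.1
  have hL' (x : X) := hL.exists_isBasis x
  have hA (x : X) : ∃ (U : X.Opens) (r : ℕ) (e : Fin r → Γ(GreenKoszul.twist E L m, U)),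
      x ∈ U ∧ GreenKoszul.IsBasis (GreenKoszul.twist E L m) e := by
    obtain ⟨U, r, e, hx, he⟩ := hE.exists_isBasis x
    obtain ⟨U', l, hx', hl⟩ := hL' x
    obtain ⟨e', he'⟩ := (he.mono inf_le_left).twist (hl.mono (inf_le_right : U ⊓ U' ≤ U')) m
    exact ⟨U ⊓ U', r, e', ⟨hx, hx'⟩, he'⟩
  have hF : (fun i : Fin (p + 2) ↦ if i = 0 then GreenKoszul.twist E L m else L) =
      GreenKoszul.consFamily (GreenKoszul.twist E L m) L (p + 1) := by
    funext i
    cases i using Fin.cases <;> simp [GreenKoszul.consFamily]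
  -- The factors of `X(p + 2)` are one for `A`, `p` for the exterior factors of the cycle, and one
  -- for the extra factor of the chain that bounds it.
  have hH := H (p + 2) (by omega) le_rfl m (by omega)
  rw [hF] at hH
  exact GreenKoszul.subsingleton_koszulCohomology _ p m fun z hz ↦
    GreenKoszul.exists_contr_eq hA hL' hH z hz
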